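/- **Setting.** Let $d\ge 2$ and let $G=\mathrm{SO}^\circ(d,1)$, the group of orientation-preserving isometries of real hyperbolic space $\mathbb H^d$. Let $\mathcal A=\{a_t:t\in\mathbb R\}<G$ be the one-parameter group whose right translation action induces the geodesic flow on $\mathrm T^1(\mathbb H^d)$, and let $\mathcal U=\{u\in G: a_{-t}ua_t\to e \text{ as } t\to+\infty\}$ be the contracting horospherical subgroup (so $\mathcal U\cong\mathbb R^{d-1}$). Put $$H=\{(h,h):h\in G\},\qquad U=\{(u,u):u\in\mathcal U\},\qquad U_2=\{e\}\times\mathcal U\qquad\text{in } G\times G .$$ Let $\Gamma_1,\Gamma_2<G$ be torsion-free discrete subgroups such that * $\Gamma_1$ is Zariski dense and convex cocompact, that is, $\Gamma_1\backslash\mathrm{hull}(\Lambda_1)$ is compact, where $\Lambda_1\subset\partial\mathbb H^d=\mathbb S^{d-1}$ is the limit set of $\Gamma_1$ and $\mathrm{hull}(\Lambda_1)\subset\mathbb H^d$ is its convex hull; * $\Gamma_2$ is cocompact in $G$. Put $Z_i=\Gamma_i\backslash G$ and $Z=Z_1\times Z_2$, on which $G\times G$ acts by right translations. Let $\mathrm{RF}=\{x\in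 Z_1: x\mathcal A \text{ is bounded, i.e. relatively compact, in } Z_1\}$ and $\Omega=\mathrm{RF}\times Z_2\subset Z$. For a closed $H$-invariant subset $X\subset Z$, a closed $U$-invariant subset $Y\subset X$ is called *$U$-minimal with respect to $\Omega$* if $Y\cap\Omega\neq\emptyset$ and $yU$ is dense in $Y$ for every $y\in Y\cap\Omega$. **Theorem (Invariance by analytic curves).** Let $X$ be a closed $H$-invariant subset of $Z$ and let $Y\subset X$ be a $U$-minimal subset with respect to $\Omega$. Suppose that there exists $y\in Y\cap\Omega$ such that the set $X\setminus yH$ is not closed. Then there exists a real-analytic curve $\mathcal C:[0,1]\to U_2$ with $\mathcal C'(0)\ne0$ such that $$Y\,\mathcal C\subset X,$$ that is, $y\,\mathcal C(t)\in X$ for all $y\in Y$ and all $t\in[0,1]$. -/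

import Mathlib

noncomputable section

open Set Filter Topology

namespace HypDyn

/-! ### The group `SO°(d,1)` and hyperbolic space (hyperboloid model) -/

/-- Indices of the coordinates of `ℝ^{d,1}`: `Sum.inl i` for the `d` positive directions and
`Sum.inr ()` for the negative one. -/
abbrev Idx (d : ℕ) : Type := Fin d ⊕ Unit

/-- The standard quadratic form of signature `(d,1)`. -/
def lorentzForm (d : ℕ) (x : Idx d → ℝ) : ℝ :=
  ∑ i : Fin d, x (Sum.inl i) ^ 2 - x (Sum.inr ()) ^ 2

/-- The upper sheet of the hyperboloid `q = -1`. -/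
def upperSheet (d : ℕ) : Set (Idx d → ℝ) :=
  {x | lorentzForm d x = -1 ∧ 0 < x (Sum.inr ())}

theorem lorentzForm_neg (d : ℕ) (x : Idx d → ℝ) : lorentzForm d (-x) = lorentzForm d x := by
  simp [lorentzForm]

theorem upperSheet_or_neg (d : ℕ) (x : Idx d → ℝ) (hx : lorentzForm d x = -1) :
    x ∈ upperSheet d ∨ -x ∈ upperSheet d := by
  rcases lt_trichotomy (x (Sum.inr ())) 0 with h | h | h
  · exact Or.inr ⟨by rw [lorentzForm_neg, hx], by simpa using h⟩
  · exfalso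
    have h0 : (0 : ℝ) ≤ ∑ i : Fin d, x (Sum.inl i) ^ 2 :=
      Finset.sum_nonneg fun i _ => sq_nonneg _
    rw [lorentzForm, h] at hx
    linarith
  · exact Or.inl ⟨hx, h⟩

/-- The group `SO°(d,1)`: real matrices of determinant `1` that preserve the quadratic form of
signature `(d,1)` and the upper sheet of the hyperboloid. -/
def SO0 (d : ℕ) : Subgroup (Matrix.SpecialLinearGroup (Idx d) ℝ) where
  carrier := {g | (∀ x, lorentzForm d (g.1.mulVec x) = lorentzForm d x) ∧
    ∀ x ∈ upperSheet d, g.1.mulVec x ∈ upperSheet d}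
  one_mem' := by simp
  mul_mem' := by
    rintro g h ⟨hg, hg'⟩ ⟨hh, hh'⟩
    refine ⟨fun x => ?_, fun x hx => ?_⟩
    · rw [Matrix.SpecialLinearGroup.coe_mul, ← Matrix.mulVec_mulVec, hg, hh]
    · rw [Matrix.SpecialLinearGroup.coe_mul, ← Matrix.mulVec_mulVec]
      exact hg' _ (hh' _ hx)
  inv_mem' := by
    rintro g ⟨hg, hg'⟩
    have key : ∀ x, g.1.mulVec ((g⁻¹).1.mulVec x) = x := fun x => by
      rw [Matrix.mulVec_mulVec, ← Matrix.SpecialLinearGroup.coe_mul]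
      simp
    have hq : ∀ x, lorentzForm d ((g⁻¹).1.mulVec x) = lorentzForm d x := fun x => by
      rw [← hg, key]
    refine ⟨hq, fun x hx => ?_⟩
    rcases upperSheet_or_neg d ((g⁻¹).1.mulVec x) (by rw [hq, hx.1]) with h | h
    · exact h
    · exfalso
      have h1 := (hg' _ h).2
      rw [Matrix.mulVec_neg, key] at h1
      have h2 := hx.2
      simp only [Pi.neg_apply] at h1
      linarith

/-- The real hyperbolic space `ℍ^d`, in the hyperboloid model. -/
abbrev HypSpace (d : ℕ) : Type := upperSheet d

instance (d : ℕ) : MulAction (SO0 d) (HypSpace d) where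
  smul g x := ⟨g.1.1.mulVec x.1, g.2.2 x.1 x.2⟩
  one_smul x := Subtype.ext (by
    change (1 : Matrix (Idx d) (Idx d) ℝ).mulVec x.1 = x.1
    simp)
  mul_smul g h x := Subtype.ext (by
    change (g.1.1 * h.1.1).mulVec x.1 = g.1.1.mulVec (h.1.1.mulVec x.1)
    rw [Matrix.mulVec_mulVec])

/-- The base point `o` of `ℍ^d`. -/
def basePoint (d : ℕ) : HypSpace d :=
  ⟨fun i => Sum.elim (fun _ => 0) (fun _ => 1) i, by simp [upperSheet, lorentzForm]⟩

/-! ### The geodesic flow and the contracting horospherical subgroup -/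

/-- The matrix of the hyperbolic translation along the geodesic through `o` with the initial unit
tangent vector `e₀`: it is `cosh t`, `sinh t` on the plane spanned by `o` and `e₀`, and the identity
on the orthogonal complement. -/
def boostMatrix (d : ℕ) [NeZero d] (t : ℝ) : Matrix (Idx d) (Idx d) ℝ :=
  1 + (Real.cosh t - 1) • (Matrix.single (Sum.inl 0) (Sum.inl 0) 1
        + Matrix.single (Sum.inr ()) (Sum.inr ()) 1)
    + Real.sinh t • (Matrix.single (Sum.inl 0) (Sum.inr ()) 1
        + Matrix.single (Sum.inr ()) (Sum.inl 0) 1)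

theorem boostMatrix_add (d : ℕ) [NeZero d] (s t : ℝ) :
    boostMatrix d (s + t) = boostMatrix d s * boostMatrix d t := by
  have e1 : (Matrix.single (Sum.inl 0) (Sum.inl 0) 1
        + Matrix.single (Sum.inr ()) (Sum.inr ()) 1 : Matrix (Idx d) (Idx d) ℝ) *
      (Matrix.single (Sum.inl 0) (Sum.inl 0) 1 + Matrix.single (Sum.inr ()) (Sum.inr ()) 1) =
      Matrix.single (Sum.inl 0) (Sum.inl 0) 1 + Matrix.single (Sum.inr ()) (Sum.inr ()) 1 := by
    simp [mul_add, add_mul]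
  have e2 : (Matrix.single (Sum.inl 0) (Sum.inl 0) 1
        + Matrix.single (Sum.inr ()) (Sum.inr ()) 1 : Matrix (Idx d) (Idx d) ℝ) *
      (Matrix.single (Sum.inl 0) (Sum.inr ()) 1 + Matrix.single (Sum.inr ()) (Sum.inl 0) 1) =
      Matrix.single (Sum.inl 0) (Sum.inr ()) 1 + Matrix.single (Sum.inr ()) (Sum.inl 0) 1 := by
    simp [mul_add, add_mul]
  have e3 : (Matrix.single (Sum.inl 0) (Sum.inr ()) 1
        + Matrix.single (Sum.inr ()) (Sum.inl 0) 1 : Matrix (Idx d) (Idx d) ℝ) *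
      (Matrix.single (Sum.inl 0) (Sum.inl 0) 1 + Matrix.single (Sum.inr ()) (Sum.inr ()) 1) =
      Matrix.single (Sum.inl 0) (Sum.inr ()) 1 + Matrix.single (Sum.inr ()) (Sum.inl 0) 1 := by
    simp [mul_add, add_mul, add_comm]
  have e4 : (Matrix.single (Sum.inl 0) (Sum.inr ()) 1
        + Matrix.single (Sum.inr ()) (Sum.inl 0) 1 : Matrix (Idx d) (Idx d) ℝ) *
      (Matrix.single (Sum.inl 0) (Sum.inr ()) 1 + Matrix.single (Sum.inr ()) (Sum.inl 0) 1) =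
      Matrix.single (Sum.inl 0) (Sum.inl 0) 1 + Matrix.single (Sum.inr ()) (Sum.inr ()) 1 := by
    simp [mul_add, add_mul, add_comm]
  unfold boostMatrix
  generalize (Matrix.single (Sum.inl 0) (Sum.inl 0) 1
        + Matrix.single (Sum.inr ()) (Sum.inr ()) 1 : Matrix (Idx d) (Idx d) ℝ) = P at *
  generalize (Matrix.single (Sum.inl 0) (Sum.inr ()) 1
        + Matrix.single (Sum.inr ()) (Sum.inl 0) 1 : Matrix (Idx d) (Idx d) ℝ) = Q at *
  simp only [add_mul, mul_add, Matrix.smul_mul, Matrix.mul_smul, e1, e2, e3, e4, one_mul, mul_one,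
    Real.cosh_add, Real.sinh_add]
  module

theorem boostMatrix_zero (d : ℕ) [NeZero d] : boostMatrix d 0 = 1 := by
  simp [boostMatrix]

theorem boostMatrix_mulVec_inr (d : ℕ) [NeZero d] (t : ℝ) (x : Idx d → ℝ) :
    (boostMatrix d t).mulVec x (Sum.inr ()) =
      Real.sinh t * x (Sum.inl 0) + Real.cosh t * x (Sum.inr ()) := by
  simp [boostMatrix, Matrix.add_mulVec, Matrix.single_mulVec]
  ring

theorem boostMatrix_mulVec_zero (d : ℕ) [NeZero d] (t : ℝ) (x : Idx d → ℝ) :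
    (boostMatrix d t).mulVec x (Sum.inl 0) =
      Real.cosh t * x (Sum.inl 0) + Real.sinh t * x (Sum.inr ()) := by
  simp [boostMatrix, Matrix.add_mulVec, Matrix.single_mulVec]
  ring

theorem boostMatrix_mulVec_of_ne (d : ℕ) [NeZero d] (t : ℝ) (x : Idx d → ℝ) (i : Fin d)
    (hi : i ≠ 0) : (boostMatrix d t).mulVec x (Sum.inl i) = x (Sum.inl i) := by
  simp [boostMatrix, Matrix.add_mulVec, Matrix.single_mulVec, hi]

theorem lorentzForm_boostMatrix (d : ℕ) [NeZero d] (t : ℝ) (x : Idx d → ℝ) :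
    lorentzForm d ((boostMatrix d t).mulVec x) = lorentzForm d x := by
  unfold lorentzForm
  rw [← Finset.add_sum_erase _ _ (Finset.mem_univ (0 : Fin d)),
    ← Finset.add_sum_erase _ (fun i : Fin d => x (Sum.inl i) ^ 2) (Finset.mem_univ (0 : Fin d)),
    boostMatrix_mulVec_inr, boostMatrix_mulVec_zero]
  have h : ∑ i ∈ Finset.univ.erase (0 : Fin d), (boostMatrix d t).mulVec x (Sum.inl i) ^ 2 =
      ∑ i ∈ Finset.univ.erase (0 : Fin d), x (Sum.inl i) ^ 2 :=
    Finset.sum_congr rfl fun i hi => by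
      rw [boostMatrix_mulVec_of_ne d t x i (Finset.ne_of_mem_erase hi)]
  rw [h]
  linear_combination (x (Sum.inl 0) ^ 2 - x (Sum.inr ()) ^ 2) * Real.cosh_sq_sub_sinh_sq t

theorem boostMatrix_mem_upperSheet (d : ℕ) [NeZero d] (t : ℝ) (x : Idx d → ℝ)
    (hx : x ∈ upperSheet d) : (boostMatrix d t).mulVec x ∈ upperSheet d := by
  refine ⟨by rw [lorentzForm_boostMatrix, hx.1], ?_⟩
  rw [boostMatrix_mulVec_inr]
  have h1 := hx.1
  have h2 := hx.2
  have h3 : x (Sum.inl 0) ^ 2 ≤ ∑ i : Fin d, x (Sum.inl i) ^ 2 :=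
    Finset.single_le_sum (f := fun i : Fin d => x (Sum.inl i) ^ 2)
      (fun i _ => sq_nonneg _) (Finset.mem_univ 0)
  have h4 : |x (Sum.inl 0)| < x (Sum.inr ()) := by
    apply abs_lt_of_sq_lt_sq _ h2.le
    unfold lorentzForm at h1
    linarith
  have h5 := Real.cosh_sq_sub_sinh_sq t
  have h6 : |Real.sinh t| < Real.cosh t :=
    abs_lt_of_sq_lt_sq (by linarith) (Real.cosh_pos t).le
  have h7 : |Real.sinh t * x (Sum.inl 0)| < Real.cosh t * x (Sum.inr ()) := by
    rw [abs_mul]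
    exact mul_lt_mul'' h6 h4 (abs_nonneg _) (abs_nonneg _)
  linarith [(abs_lt.mp h7).1]

theorem boostMatrix_neg (d : ℕ) [NeZero d] (t : ℝ) :
    (1 - (2 : ℝ) • Matrix.single (Sum.inl 0) (Sum.inl 0) 1 : Matrix (Idx d) (Idx d) ℝ) *
      boostMatrix d t * (1 - (2 : ℝ) • Matrix.single (Sum.inl 0) (Sum.inl 0) 1) =
      boostMatrix d (-t) := by
  have e1 : (Matrix.single (Sum.inl 0) (Sum.inl 0) 1 : Matrix (Idx d) (Idx d) ℝ) *
    Matrix.single (Sum.inl 0) (Sum.inl 0) 1 = Matrix.single (Sum.inl 0) (Sum.inl 0) 1 := by simp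
  have e2 : (Matrix.single (Sum.inl 0) (Sum.inl 0) 1 : Matrix (Idx d) (Idx d) ℝ) *
    Matrix.single (Sum.inr ()) (Sum.inr ()) 1 = 0 := by simp
  have e3 : (Matrix.single (Sum.inl 0) (Sum.inl 0) 1 : Matrix (Idx d) (Idx d) ℝ) *
    Matrix.single (Sum.inl 0) (Sum.inr ()) 1 = Matrix.single (Sum.inl 0) (Sum.inr ()) 1 := by simp
  have e4 : (Matrix.single (Sum.inl 0) (Sum.inl 0) 1 : Matrix (Idx d) (Idx d) ℝ) *
    Matrix.single (Sum.inr ()) (Sum.inl 0) 1 = 0 := by simp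
  have e5 : (Matrix.single (Sum.inr ()) (Sum.inr ()) 1 : Matrix (Idx d) (Idx d) ℝ) *
    Matrix.single (Sum.inl 0) (Sum.inl 0) 1 = 0 := by simp
  have e6 : (Matrix.single (Sum.inl 0) (Sum.inr ()) 1 : Matrix (Idx d) (Idx d) ℝ) *
    Matrix.single (Sum.inl 0) (Sum.inl 0) 1 = 0 := by simp
  have e7 : (Matrix.single (Sum.inr ()) (Sum.inl 0) 1 : Matrix (Idx d) (Idx d) ℝ) *
    Matrix.single (Sum.inl 0) (Sum.inl 0) 1 = Matrix.single (Sum.inr ()) (Sum.inl 0) 1 := by simp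
  simp only [boostMatrix, sub_mul, mul_sub, add_mul, mul_add, Matrix.smul_mul, Matrix.mul_smul,
    one_mul, mul_one, e1, e2, e3, e4, e5, e6, e7, Real.cosh_neg, Real.sinh_neg,
    smul_zero, add_zero, zero_add]
  module

theorem det_boostMatrix (d : ℕ) [NeZero d] (t : ℝ) : (boostMatrix d t).det = 1 := by
  have hD : (1 - (2 : ℝ) • Matrix.single (Sum.inl 0) (Sum.inl 0) 1 :
      Matrix (Idx d) (Idx d) ℝ).det *
      (1 - (2 : ℝ) • Matrix.single (Sum.inl 0) (Sum.inl 0) 1 : Matrix (Idx d) (Idx d) ℝ).det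
      = 1 := by
    have h := boostMatrix_neg d 0
    rw [neg_zero, boostMatrix_zero, mul_one] at h
    rw [← Matrix.det_mul, h, Matrix.det_one]
  have hneg : ∀ s, (boostMatrix d (-s)).det = (boostMatrix d s).det := fun s => by
    rw [← boostMatrix_neg, Matrix.det_mul, Matrix.det_mul]
    linear_combination (boostMatrix d s).det * hD
  have h2 : (boostMatrix d (t / 2)).det * (boostMatrix d (t / 2)).det = 1 := by
    nth_rewrite 2 [← hneg]
    rw [← Matrix.det_mul, ← boostMatrix_add, add_neg_cancel, boostMatrix_zero, Matrix.det_one]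
  rw [← Matrix.det_mul, ← boostMatrix_add, add_halves] at h2
  exact h2

/-- The one-parameter group `𝒜 = {a_t}`; right translation by `a_t` is the geodesic flow. -/
def boost (d : ℕ) [NeZero d] (t : ℝ) : SO0 d :=
  ⟨⟨boostMatrix d t, det_boostMatrix d t⟩,
    lorentzForm_boostMatrix d t, boostMatrix_mem_upperSheet d t⟩

theorem boost_add (d : ℕ) [NeZero d] (s t : ℝ) : boost d (s + t) = boost d s * boost d t :=
  Subtype.ext (Subtype.ext (boostMatrix_add d s t))

theorem boost_neg_mul (d : ℕ) [NeZero d] (t : ℝ) : boost d (-t) * boost d t = 1 := by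
  rw [← boost_add, neg_add_cancel]
  exact Subtype.ext (Subtype.ext (boostMatrix_zero d))

/-- The contracting horospherical subgroup `𝒰 = {u : a_{-t} u a_t → e as t → +∞}`. -/
def horospherical (d : ℕ) [NeZero d] : Subgroup (SO0 d) where
  carrier := {u | Tendsto (fun t : ℝ => boost d (-t) * u * boost d t) atTop (𝓝 1)}
  one_mem' := by simp [boost_neg_mul]
  mul_mem' := by
    intro u v hu hv
    have h := Tendsto.mul hu hv
    rw [mul_one] at h
    refine h.congr fun t => ?_
    have e : boost d t * boost d (-t) = 1 := by simpa using boost_neg_mul d (-t)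
    calc boost d (-t) * u * boost d t * (boost d (-t) * v * boost d t)
        = boost d (-t) * u * (boost d t * boost d (-t)) * v * boost d t := by group
      _ = boost d (-t) * (u * v) * boost d t := by rw [e]; group
  inv_mem' := by
    intro u hu
    have h := Tendsto.inv hu
    rw [inv_one] at h
    refine h.congr fun t => ?_
    have e : (boost d t)⁻¹ = boost d (-t) := (eq_inv_of_mul_eq_one_left (boost_neg_mul d t)).symm
    have e' : (boost d (-t))⁻¹ = boost d t := by rw [← e, inv_inv]
    rw [mul_inv_rev, mul_inv_rev, e, e', mul_assoc]

/-! ### Limit sets, convex cocompactness, Zariski density -/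

/-- The projective (Klein) model of `ℍ^d`: a point of the hyperboloid is sent to the open unit ball
of `ℝ^d`. Geodesics become Euclidean segments, and the boundary `∂ℍ^d` becomes the unit sphere. -/
def klein (d : ℕ) (x : HypSpace d) : EuclideanSpace ℝ (Fin d) :=
  WithLp.toLp 2 fun i => x.1 (Sum.inl i) / x.1 (Sum.inr ())

/-- The limit set `Λ ⊆ ∂ℍ^d = 𝕊^{d-1}`: the boundary points in the closure of an orbit. -/
def limitSet {d : ℕ} (Γ : Subgroup (SO0 d)) : Set (EuclideanSpace ℝ (Fin d)) :=
  Metric.sphere 0 1 ∩ closure (range fun γ : Γ => klein d (γ • basePoint d))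

/-- The convex hull in `ℍ^d` of a subset of `∂ℍ^d` (hyperbolic convexity is Euclidean convexity in
the projective model). -/
def hypHull (d : ℕ) (Λ : Set (EuclideanSpace ℝ (Fin d))) : Set (HypSpace d) :=
  {x | klein d x ∈ convexHull ℝ Λ}

/-- `Γ` is convex cocompact: `Γ \ hull(Λ)` is a compact subset of `Γ \ ℍ^d`. -/
def IsConvexCocompact {d : ℕ} (Γ : Subgroup (SO0 d)) : Prop :=
  IsCompact ((Quotient.mk (MulAction.orbitRel Γ (HypSpace d))) '' hypHull d (limitSet Γ))

/-- `Γ` is Zariski dense in `SO°(d,1)`: every polynomial in the matrix entries that vanishes on `Γ`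
vanishes on `SO°(d,1)`. -/
def IsZariskiDense {d : ℕ} (Γ : Subgroup (SO0 d)) : Prop :=
  ∀ p : MvPolynomial (Idx d × Idx d) ℝ,
    (∀ γ ∈ Γ, MvPolynomial.eval (fun ij => γ.1.1 ij.1 ij.2) p = 0) →
      ∀ g : SO0 d, MvPolynomial.eval (fun ij => g.1.1 ij.1 ij.2) p = 0

/-- `Γ` is torsion-free. -/
def IsTorsionFreeSubgroup {G : Type*} [Group G] (Γ : Subgroup G) : Prop :=
  ∀ γ ∈ Γ, IsOfFinOrder γ → γ = 1

/-! ### The homogeneous spaces -/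

/-- The homogeneous space `Γ \ G`, with the quotient topology. -/
abbrev HomSpace {G : Type*} [Group G] (Γ : Subgroup G) : Type _ :=
  Quotient (QuotientGroup.rightRel Γ)

/-- Right translation `(Γx, g) ↦ Γxg` on `Γ \ G`. -/
def translate {G : Type*} [Group G] {Γ : Subgroup G} (x : HomSpace Γ) (g : G) : HomSpace Γ :=
  Quotient.map (fun y : G => y * g)
    (fun a b h => by
      change (QuotientGroup.rightRel Γ) _ _ at h
      change (QuotientGroup.rightRel Γ) _ _
      rw [QuotientGroup.rightRel_apply] at h ⊢
      simpa [mul_assoc] using h) x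

/-- The right action of `G × G` on `Z = (Γ₁ \ G) × (Γ₂ \ G)`. -/
def act {G : Type*} [Group G] {Γ₁ Γ₂ : Subgroup G} (z : HomSpace Γ₁ × HomSpace Γ₂) (g : G × G) :
    HomSpace Γ₁ × HomSpace Γ₂ :=
  (translate z.1 g.1, translate z.2 g.2)

/-- `H = {(h, h) : h ∈ G}`. -/
def diagH (d : ℕ) : Subgroup (SO0 d × SO0 d) :=
  ((MonoidHom.id (SO0 d)).prod (MonoidHom.id (SO0 d))).range

/-- `U = {(u, u) : u ∈ 𝒰}`. -/
def diagU (d : ℕ) [NeZero d] : Subgroup (SO0 d × SO0 d) :=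
  (horospherical d).map ((MonoidHom.id (SO0 d)).prod (MonoidHom.id (SO0 d)))

/-- `U₂ = {e} × 𝒰`. -/
def U₂ (d : ℕ) [NeZero d] : Subgroup (SO0 d × SO0 d) :=
  (⊥ : Subgroup (SO0 d)).prod (horospherical d)

/-- The renormalized frame bundle `RF = {x ∈ Γ \ G : x𝒜 is bounded}`, where a bounded set is a
relatively compact one. -/
def RF {d : ℕ} [NeZero d] (Γ : Subgroup (SO0 d)) : Set (HomSpace Γ) :=
  {x | IsCompact (closure (range fun t : ℝ => translate x (boost d t)))}

/-- `Ω = RF(Γ₁) × (Γ₂ \ G)`. -/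
def Omega {d : ℕ} [NeZero d] (Γ₁ Γ₂ : Subgroup (SO0 d)) : Set (HomSpace Γ₁ × HomSpace Γ₂) :=
  RF Γ₁ ×ˢ univ

/-- The orbit `zS`. -/
def orbitOf {G : Type*} [Group G] {Γ₁ Γ₂ : Subgroup G} (z : HomSpace Γ₁ × HomSpace Γ₂)
    (S : Subgroup (G × G)) : Set (HomSpace Γ₁ × HomSpace Γ₂) :=
  {w | ∃ s ∈ S, w = act z s}

/-- `X` is `S`-invariant. -/
def IsInvariantUnder {G : Type*} [Group G] {Γ₁ Γ₂ : Subgroup G} (S : Subgroup (G × G))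
    (X : Set (HomSpace Γ₁ × HomSpace Γ₂)) : Prop :=
  ∀ z ∈ X, ∀ s ∈ S, act z s ∈ X

/-- `Y` is a `U`-minimal subset of `X` with respect to `Ω`: a closed `U`-invariant subset of `X`
that meets `Ω`, such that `yU` is dense in `Y` for every `y ∈ Y ∩ Ω`. -/
structure IsRelMinimal {d : ℕ} [NeZero d] {Γ₁ Γ₂ : Subgroup (SO0 d)}
    (X Y : Set (HomSpace Γ₁ × HomSpace Γ₂)) : Prop where
  subset : Y ⊆ X
  isClosed : IsClosed Y
  invariant : IsInvariantUnder (diagU d) Y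
  nonempty : (Y ∩ Omega Γ₁ Γ₂).Nonempty
  dense : ∀ y ∈ Y ∩ Omega Γ₁ Γ₂, Y ⊆ closure (orbitOf y (diagU d))

/-- The matrix entries of an element of `G × G`, as a vector in a Euclidean space; real-analyticity
and derivatives of curves in the (embedded) Lie group `G × G` are read off in these. -/
def entries {d : ℕ} (g : SO0 d × SO0 d) :
    (Idx d → Idx d → ℝ) × (Idx d → Idx d → ℝ) :=
  (fun i j => g.1.1.1 i j, fun i j => g.2.1.1 i j)

end HypDyn

end

noncomputable section

open Set Filter Topology Matrix

set_option linter.unusedSectionVars false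

namespace HypDyn

/-! ### Light-cone coordinates -/

/-! The theorem is proved by polynomial divergence of horospherical orbits.

Return times. In light-cone coordinates `𝒰` consists of the matrices `horoMat s`, polynomial in `s ∈
ℝ^{d-1}`, and the geodesic flow acts on `𝒰` by scaling `s`. Convex cocompactness identifies `RF`
with the frames whose two endpoints lie in the limit set (`mem_RF_iff`). Right translation by `𝒰`
fixes the forward endpoint, so the `s` with `x * horo s ∈ RF` are the limit points of `Γ₁` seen from
that endpoint. Zariski density prevents a nonzero polynomial from vanishing at all of them.
Compactness of `RF`, together with its invariance under the flow, makes this uniform: at every scale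
`R` there is a return time of size `O(R)` at which a given polynomial with monomials in a fixed
finite set is as large as its biggest monomial at scale `R` (`exists_return`).

Drift. Let `X'` be closed and `U`-invariant, `w ∈ Y ∩ Ω`, and let `w (g, k g) ∈ X'` with `g`, `k`
near `e`. The points `w (u_s, u_s)` and `w (g, k g) (u_σ, u_σ)` differ by `(b, z b)` with `b =
u_{-s} g u_σ` and `z = u_{-s} k u_s`. The entries of `z` and the corner entry of `b` are polynomials
in `s`, and `σ` is chosen to keep `b` bounded. At a return time where these polynomials have size
comparable to `ε`, a limit as `(g, k) → e` gives `(h, u h)`, where `h` centralizes the geodesic flow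
and `u` commutes with `𝒰`, hence lies in `𝒰`. Such a pair normalizes `U`, so minimality yields `Y
(h, u h) ⊆ X'`, with upper and lower bounds of order `ε` on the displacement
(`exists_levi_translate`).

Two applications. For `X' = Y`, starting from returns transverse to the parabolic subgroup
(`exists_transverse_return`), let `ε → 0` and take powers. This produces a one-parameter semigroup
`p(r) = (exp rN, exp r(N + T))` preserving `Y`, where `T` generates a subgroup of `𝒰`, and either `T
≠ 0` or `N` has a component along the flow (`exists_generator`). For `X' = X`, starting from the
points `y (1, k)` that exist because `X \ yH` is not closed, the drift produces a nontrivial `u ∈ 𝒰`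
with `Y (1, u) ⊆ X` (`exists_horo_translate`).

Conclusion. If `Y (1, v) ⊆ X`, then `H`-invariance gives `Y (1, p₂(r) v p₁(r)⁻¹) ⊆ X` for `r ≥ 0`.
This is an analytic curve in `U₂` with derivative `(N + T) v - v N` at `0`. The choice `v = 1` works
when `T ≠ 0`; otherwise `v = u` works, because the flow component of `N` does not commute with `u`.
-/

/-- Indices of the light-cone basis `f₊ = e₀ + eᵣ`, `eᵢ` (`i ≠ 0`), `f₋ = (eᵣ - e₀) / 2`. -/
abbrev LIdx (d : ℕ) [NeZero d] : Type := Unit ⊕ ({i : Fin d // i ≠ 0} ⊕ Unit)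

/-- The parameter space `ℝ^{d-1}` of the horospherical subgroup. -/
abbrev HVec (d : ℕ) [NeZero d] : Type := {i : Fin d // i ≠ 0} → ℝ

local notation "𝔭" => Sum.inl PUnit.unit
local notation "𝔪" => Sum.inr (Sum.inr PUnit.unit)
local notation "𝔴" i:max => Sum.inr (Sum.inl i)

variable {d : ℕ} [NeZero d]

theorem lidx_cases {p : LIdx d → Prop} (hp : p 𝔭) (hw : ∀ i, p (𝔴 i)) (hm : p 𝔪) (a : LIdx d) :
    p a := by
  rcases a with ⟨⟨⟩⟩ | i | ⟨⟨⟩⟩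
  exacts [hp, hw i, hm]

/-- Light-cone coordinates of a vector of `ℝ^{d,1}`. -/
def lightEquiv (d : ℕ) [NeZero d] : (Idx d → ℝ) ≃ₗ[ℝ] (LIdx d → ℝ) where
  toFun x := Sum.elim (fun _ => (x (Sum.inl 0) + x (Sum.inr ())) / 2)
    (Sum.elim (fun i => x (Sum.inl i.1)) (fun _ => x (Sum.inr ()) - x (Sum.inl 0)))
  invFun y := Sum.elim (fun a => if h : a = 0 then y 𝔭 - y 𝔪 / 2 else y (𝔴 ⟨a, h⟩))
    (fun _ => y 𝔭 + y 𝔪 / 2)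
  map_add' x y := by
    ext (_ | _ | _) <;> simp <;> ring
  map_smul' c x := by
    ext (_ | _ | _) <;> simp <;> ring
  left_inv x := by
    ext (a | _)
    · by_cases h : a = 0
      · subst h; simp; ring
      · simp [h]
    · simp; ring
  right_inv y := by
    ext (_ | a | _)
    · simp
    · simp [a.2]
    · simp

theorem lightEquiv_plus (x : Idx d → ℝ) :
    lightEquiv d x 𝔭 = (x (Sum.inl 0) + x (Sum.inr ())) / 2 := rfl

theorem lightEquiv_mid (x : Idx d → ℝ) (i : {i : Fin d // i ≠ 0}) :
    lightEquiv d x (𝔴 i) = x (Sum.inl i.1) := rfl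

theorem lightEquiv_minus (x : Idx d → ℝ) :
    lightEquiv d x 𝔪 = x (Sum.inr ()) - x (Sum.inl 0) := rfl

theorem lightEquiv_symm_inr (y : LIdx d → ℝ) :
    (lightEquiv d).symm y (Sum.inr ()) = y 𝔭 + y 𝔪 / 2 := rfl

/-- The Lorentz bilinear form in light-cone coordinates. -/
def lightBil (x y : LIdx d → ℝ) : ℝ :=
  ∑ i, x (𝔴 i) * y (𝔴 i) - x 𝔭 * y 𝔪 - x 𝔪 * y 𝔭

theorem lorentzForm_eq (x : Idx d → ℝ) :
    lorentzForm d x = lightBil (lightEquiv d x) (lightEquiv d x) := by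
  simp only [lorentzForm, lightBil, lightEquiv_plus, lightEquiv_mid, lightEquiv_minus]
  rw [Fintype.sum_eq_add_sum_subtype_ne _ (0 : Fin d)]
  simp only [← sq]
  ring

theorem lightBil_add_self (x y : LIdx d → ℝ) :
    lightBil (x + y) (x + y) = lightBil x x + 2 * lightBil x y + lightBil y y := by
  simp only [lightBil, Pi.add_apply, Finset.mul_sum, mul_sub, add_mul, mul_add,
    Finset.sum_add_distrib]
  have : ∑ i, y (𝔴 i) * x (𝔴 i) = ∑ i, x (𝔴 i) * y (𝔴 i) :=
    Finset.sum_congr rfl fun i _ => mul_comm _ _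
  rw [this, ← Finset.mul_sum]
  ring

/-- On the hyperboloid the product of the two null coordinates is positive, so they have the same
sign, and either one of them detects the sheet. -/
theorem mem_upperSheet_iff (x : Idx d → ℝ) :
    x ∈ upperSheet d ↔ lightBil (lightEquiv d x) (lightEquiv d x) = -1 ∧ 0 < lightEquiv d x 𝔪 := by
  rw [upperSheet, Set.mem_ofPred_eq, lorentzForm_eq]
  refine and_congr_right fun h => ?_
  have h0 : (0 : ℝ) ≤ ∑ i, lightEquiv d x (𝔴 i) * lightEquiv d x (𝔴 i) :=
    Finset.sum_nonneg fun i _ => mul_self_nonneg _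
  have e : x (Sum.inr ()) = lightEquiv d x 𝔭 + lightEquiv d x 𝔪 / 2 := by
    rw [lightEquiv_plus, lightEquiv_minus]; ring
  rw [e]
  simp only [lightBil] at h
  set p := lightEquiv d x 𝔭
  set m := lightEquiv d x 𝔪
  have hpm : 0 < p * m := by nlinarith
  constructor
  · intro h1
    by_contra! hm
    have : p ≤ 0 := by
      by_contra! hp
      nlinarith
    linarith
  · intro hm
    have : 0 < p := by
      by_contra! hp
      nlinarith
    linarith

/-- Conjugation of matrices into light-cone coordinates. -/
def lightConj (d : ℕ) [NeZero d] :
    Matrix (Idx d) (Idx d) ℝ ≃ₐ[ℝ] Matrix (LIdx d) (LIdx d) ℝ :=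
  (Matrix.toLinAlgEquiv'.trans (LinearEquiv.conjAlgEquiv ℝ (lightEquiv d))).trans
    LinearMap.toMatrixAlgEquiv'

theorem lightConj_mulVec (M : Matrix (Idx d) (Idx d) ℝ) (x : Idx d → ℝ) :
    lightConj d M *ᵥ lightEquiv d x = lightEquiv d (M *ᵥ x) := by
  simp [lightConj, LinearMap.toMatrixAlgEquiv', ← Matrix.toLin'_apply]

theorem det_lightConj (M : Matrix (Idx d) (Idx d) ℝ) : (lightConj d M).det = M.det := by
  have h : lightConj d M
      = LinearMap.toMatrix' ((lightEquiv d).toLinearMap ∘ₗ Matrix.toLin' M ∘ₗ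
        (lightEquiv d).symm.toLinearMap) := rfl
  rw [h, LinearMap.det_toMatrix', LinearMap.det_conj, LinearMap.det_toLin']

/-- The matrix of a group element in light-cone coordinates. -/
def lm (g : SO0 d) : Matrix (LIdx d) (LIdx d) ℝ := lightConj d g.1.1

theorem lm_eq (g : SO0 d) : lm g = lightConj d g.1.1 := rfl

theorem lm_mulVec (g : SO0 d) (x : Idx d → ℝ) :
    lm g *ᵥ lightEquiv d x = lightEquiv d (g.1.1 *ᵥ x) := lightConj_mulVec _ _

theorem lm_one : lm (1 : SO0 d) = 1 := map_one (lightConj d)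

theorem lm_mul (g h : SO0 d) : lm (g * h) = lm g * lm h := map_mul (lightConj d) g.1.1 h.1.1

theorem lm_mul_inv (g : SO0 d) : lm g * lm g⁻¹ = 1 := by rw [← lm_mul, mul_inv_cancel, lm_one]

theorem lm_injective : Function.Injective (lm : SO0 d → _) := fun _ _ h =>
  Subtype.ext (Subtype.ext ((lightConj d).injective h))

theorem lightBil_lm_self (g : SO0 d) (x : LIdx d → ℝ) :
    lightBil (lm g *ᵥ x) (lm g *ᵥ x) = lightBil x x := by
  obtain ⟨x, rfl⟩ := (lightEquiv d).surjective x
  rw [lm_mulVec, ← lorentzForm_eq, ← lorentzForm_eq, g.2.1]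

theorem lightBil_lm (g : SO0 d) (x y : LIdx d → ℝ) :
    lightBil (lm g *ᵥ x) (lm g *ᵥ y) = lightBil x y := by
  have h := lightBil_lm_self g (x + y)
  rw [Matrix.mulVec_add, lightBil_add_self, lightBil_add_self, lightBil_lm_self,
    lightBil_lm_self] at h
  linarith

theorem lightBil_col (g : SO0 d) (a b : LIdx d) :
    ∑ i, lm g (𝔴 i) a * lm g (𝔴 i) b - lm g 𝔭 a * lm g 𝔪 b - lm g 𝔪 a * lm g 𝔭 b =
      lightBil (Pi.single a 1) (Pi.single b 1) := by
  rw [← lightBil_lm g]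
  simp [lightBil]

/-- A matrix in light-cone coordinates that preserves the form and the upper sheet. -/
theorem exists_lm_eq (M : Matrix (LIdx d) (LIdx d) ℝ) (hdet : M.det = 1)
    (hM : ∀ x, lightBil (M *ᵥ x) (M *ᵥ x) = lightBil x x)
    (hpos : ∀ x, lightBil x x = -1 → 0 < x 𝔪 → 0 < (M *ᵥ x) 𝔪) : ∃ g : SO0 d, lm g = M := by
  set N := (lightConj d).symm M
  have hN : lightConj d N = M := (lightConj d).apply_symm_apply M
  refine ⟨⟨⟨N, by rw [← det_lightConj, hN, hdet]⟩, fun x => ?_, fun x hx => ?_⟩, hN⟩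
  · change lorentzForm d (N *ᵥ x) = _
    rw [lorentzForm_eq, lorentzForm_eq, ← lightConj_mulVec, hN, hM]
  · change N *ᵥ x ∈ _
    rw [mem_upperSheet_iff] at hx ⊢
    rw [← lightConj_mulVec, hN, hM]
    exact ⟨hx.1, hpos _ hx.1 hx.2⟩

/-! ### Horospherical elements -/

/-- The matrix of a horospherical element in light-cone coordinates. -/
def horoMat (s : HVec d) : Matrix (LIdx d) (LIdx d) ℝ :=
  Matrix.of (Sum.elim (fun _ => Sum.elim (fun _ => 1) (Sum.elim s (fun _ => (s ⬝ᵥ s) / 2)))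
    (Sum.elim (fun i => Sum.elim (fun _ => 0)
        (Sum.elim (fun j => if i = j then 1 else 0) (fun _ => s i)))
      (fun _ => Sum.elim (fun _ => 0) (Sum.elim (fun _ => 0) (fun _ => 1)))))

theorem horoMat_mulVec_plus (s : HVec d) (x : LIdx d → ℝ) :
    (horoMat s *ᵥ x) 𝔭 = x 𝔭 + ∑ i, s i * x (𝔴 i) + (s ⬝ᵥ s) / 2 * x 𝔪 := by
  simp [horoMat, Matrix.mulVec, dotProduct, Fintype.sum_sum_type]
  ring

theorem horoMat_mulVec_mid (s : HVec d) (x : LIdx d → ℝ) (i : {i : Fin d // i ≠ 0}) :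
    (horoMat s *ᵥ x) (𝔴 i) = x (𝔴 i) + s i * x 𝔪 := by
  simp [horoMat, Matrix.mulVec, dotProduct, Fintype.sum_sum_type]

theorem horoMat_mulVec_minus (s : HVec d) (x : LIdx d → ℝ) :
    (horoMat s *ᵥ x) 𝔪 = x 𝔪 := by
  simp [horoMat, Matrix.mulVec, dotProduct, Fintype.sum_sum_type]

theorem horoMat_zero : horoMat (0 : HVec d) = 1 := by
  ext (⟨⟩ | i | ⟨⟩) (⟨⟩ | j | ⟨⟩) <;> simp [horoMat, Matrix.one_apply]

theorem horoMat_add (s t : HVec d) : horoMat (s + t) = horoMat s * horoMat t := by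
  refine Matrix.toLin'.injective (LinearMap.ext fun x => ?_)
  rw [Matrix.toLin'_apply, Matrix.toLin'_apply, ← Matrix.mulVec_mulVec]
  refine funext (lidx_cases ?_ (fun i => ?_) ?_)
  · simp only [horoMat_mulVec_plus, horoMat_mulVec_mid, horoMat_mulVec_minus, Pi.add_apply,
      add_mul, mul_add, Finset.sum_add_distrib, dotProduct_add, add_dotProduct]
    rw [dotProduct_comm t s]
    simp only [dotProduct, ← mul_assoc, ← Finset.sum_mul]
    ring
  · simp only [horoMat_mulVec_mid, horoMat_mulVec_minus, Pi.add_apply]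
    ring
  · rw [horoMat_mulVec_minus, horoMat_mulVec_minus, horoMat_mulVec_minus]

/-- The reflection `D` conjugates `horoMat t` to `horoMat (-t)`, so both have the same determinant.
Their product is `1`, and applying this to `t = s / 2` gives `det (horoMat s) = det (horoMat (s /
2)) ^ 2 = 1`. -/
theorem det_horoMat (s : HVec d) : (horoMat s).det = 1 := by
  set D : Matrix (LIdx d) (LIdx d) ℝ :=
    Matrix.diagonal (Sum.elim (fun _ => 1) (Sum.elim (fun _ => -1) (fun _ => 1))) with hD
  have hDD : D * D = 1 := by
    rw [hD, Matrix.diagonal_mul_diagonal, ← Matrix.diagonal_one]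
    congr 1
    ext (⟨⟩ | i | ⟨⟩) <;> simp
  have hdD : D.det * D.det = 1 := by rw [← Matrix.det_mul, hDD, Matrix.det_one]
  have hconj : ∀ t : HVec d, D * horoMat t * D = horoMat (-t) := fun t => by
    ext (⟨⟩ | i | ⟨⟩) (⟨⟩ | j | ⟨⟩) <;>
      simp [hD, horoMat, Matrix.mul_diagonal, Matrix.diagonal_mul]; split_ifs <;> simp
  have hneg : ∀ t : HVec d, (horoMat (-t)).det = (horoMat t).det := fun t => by
    rw [← hconj, Matrix.det_mul, Matrix.det_mul]
    linear_combination (horoMat t).det * hdD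
  have h2 : (horoMat ((1 / 2 : ℝ) • s)).det * (horoMat ((1 / 2 : ℝ) • s)).det = 1 := by
    nth_rewrite 2 [← hneg]
    rw [← Matrix.det_mul, ← horoMat_add, add_neg_cancel, horoMat_zero, Matrix.det_one]
  rw [← Matrix.det_mul, ← horoMat_add, ← add_smul, add_halves, one_smul] at h2
  exact h2

theorem exists_lm_eq_horoMat (s : HVec d) : ∃ g : SO0 d, lm g = horoMat s := by
  refine exists_lm_eq _ (det_horoMat s) (fun x => ?_) fun x _ hx => ?_
  · simp only [lightBil, horoMat_mulVec_plus, horoMat_mulVec_mid, horoMat_mulVec_minus,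
      add_mul, mul_add, Finset.sum_add_distrib, dotProduct]
    have h1 : ∑ i, x (𝔴 i) * (s i * x 𝔪) = (∑ i, s i * x (𝔴 i)) * x 𝔪 := by
      rw [Finset.sum_mul]; exact Finset.sum_congr rfl fun i _ => by ring
    have h2 : ∑ i, s i * x 𝔪 * x (𝔴 i) = (∑ i, s i * x (𝔴 i)) * x 𝔪 := by
      rw [Finset.sum_mul]; exact Finset.sum_congr rfl fun i _ => by ring
    have h3 : ∑ i, s i * x 𝔪 * (s i * x 𝔪) = (∑ i, s i * s i) * x 𝔪 * x 𝔪 := by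
      rw [Finset.sum_mul, Finset.sum_mul]; exact Finset.sum_congr rfl fun i _ => by ring
    rw [h1, h2, h3]
    ring
  · rwa [horoMat_mulVec_minus]

/-- The horospherical element with parameter `s`. -/
def horo (s : HVec d) : SO0 d := (exists_lm_eq_horoMat s).choose

theorem lm_horo (s : HVec d) : lm (horo s) = horoMat s := (exists_lm_eq_horoMat s).choose_spec

theorem horo_zero : horo (0 : HVec d) = 1 := lm_injective (by rw [lm_horo, horoMat_zero, lm_one])

theorem horo_add (s t : HVec d) : horo (s + t) = horo s * horo t :=
  lm_injective (by rw [lm_mul, lm_horo, lm_horo, lm_horo, horoMat_add])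

theorem horo_neg (s : HVec d) : horo (-s) = (horo s)⁻¹ :=
  eq_inv_of_mul_eq_one_left (by rw [← horo_add, neg_add_cancel, horo_zero])

theorem horo_mul_comm (s t : HVec d) : horo s * horo t = horo t * horo s := by
  rw [← horo_add, add_comm, horo_add]

/-- The eigenvalue exponents of the geodesic flow on the light-cone basis. -/
def wt (a : LIdx d) : ℝ := Sum.elim (fun _ => 1) (Sum.elim (fun _ => 0) (fun _ => -1)) a

theorem lm_boost (t : ℝ) : lm (boost d t) = Matrix.diagonal fun a => Real.exp (wt a * t) := by
  refine Matrix.toLin'.injective (LinearMap.ext fun x => ?_)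
  obtain ⟨x, rfl⟩ := (lightEquiv d).surjective x
  rw [Matrix.toLin'_apply, Matrix.toLin'_apply, lm_mulVec]
  change lightEquiv d (boostMatrix d t *ᵥ x) = _
  ext (⟨⟩ | i | ⟨⟩)
  · rw [Matrix.mulVec_diagonal, lightEquiv_plus, lightEquiv_plus, boostMatrix_mulVec_inr,
      boostMatrix_mulVec_zero, Real.cosh_eq, Real.sinh_eq]
    simp [wt]; ring
  · rw [Matrix.mulVec_diagonal, lightEquiv_mid, lightEquiv_mid, boostMatrix_mulVec_of_ne _ _ _ _ i.2]
    simp [wt]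
  · rw [Matrix.mulVec_diagonal, lightEquiv_minus, lightEquiv_minus, boostMatrix_mulVec_inr,
      boostMatrix_mulVec_zero, Real.cosh_eq, Real.sinh_eq]
    simp [wt]; ring

theorem boost_zero : boost d 0 = 1 := Subtype.ext (Subtype.ext (boostMatrix_zero d))

theorem boost_neg (t : ℝ) : boost d (-t) = (boost d t)⁻¹ :=
  eq_inv_of_mul_eq_one_left (boost_neg_mul d t)

theorem lm_boost_conj (t : ℝ) (g : SO0 d) (a b : LIdx d) :
    lm (boost d (-t) * g * boost d t) a b = Real.exp ((wt b - wt a) * t) * lm g a b := by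
  rw [lm_mul, lm_mul, lm_boost, lm_boost, Matrix.mul_diagonal, Matrix.diagonal_mul,
    show (wt b - wt a) * t = wt a * -t + wt b * t by ring, Real.exp_add]
  ring

theorem boost_conj_horo (t : ℝ) (s : HVec d) :
    boost d (-t) * horo s * boost d t = horo (Real.exp (-t) • s) := by
  apply lm_injective
  ext a b
  rw [lm_boost_conj, lm_horo, lm_horo]
  rcases a with ⟨⟩ | i | ⟨⟩ <;> rcases b with ⟨⟩ | j | ⟨⟩ <;> simp [wt, horoMat]
  · rw [show (-1 - 1) * t = -t + -t by ring, Real.exp_add]; ring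

theorem continuous_lm : Continuous (lm : SO0 d → _) :=
  (LinearMap.continuous_of_finiteDimensional (lightConj d).toLinearMap).comp
    (continuous_subtype_val.comp continuous_subtype_val)

attribute [irreducible] lm

/-! ### Topology of the group -/

theorem isClosed_range_lm : IsClosed (range (lm : SO0 d → _)) := by
  have key : range (lm : SO0 d → _) = {M | M.det = 1} ∩
      ((⋂ x, {M | lightBil (M *ᵥ x) (M *ᵥ x) = lightBil x x}) ∩
        ⋂ x ∈ {x : LIdx d → ℝ | lightBil x x = -1 ∧ 0 < x 𝔪}, {M | 0 ≤ (M *ᵥ x) 𝔪}) := by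
    ext M
    simp only [mem_range, mem_inter_iff, mem_iInter, Set.mem_ofPred_eq]
    constructor
    · rintro ⟨g, rfl⟩
      refine ⟨by rw [lm, det_lightConj]; exact g.1.2, lightBil_lm_self g, fun x hx => ?_⟩
      obtain ⟨x, rfl⟩ := (lightEquiv d).surjective x
      rw [lm_mulVec]
      exact ((mem_upperSheet_iff _).1 (g.2.2 x ((mem_upperSheet_iff x).2 hx))).2.le
    · rintro ⟨h1, h2, h3⟩
      -- The closed condition `0 ≤` suffices: a vector whose `𝔪`-coordinate vanishes has nonnegative
      -- norm, so it cannot lie on the hyperboloid.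
      refine exists_lm_eq M h1 h2 fun x hx hx' => lt_of_le_of_ne (h3 x ⟨hx, hx'⟩) fun h => ?_
      have h4 := h2 x
      rw [hx, lightBil, ← h] at h4
      have h0 : (0 : ℝ) ≤ ∑ i, (M *ᵥ x) (𝔴 i) * (M *ᵥ x) (𝔴 i) :=
        Finset.sum_nonneg fun i _ => mul_self_nonneg _
      simp only [mul_zero, zero_mul, sub_zero] at h4
      linarith
  have hc : ∀ (x : LIdx d → ℝ) (a : LIdx d),
      Continuous fun M : Matrix (LIdx d) (LIdx d) ℝ => (M *ᵥ x) a := fun x a =>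
    (continuous_apply a).comp (Continuous.matrix_mulVec continuous_id continuous_const)
  rw [key]
  refine (isClosed_eq (Continuous.matrix_det continuous_id) continuous_const).inter
    ((isClosed_iInter fun x => isClosed_eq ?_ continuous_const).inter
      (isClosed_iInter fun x => isClosed_iInter fun _ => isClosed_le continuous_const (hc x 𝔪)))
  unfold lightBil
  exact (((continuous_finsetSum _ fun i _ => (hc x _).mul (hc x _))).sub
    ((hc x _).mul (hc x _))).sub ((hc x _).mul (hc x _))

theorem isClosedEmbedding_lm : IsClosedEmbedding (lm : SO0 d → _) := by
  refine ⟨⟨?_, lm_injective⟩, isClosed_range_lm⟩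
  have h1 : IsInducing fun g : SO0 d => g.1.1 :=
    IsInducing.subtypeVal.comp IsInducing.subtypeVal
  let e : Matrix (Idx d) (Idx d) ℝ ≃ₜ Matrix (LIdx d) (LIdx d) ℝ :=
    { (lightConj d).toEquiv with
      continuous_toFun :=
        LinearMap.continuous_of_finiteDimensional (lightConj d).toLinearMap
      continuous_invFun :=
        LinearMap.continuous_of_finiteDimensional (lightConj d).symm.toLinearMap }
  have h2 : (lm : SO0 d → _) = e ∘ fun g : SO0 d => g.1.1 := funext lm_eq
  rw [h2]
  exact e.isInducing.comp h1

instance : LocallyCompactSpace (Matrix (LIdx d) (LIdx d) ℝ) :=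
  inferInstanceAs (LocallyCompactSpace (LIdx d → LIdx d → ℝ))

instance : FirstCountableTopology (Matrix (LIdx d) (LIdx d) ℝ) :=
  inferInstanceAs (FirstCountableTopology (LIdx d → LIdx d → ℝ))

instance : LocallyCompactSpace (SO0 d) := isClosedEmbedding_lm.locallyCompactSpace

instance : FirstCountableTopology (SO0 d) :=
  isClosedEmbedding_lm.isInducing.firstCountableTopology

theorem tendsto_iff_lm {α : Type*} {l : Filter α} {f : α → SO0 d} {g : SO0 d} :
    Tendsto f l (𝓝 g) ↔ ∀ a b, Tendsto (fun x => lm (f x) a b) l (𝓝 (lm g a b)) := by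
  rw [isClosedEmbedding_lm.isInducing.tendsto_nhds_iff]
  exact tendsto_pi_nhds.trans (forall_congr' fun a => tendsto_pi_nhds)

theorem tendsto_lm {α : Type*} {l : Filter α} {f : α → SO0 d} {g : SO0 d}
    (h : Tendsto f l (𝓝 g)) (a b : LIdx d) :
    Tendsto (fun x => lm (f x) a b) l (𝓝 (lm g a b)) := tendsto_iff_lm.1 h a b

/-- A bounded sequence of group elements has a convergent subsequence. -/
theorem exists_tendsto_subseq_of_bounded {g : ℕ → SO0 d} {C : ℝ}
    (hg : ∀ n a b, |lm (g n) a b| ≤ C) :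
    ∃ h : SO0 d, ∃ φ : ℕ → ℕ, StrictMono φ ∧ Tendsto (g ∘ φ) atTop (𝓝 h) := by
  let K : Set (LIdx d → LIdx d → ℝ) := Set.pi univ fun _ => Set.pi univ fun _ => Icc (-C) C
  have hK : IsCompact K := isCompact_univ_pi fun _ => isCompact_univ_pi fun _ => isCompact_Icc
  have hK' : IsCompact (lm ⁻¹' (K : Set (Matrix (LIdx d) (LIdx d) ℝ)) : Set (SO0 d)) :=
    isClosedEmbedding_lm.isCompact_preimage hK
  obtain ⟨h, -, φ, hφ, hlim⟩ := hK'.tendsto_subseq (x := g)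
    fun n a _ b _ => abs_le.1 (hg n a b)
  exact ⟨h, φ, hφ, hlim⟩

theorem eventually_lm_lt {δ : ℝ} (hδ : 0 < δ) :
    ∀ᶠ g : SO0 d in 𝓝 1, ∀ a b, |lm g a b - lm 1 a b| < δ := by
  rw [eventually_all]
  intro a
  rw [eventually_all]
  intro b
  have h := tendsto_lm (tendsto_id (x := 𝓝 (1 : SO0 d))) a b
  exact (Metric.tendsto_nhds.1 h δ hδ).mono fun g hg => by rwa [Real.dist_eq] at hg

theorem exists_lm_lt_mem {O : Set (SO0 d)} (hO : O ∈ 𝓝 1) :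
    ∃ δ > 0, ∀ g : SO0 d, (∀ a b, |lm g a b - lm 1 a b| < δ) → g ∈ O := by
  by_contra! h
  choose g hg hgO using fun n : ℕ => h (1 / (n + 1)) (by positivity)
  have : Tendsto g atTop (𝓝 1) := by
    rw [tendsto_iff_lm]
    intro a b
    rw [tendsto_iff_dist_tendsto_zero]
    exact squeeze_zero (fun _ => dist_nonneg) (fun n => (hg n a b).le)
      tendsto_one_div_add_atTop_nhds_zero_nat
  obtain ⟨n, hn⟩ := (this.eventually hO).exists
  exact hgO n hn

theorem continuous_horo : Continuous (horo : HVec d → SO0 d) := by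
  rw [continuous_iff_continuousAt]
  intro s
  refine tendsto_iff_lm.2 fun a b => ?_
  have : Continuous fun t : HVec d => lm (horo t) a b := by
    simp only [lm_horo]
    rcases a with ⟨⟩ | i | ⟨⟩ <;> rcases b with ⟨⟩ | j | ⟨⟩ <;>
      simp only [horoMat, Matrix.of_apply, Sum.elim_inl, Sum.elim_inr, dotProduct] <;> fun_prop
  exact this.continuousAt

/-! ### Orthogonality relations -/

theorem lm_null (g : SO0 d) {a : LIdx d} (ha : a = 𝔭 ∨ a = 𝔪) :
    ∑ i, lm g (𝔴 i) a ^ 2 = 2 * lm g 𝔭 a * lm g 𝔪 a := by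
  have h := lightBil_col g a a
  have h' : lightBil (Pi.single a 1) (Pi.single a (1 : ℝ)) = 0 := by
    rcases ha with rfl | rfl <;> simp [lightBil]
  rw [h'] at h
  simp only [sq]
  linarith

theorem lm_plus_minus (g : SO0 d) :
    ∑ i, lm g (𝔴 i) 𝔭 * lm g (𝔴 i) 𝔪 - lm g 𝔭 𝔭 * lm g 𝔪 𝔪 - lm g 𝔪 𝔭 * lm g 𝔭 𝔪 = -1 := by
  rw [lightBil_col]; simp [lightBil]

theorem lm_mid_plus (g : SO0 d) (j : {i : Fin d // i ≠ 0}) :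
    ∑ i, lm g (𝔴 i) (𝔴 j) * lm g (𝔴 i) 𝔭 - lm g 𝔭 (𝔴 j) * lm g 𝔪 𝔭
      - lm g 𝔪 (𝔴 j) * lm g 𝔭 𝔭 = 0 := by
  rw [lightBil_col]; simp [lightBil]

theorem lm_mid_minus (g : SO0 d) (j : {i : Fin d // i ≠ 0}) :
    ∑ i, lm g (𝔴 i) (𝔴 j) * lm g (𝔴 i) 𝔪 - lm g 𝔭 (𝔴 j) * lm g 𝔪 𝔪
      - lm g 𝔪 (𝔴 j) * lm g 𝔭 𝔪 = 0 := by
  rw [lightBil_col]; simp [lightBil]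

/-- The vector `c f₊ + (1 / 2c) f₋` lies on the upper sheet for every `c > 0`, and so does its
image. Large `c` gives the sign of the first entry, small `c` that of the second. -/
theorem lm_future (g : SO0 d) : 0 ≤ lm g 𝔪 𝔭 ∧ 0 ≤ lm g 𝔪 𝔪 := by
  have key : ∀ c : ℝ, 0 < c → 0 < 2 * c ^ 2 * lm g 𝔪 𝔭 + lm g 𝔪 𝔪 := by
    intro c hc
    set y : LIdx d → ℝ := c • Pi.single 𝔭 1 + (1 / (2 * c)) • Pi.single 𝔪 1
    obtain ⟨x, hx⟩ := (lightEquiv d).surjective y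
    have hx1 : x ∈ upperSheet d := by
      rw [mem_upperSheet_iff, hx]
      constructor
      · simp [lightBil, y]; field_simp; ring
      · simp [y]; exact hc
    have h := ((mem_upperSheet_iff _).1 (g.2.2 x hx1)).2
    rw [← lm_mulVec, hx] at h
    simp only [y, Matrix.mulVec_add, Matrix.mulVec_smul, Matrix.mulVec_single_one, Pi.add_apply,
      Pi.smul_apply, Matrix.col_apply, smul_eq_mul] at h
    have h2 := mul_pos (by positivity : 0 < 2 * c) h
    have e : 2 * c * (c * lm g 𝔪 𝔭 + 1 / (2 * c) * lm g 𝔪 𝔪)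
        = 2 * c ^ 2 * lm g 𝔪 𝔭 + lm g 𝔪 𝔪 := by field_simp
    linarith [e ▸ h2]
  set a := lm g 𝔪 𝔭
  set b := lm g 𝔪 𝔪
  constructor
  · by_contra! ha
    have hc : 1 ≤ 1 + |b| / (-a) := by
      have : 0 ≤ |b| / (-a) := div_nonneg (abs_nonneg _) (by linarith)
      linarith
    have h := key (1 + |b| / (-a)) (by linarith)
    have e : (1 + |b| / (-a)) * a = a - |b| := by
      have := ha.ne
      field_simp
      ring
    have hb := le_abs_self b
    have hb' := abs_nonneg b
    nlinarith [mul_nonneg (mul_nonneg (by linarith : (0 : ℝ) ≤ (|b| / (-a) + 1)) (by linarith : 0 ≤ -a)) (by linarith : (0 : ℝ) ≤ (|b| / (-a) + 1) - 1)]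
  · by_contra! hb
    have hD : 0 < 2 * |a| - b + 1 := by linarith [abs_nonneg a]
    have hc0 : 0 < -b / (2 * |a| - b + 1) := div_pos (by linarith) hD
    have hc1 : -b / (2 * |a| - b + 1) ≤ 1 := by
      rw [div_le_one hD]; linarith [abs_nonneg a]
    have h := key _ hc0
    have e : -b / (2 * |a| - b + 1) * (2 * |a| - b + 1) = -b := by field_simp
    set c := -b / (2 * |a| - b + 1)
    have h3 : c ^ 2 * a ≤ c * |a| := by
      calc c ^ 2 * a ≤ c ^ 2 * |a| := by gcongr; exact le_abs_self a
        _ ≤ c * |a| := by gcongr; nlinarith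
    nlinarith

/-- The image of a future null vector is null, nonzero and future-pointing; the expression is its
time coordinate. -/
theorem lm_time_pos (g : SO0 d) {a : LIdx d} (ha : a = 𝔭 ∨ a = 𝔪) :
    0 < lm g 𝔭 a + lm g 𝔪 a / 2 := by
  have h0 : 0 ≤ lm g 𝔪 a := by
    rcases ha with rfl | rfl
    exacts [(lm_future g).1, (lm_future g).2]
  have hn := lm_null g ha
  have hnn : 0 ≤ ∑ i, lm g (𝔴 i) a ^ 2 := Finset.sum_nonneg fun i _ => sq_nonneg _
  rcases h0.eq_or_lt with h | h
  · rw [← h, mul_zero] at hn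
    have hz : ∀ i, lm g (𝔴 i) a = 0 := fun i => by
      have := (Finset.sum_eq_zero_iff_of_nonneg fun i _ => sq_nonneg _).1 hn i (Finset.mem_univ i)
      exact pow_eq_zero_iff (two_ne_zero) |>.1 this
    have hpm := lm_plus_minus g
    have hf := lm_future g
    rcases ha with rfl | rfl
    · simp only [hz, ← h, zero_mul, Finset.sum_const_zero] at hpm
      rw [← h]
      by_contra! hc
      nlinarith [hf.2]
    · simp only [hz, ← h, mul_zero, Finset.sum_const_zero] at hpm
      rw [← h]
      by_contra! hc
      nlinarith [hf.1]
  · have : 0 ≤ lm g 𝔭 a := by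
      by_contra! hc
      nlinarith
    linarith

/-! ### The horospherical group and its normalizer -/

/-- A group element that fixes the null vector `f₊` and acts trivially on the graded pieces is
horospherical. -/
theorem exists_eq_horo (z : SO0 d) (h1 : lm z 𝔭 𝔭 = 1) (h2 : ∀ i, lm z (𝔴 i) 𝔭 = 0)
    (h3 : lm z 𝔪 𝔭 = 0) (h4 : ∀ i j, lm z (𝔴 i) (𝔴 j) = if i = j then 1 else 0)
    (h5 : ∀ i, lm z 𝔪 (𝔴 i) = 0) (h6 : lm z 𝔪 𝔪 = 1) : ∃ s : HVec d, z = horo s := by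
  refine ⟨fun i => lm z (𝔴 i) 𝔪, lm_injective ?_⟩
  rw [lm_horo]
  have hmid : ∀ j, lm z 𝔭 (𝔴 j) = lm z (𝔴 j) 𝔪 := fun j => by
    have := lm_mid_minus z j
    simp only [h4, h5, h6, ite_mul, one_mul, zero_mul, Finset.sum_ite_eq', Finset.mem_univ,
      if_true] at this
    linarith
  have hnull := lm_null z (Or.inr rfl : (𝔪 : LIdx d) = 𝔭 ∨ (𝔪 : LIdx d) = 𝔪)
  rw [h6] at hnull
  ext a b
  revert b
  revert a
  refine lidx_cases (lidx_cases ?_ (fun j => ?_) ?_) (fun i => lidx_cases ?_ (fun j => ?_) ?_)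
    (lidx_cases ?_ (fun j => ?_) ?_) <;>
    simp only [horoMat, Matrix.of_apply, Sum.elim_inl, Sum.elim_inr, dotProduct, h1, h2, h3, h4,
      h5, h6, hmid]
  simp only [← sq]
  linarith

theorem eq_horo_of_commute [Nonempty {i : Fin d // i ≠ 0}] {z : SO0 d}
    (hz : ∀ t : HVec d, z * horo t = horo t * z) : ∃ s : HVec d, z = horo s := by
  have hM : ∀ (t : HVec d) a b, (lm z * horoMat t) a b = (horoMat t * lm z) a b := fun t a b => by
    rw [← lm_horo, ← lm_mul, hz, lm_mul]
  simp only [Matrix.mul_apply, Fintype.sum_sum_type, Finset.univ_unique, Finset.sum_singleton,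
    PUnit.default_eq_unit] at hM
  -- An index `i ≠ 0` is essential here: if `𝒰` were trivial, every element would commute with it.
  have hmp : lm z 𝔪 𝔭 = 0 := by
    obtain ⟨i⟩ := ‹Nonempty {i : Fin d // i ≠ 0}›
    have := hM (Pi.single i 1) (𝔴 i) 𝔭
    simpa [horoMat] using this
  have hip : ∀ i, lm z (𝔴 i) 𝔭 = 0 := fun i => by
    have := hM (Pi.single i 1) 𝔭 𝔭
    simpa [horoMat, Pi.single_apply, hmp] using this
  have hmj : ∀ j, lm z 𝔪 (𝔴 j) = 0 := fun j => by
    have := hM (Pi.single j 1) (𝔴 j) (𝔴 j)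
    simpa [horoMat, Pi.single_apply, hip] using this
  have hij : ∀ i j, lm z (𝔴 i) (𝔴 j) = if i = j then lm z 𝔭 𝔭 else 0 := fun i j => by
    have := hM (Pi.single i 1) 𝔭 (𝔴 j)
    have h2 : lm z (𝔴 i) (𝔴 j) = lm z 𝔭 𝔭 * (Pi.single i 1 : HVec d) j := by
      simp [horoMat, Pi.single_apply, hmj] at this
      simp [Pi.single_apply]
      linarith
    rw [h2, Pi.single_apply]
    by_cases h : i = j <;> simp [h, eq_comm]
  have hmm : lm z 𝔪 𝔪 = lm z 𝔭 𝔭 := by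
    obtain ⟨i⟩ := ‹Nonempty {i : Fin d // i ≠ 0}›
    have := hM (Pi.single i 1) (𝔴 i) 𝔪
    simp [horoMat, Pi.single_apply, hip, hij] at this
    linarith
  have h1 : lm z 𝔭 𝔭 = 1 := by
    have := lm_plus_minus z
    simp only [hip, hmm, hmp, zero_mul, Finset.sum_const_zero] at this
    have hp := lm_time_pos z (Or.inl rfl : (𝔭 : LIdx d) = 𝔭 ∨ (𝔭 : LIdx d) = 𝔪)
    rw [hmp] at hp
    nlinarith
  refine exists_eq_horo z h1 hip hmp (fun i j => ?_) hmj (by rw [hmm, h1])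
  rw [hij, h1]

/-- Conjugation by the flow multiplies the entry `(a, b)` by `exp ((wt b - wt a) t)`. Convergence to
`1` therefore kills the entries with `wt a < wt b` and fixes those of equal weight, while the others
decay by themselves. -/
theorem mem_horospherical_iff {u : SO0 d} : u ∈ horospherical d ↔ ∃ s : HVec d, u = horo s := by
  constructor
  · intro hu
    have hu' : Tendsto (fun t : ℝ => boost d (-t) * u * boost d t) atTop (𝓝 1) := hu
    have hent : ∀ a b, Tendsto (fun t => Real.exp ((wt b - wt a) * t) * lm u a b) atTop
        (𝓝 (lm 1 a b)) := fun a b => by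
      simpa only [lm_boost_conj] using tendsto_lm hu' a b
    have hzero : ∀ a b, wt b = wt a → lm u a b = lm 1 a b := fun a b hab => by
      have := hent a b
      rw [hab] at this
      simp only [sub_self, zero_mul, Real.exp_zero, one_mul] at this
      exact tendsto_nhds_unique tendsto_const_nhds this
    have hpos : ∀ a b, wt a < wt b → lm u a b = 0 := fun a b hab => by
      have h2 : Tendsto (fun t : ℝ => Real.exp (-((wt b - wt a) * t))) atTop (𝓝 0) :=
        Real.tendsto_exp_neg_atTop_nhds_zero.comp
          (tendsto_id.const_mul_atTop (sub_pos.2 hab))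
      have h3 := h2.mul (hent a b)
      rw [zero_mul] at h3
      refine tendsto_nhds_unique (tendsto_const_nhds.congr fun t => ?_) h3
      rw [← mul_assoc, ← Real.exp_add]
      simp
    refine exists_eq_horo u ?_ (fun i => ?_) ?_ (fun i j => ?_) (fun i => ?_) ?_
    · rw [hzero _ _ rfl, lm_one]; simp
    · exact hpos _ _ (by simp [wt])
    · exact hpos _ _ (by simp [wt])
    · rw [hzero (𝔴 i) (𝔴 j) rfl, lm_one]; simp [Matrix.one_apply]
    · exact hpos _ _ (by simp [wt])
    · rw [hzero _ _ rfl, lm_one]; simp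
  · rintro ⟨s, rfl⟩
    change Tendsto (fun t : ℝ => boost d (-t) * horo s * boost d t) atTop (𝓝 1)
    simp only [boost_conj_horo]
    have h : Tendsto (fun t : ℝ => Real.exp (-t) • s) atTop (𝓝 ((0 : ℝ) • s)) :=
      Real.tendsto_exp_neg_atTop_nhds_zero.smul_const s
    rw [zero_smul] at h
    have h2 := (continuous_horo.tendsto (0 : HVec d)).comp h
    rw [horo_zero] at h2
    exact h2

theorem horo_mem (s : HVec d) : horo s ∈ horospherical d := mem_horospherical_iff.2 ⟨s, rfl⟩

theorem tendsto_boost_conj_horo (s : HVec d) :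
    Tendsto (fun t : ℝ => boost d (-t) * horo s * boost d t) atTop (𝓝 1) := horo_mem s

/-- The parabolic subgroup that fixes the null line of `f₊`. -/
def IsPar (g : SO0 d) : Prop := (∀ i, lm g (𝔴 i) 𝔭 = 0) ∧ lm g 𝔪 𝔭 = 0

theorem isPar_of_mid {g : SO0 d} (h : ∀ i, lm g (𝔴 i) 𝔭 = 0) (hp : lm g 𝔭 𝔭 ≠ 0) : IsPar g := by
  refine ⟨h, ?_⟩
  have := lm_null g (Or.inl rfl : (𝔭 : LIdx d) = 𝔭 ∨ (𝔭 : LIdx d) = 𝔪)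
  simpa [h, hp] using this.symm

/-- An element preserving the line of `f₊` also preserves its orthogonal complement, so it is block
upper triangular for the weight filtration. -/
theorem IsPar.lm_eq_zero {g : SO0 d} (hg : IsPar g) {a b : LIdx d} (hab : wt a < wt b) :
    lm g a b = 0 := by
  have hpp : lm g 𝔭 𝔭 ≠ 0 := by
    have hp := lm_time_pos g (Or.inl rfl : (𝔭 : LIdx d) = 𝔭 ∨ (𝔭 : LIdx d) = 𝔪)
    rw [hg.2] at hp
    simp at hp
    exact hp.ne'
  refine lidx_cases (p := fun a => ∀ b, wt a < wt b → lm g a b = 0)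
    (lidx_cases ?_ (fun j => ?_) ?_) (fun i => lidx_cases ?_ (fun j => ?_) ?_)
    (lidx_cases ?_ (fun j => ?_) ?_) a b hab <;> intro hab
  · norm_num [wt] at hab
  · norm_num [wt] at hab
  · norm_num [wt] at hab
  · exact hg.1 i
  · norm_num [wt] at hab
  · norm_num [wt] at hab
  · exact hg.2
  · have := lm_mid_plus g j
    simp only [hg.1, hg.2, mul_zero, Finset.sum_const_zero] at this
    have : lm g 𝔪 (𝔴 j) * lm g 𝔭 𝔭 = 0 := by linarith
    exact (mul_eq_zero.1 this).resolve_right hpp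
  · norm_num [wt] at hab

/-- For parabolic elements the only entries that the conjugation would expand are zero, so smallness
persists for all `t ≥ 0` at once. -/
theorem eventually_isPar_boost_conj {O : Set (SO0 d)} (hO : O ∈ 𝓝 1) :
    ∀ᶠ p : SO0 d in 𝓝 1, IsPar p → ∀ t : ℝ, 0 ≤ t → boost d (-t) * p * boost d t ∈ O := by
  obtain ⟨δ, hδ, h⟩ := exists_lm_lt_mem hO
  filter_upwards [eventually_lm_lt hδ] with p hp hpar t ht
  refine h _ fun a b => ?_
  rw [lm_boost_conj]
  rcases lt_or_ge (wt a) (wt b) with hab | hab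
  · have h1 : lm (1 : SO0 d) a b = 0 := by
      rw [lm_one, Matrix.one_apply_ne]
      rintro rfl
      exact lt_irrefl _ hab
    rw [hpar.lm_eq_zero hab, h1]
    simpa using hδ
  · have h1 : lm (1 : SO0 d) a b = Real.exp ((wt b - wt a) * t) * lm (1 : SO0 d) a b := by
      rw [lm_one]
      by_cases e : a = b
      · subst e; simp
      · simp [Matrix.one_apply_ne e]
    rw [h1, ← mul_sub, abs_mul, abs_of_pos (Real.exp_pos _)]
    have h2 : Real.exp ((wt b - wt a) * t) ≤ 1 := by
      rw [Real.exp_le_one_iff]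
      exact mul_nonpos_of_nonpos_of_nonneg (by linarith) ht
    exact lt_of_le_of_lt (mul_le_of_le_one_left (abs_nonneg _) h2) (hp a b)

/-! ### Bounded subsets of the group and its quotients -/

/-- The Lorentz bilinear form. -/
def lorBil (x y : Idx d → ℝ) : ℝ :=
  ∑ i, x (Sum.inl i) * y (Sum.inl i) - x (Sum.inr ()) * y (Sum.inr ())

theorem lorBil_eq_lightBil (x y : Idx d → ℝ) :
    lorBil x y = lightBil (lightEquiv d x) (lightEquiv d y) := by
  simp only [lorBil, lightBil, lightEquiv_plus, lightEquiv_mid, lightEquiv_minus]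
  rw [Fintype.sum_eq_add_sum_subtype_ne _ (0 : Fin d)]
  ring

theorem lorBil_smul (g : SO0 d) (x y : Idx d → ℝ) :
    lorBil (g.1.1 *ᵥ x) (g.1.1 *ᵥ y) = lorBil x y := by
  rw [lorBil_eq_lightBil, lorBil_eq_lightBil, ← lm_mulVec, ← lm_mulVec, lightBil_lm]

theorem lorBil_self (x : Idx d → ℝ) : lorBil x x = lorentzForm d x := by
  simp only [lorBil, lorentzForm, sq]

/-- The hyperbolic cosine of the distance from `g o` to `o`. -/
def ht (g : SO0 d) : ℝ := g.1.1 (Sum.inr ()) (Sum.inr ())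

theorem basePoint_eq : (basePoint d).1 = Pi.single (Sum.inr ()) 1 := by
  ext (i | ⟨⟩) <;> simp [basePoint]

theorem smul_basePoint (g : SO0 d) : (g • basePoint d).1 = fun a => g.1.1 a (Sum.inr ()) := by
  change g.1.1 *ᵥ (basePoint d).1 = _
  rw [basePoint_eq, Matrix.mulVec_single_one]
  rfl

theorem ht_eq (g : SO0 d) : ht g = (g • basePoint d).1 (Sum.inr ()) := by
  rw [smul_basePoint]; rfl

theorem lorBil_basePoint (x : Idx d → ℝ) : lorBil (basePoint d).1 x = -x (Sum.inr ()) := by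
  simp [lorBil, basePoint_eq]

theorem one_le_inr {x : Idx d → ℝ} (hx : x ∈ upperSheet d) : 1 ≤ x (Sum.inr ()) := by
  have h1 := hx.1
  have h2 := hx.2
  have h0 : (0 : ℝ) ≤ ∑ i : Fin d, x (Sum.inl i) ^ 2 := Finset.sum_nonneg fun i _ => sq_nonneg _
  unfold lorentzForm at h1
  nlinarith

theorem one_le_ht (g : SO0 d) : 1 ≤ ht g := by
  rw [ht_eq]; exact one_le_inr (g • basePoint d).2

/-- The bottom row of `g` is, up to signs, the vector `g⁻¹ o`, which lies on the hyperboloid and has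
time coordinate `ht g`; this bounds the row. Each column has the same Lorentz norm as a basis
vector, so its spatial part is bounded by its bottom entry. Hence `ht` is a proper function on the
group. -/
theorem abs_entry_le_ht (g : SO0 d) (a b : Idx d) : |g.1.1 a b| ≤ ht g := by
  have key : ∀ b, g.1.1 (Sum.inr ()) b = -lorBil (g⁻¹ • basePoint d).1 (Pi.single b 1) := by
    intro b
    rw [← lorBil_smul g]
    change _ = -lorBil (g • g⁻¹ • basePoint d).1 _
    rw [smul_inv_smul, lorBil_basePoint, Matrix.mulVec_single_one]
    simp
  have hinv : (g⁻¹ • basePoint d).1 (Sum.inr ()) = ht g := by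
    rw [ht, key]; simp [lorBil]
  have hsq := (g⁻¹ • basePoint d).2.1
  have h1 := one_le_ht g
  have hrow : ∀ i : Fin d, g.1.1 (Sum.inr ()) (Sum.inl i) ^ 2 ≤ ht g ^ 2 - 1 := fun i => by
    have : g.1.1 (Sum.inr ()) (Sum.inl i) = -(g⁻¹ • basePoint d).1 (Sum.inl i) := by
      rw [key]; simp [lorBil, Pi.single_apply]
    rw [this, neg_sq]
    have h2 : (g⁻¹ • basePoint d).1 (Sum.inl i) ^ 2
        ≤ ∑ i : Fin d, (g⁻¹ • basePoint d).1 (Sum.inl i) ^ 2 :=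
      Finset.single_le_sum (f := fun i : Fin d => (g⁻¹ • basePoint d).1 (Sum.inl i) ^ 2)
        (fun i _ => sq_nonneg _) (Finset.mem_univ i)
    unfold lorentzForm at hsq
    rw [hinv] at hsq
    linarith
  have hcol : ∀ b, lorentzForm d (fun a => g.1.1 a b) = lorentzForm d (Pi.single b 1) := fun b => by
    rw [← g.2.1 (Pi.single b 1), Matrix.mulVec_single_one]; rfl
  refine abs_le_of_sq_le_sq ?_ (by linarith)
  rcases b with b | ⟨⟩
  · have hc := hcol (Sum.inl b)
    have e : lorentzForm d (Pi.single (Sum.inl b) 1) = 1 := by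
      simp [lorentzForm, Pi.single_apply]
    rw [e, lorentzForm] at hc
    have hr := hrow b
    rcases a with a | ⟨⟩
    · have h2 : g.1.1 (Sum.inl a) (Sum.inl b) ^ 2 ≤ ∑ i, g.1.1 (Sum.inl i) (Sum.inl b) ^ 2 :=
        Finset.single_le_sum (f := fun i => g.1.1 (Sum.inl i) (Sum.inl b) ^ 2)
          (fun i _ => sq_nonneg _) (Finset.mem_univ a)
      linarith
    · linarith
  · have hc := hcol (Sum.inr ())
    have e : lorentzForm d (Pi.single (Sum.inr ()) 1) = -1 := by
      simp [lorentzForm]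
    rw [e, lorentzForm] at hc
    rcases a with a | ⟨⟩
    · have h2 : g.1.1 (Sum.inl a) (Sum.inr ()) ^ 2 ≤ ∑ i, g.1.1 (Sum.inl i) (Sum.inr ()) ^ 2 :=
        Finset.single_le_sum (f := fun i => g.1.1 (Sum.inl i) (Sum.inr ()) ^ 2)
          (fun i _ => sq_nonneg _) (Finset.mem_univ a)
      change _ ≤ (g.1.1 (Sum.inr ()) (Sum.inr ())) ^ 2
      linarith
    · exact le_rfl

theorem isClosedEmbedding_coe : IsClosedEmbedding fun g : SO0 d => g.1.1 := by
  let e : Matrix (LIdx d) (LIdx d) ℝ ≃ₜ Matrix (Idx d) (Idx d) ℝ :=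
    { (lightConj d).symm.toEquiv with
      continuous_toFun :=
        LinearMap.continuous_of_finiteDimensional (lightConj d).symm.toLinearMap
      continuous_invFun :=
        LinearMap.continuous_of_finiteDimensional (lightConj d).toLinearMap }
  have h := e.isClosedEmbedding.comp (isClosedEmbedding_lm (d := d))
  have h2 : (e ∘ lm : SO0 d → _) = fun g : SO0 d => g.1.1 :=
    funext fun g => by
      rw [Function.comp_apply, lm_eq]
      exact (lightConj d).symm_apply_apply g.1.1
  rwa [h2] at h

theorem continuous_ht : Continuous (ht : SO0 d → ℝ) :=
  (continuous_apply_apply (Sum.inr ()) (Sum.inr ())).comp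
    (isClosedEmbedding_coe (d := d)).continuous

theorem isCompact_ht_le (C : ℝ) : IsCompact {g : SO0 d | ht g ≤ C} := by
  let K : Set (Idx d → Idx d → ℝ) := Set.pi univ fun _ => Set.pi univ fun _ => Icc (-C) C
  have hK : IsCompact K := isCompact_univ_pi fun _ => isCompact_univ_pi fun _ => isCompact_Icc
  have hK' := isClosedEmbedding_coe.isCompact_preimage (K := (K : Set (Matrix (Idx d) (Idx d) ℝ))) hK
  refine hK'.of_isClosed_subset (isClosed_le continuous_ht continuous_const) ?_
  intro g hg a _ b _
  exact abs_le.1 ((abs_entry_le_ht g a b).trans hg)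

section Quotients

variable {G : Type*} [Group G]

/-- The class of `g` in `Γ \ G`. -/
def cl (Γ : Subgroup G) (g : G) : HomSpace Γ := Quotient.mk _ g

theorem cl_surjective (Γ : Subgroup G) : Function.Surjective (cl Γ) := Quotient.mk_surjective

theorem translate_cl (Γ : Subgroup G) (g h : G) : translate (cl Γ g) h = cl Γ (g * h) := rfl

theorem act_cl (Γ₁ Γ₂ : Subgroup G) (a b : G) (g : G × G) :
    act (cl Γ₁ a, cl Γ₂ b) g = (cl Γ₁ (a * g.1), cl Γ₂ (b * g.2)) := rfl

theorem act_act {Γ₁ Γ₂ : Subgroup G} (z : HomSpace Γ₁ × HomSpace Γ₂) (g h : G × G) :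
    act (act z g) h = act z (g * h) := by
  obtain ⟨z₁, z₂⟩ := z
  obtain ⟨a, rfl⟩ := cl_surjective Γ₁ z₁
  obtain ⟨b, rfl⟩ := cl_surjective Γ₂ z₂
  simp only [act_cl, Prod.fst_mul, Prod.snd_mul, mul_assoc]

theorem act_one {Γ₁ Γ₂ : Subgroup G} (z : HomSpace Γ₁ × HomSpace Γ₂) : act z 1 = z := by
  obtain ⟨z₁, z₂⟩ := z
  obtain ⟨a, rfl⟩ := cl_surjective Γ₁ z₁
  obtain ⟨b, rfl⟩ := cl_surjective Γ₂ z₂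
  simp only [act_cl, Prod.fst_one, Prod.snd_one, mul_one]

theorem cl_eq_iff {Γ : Subgroup G} {a b : G} : cl Γ a = cl Γ b ↔ b * a⁻¹ ∈ Γ := by
  rw [cl, cl, Quotient.eq]
  exact QuotientGroup.rightRel_apply

theorem cl_mul_left {Γ : Subgroup G} {γ : G} (hγ : γ ∈ Γ) (a : G) : cl Γ (γ * a) = cl Γ a := by
  rw [cl_eq_iff]
  simpa using hγ

variable [TopologicalSpace G] [IsTopologicalGroup G]

theorem continuous_cl (Γ : Subgroup G) : Continuous (cl Γ) := continuous_quotient_mk'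

theorem isOpenMap_cl (Γ : Subgroup G) : IsOpenMap (cl Γ) :=
  isOpenMap_quotient_mk'_mul (Γ := Γ) (T := G)

theorem continuous_translate {Γ : Subgroup G} (g : G) :
    Continuous fun x : HomSpace Γ => translate x g :=
  isQuotientMap_quotient_mk'.continuous_iff.2 ((continuous_cl Γ).comp (continuous_mul_const g))

theorem continuous_act {Γ₁ Γ₂ : Subgroup G} (g : G × G) :
    Continuous fun z : HomSpace Γ₁ × HomSpace Γ₂ => act z g :=
  ((continuous_translate g.1).comp continuous_fst).prodMk
    ((continuous_translate g.2).comp continuous_snd)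

theorem isOpenMap_act {Γ₁ Γ₂ : Subgroup G} (z : HomSpace Γ₁ × HomSpace Γ₂) :
    IsOpenMap fun g : G × G => act z g := by
  obtain ⟨z₁, z₂⟩ := z
  obtain ⟨a, rfl⟩ := cl_surjective Γ₁ z₁
  obtain ⟨b, rfl⟩ := cl_surjective Γ₂ z₂
  exact ((isOpenMap_cl Γ₁).comp (isOpenMap_mul_left a)).prodMap
    ((isOpenMap_cl Γ₂).comp (isOpenMap_mul_left b))

end Quotients

theorem t2Space_homSpace {Γ : Subgroup (SO0 d)} (hΓ : DiscreteTopology Γ) :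
    T2Space (HomSpace Γ) := by
  have : ProperlyDiscontinuousSMul Γ (SO0 d) :=
    Subgroup.properlyDiscontinuousSMul_of_tendsto_cofinite Γ
      (Subgroup.tendsto_coe_cofinite_of_discrete Γ ⟨hΓ⟩)
  exact t2Space_of_properlyDiscontinuousSMul_of_t2Space (Γ := Γ) (T := SO0 d)

theorem exists_ht_bound {Γ : Subgroup (SO0 d)} {C : Set (HomSpace Γ)} (hC : IsCompact C) :
    ∃ n : ℕ, ∀ g, cl Γ g ∈ C → ∃ γ ∈ Γ, ht (γ * g) ≤ n := by
  obtain ⟨n, hn⟩ := hC.elim_directed_cover (fun n : ℕ => cl Γ '' {g | ht g < n})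
    (fun n => isOpenMap_cl Γ _ (isOpen_lt continuous_ht continuous_const))
    (fun x _ => by
      obtain ⟨g, rfl⟩ := cl_surjective Γ x
      obtain ⟨n, hn⟩ := exists_nat_gt (ht g)
      exact mem_iUnion.2 ⟨n, g, hn, rfl⟩)
    (directed_of_isDirected_le fun m n hmn => image_mono fun g (hg : ht g < m) =>
      hg.trans_le (Nat.cast_le.2 hmn))
  refine ⟨n, fun g hg => ?_⟩
  obtain ⟨g', hg', e⟩ := hn hg
  refine ⟨g' * g⁻¹, cl_eq_iff.1 e.symm, ?_⟩
  rw [inv_mul_cancel_right]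
  exact le_of_lt hg'

/-! ### The limit cone and the renormalized frame bundle -/

/-- The projection of a vector to the Klein model. -/
def kl (x : Idx d → ℝ) : EuclideanSpace ℝ (Fin d) :=
  WithLp.toLp 2 fun i => x (Sum.inl i) / x (Sum.inr ())

theorem klein_eq (x : HypSpace d) : klein d x = kl x.1 := rfl

theorem kl_smul {c : ℝ} (hc : c ≠ 0) (x : Idx d → ℝ) : kl (c • x) = kl x := by
  ext i
  simp [kl, mul_div_mul_left _ _ hc]

theorem continuousAt_kl {x : Idx d → ℝ} (hx : x (Sum.inr ()) ≠ 0) : ContinuousAt kl x := by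
  refine (PiLp.continuous_toLp 2 _).continuousAt.comp (continuousAt_pi.2 fun i => ?_)
  exact (continuous_apply _).continuousAt.div (continuous_apply _).continuousAt hx

theorem inner_kl {x y : Idx d → ℝ} (hx : x (Sum.inr ()) ≠ 0) (hy : y (Sum.inr ()) ≠ 0) :
    inner ℝ (kl x) (kl y) = 1 + lorBil x y / (x (Sum.inr ()) * y (Sum.inr ())) := by
  rw [PiLp.inner_apply, lorBil, sub_div, Finset.sum_div, div_self (mul_ne_zero hx hy)]
  simp only [add_sub_cancel]
  refine Finset.sum_congr rfl fun i _ => ?_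
  simp only [kl, RCLike.inner_apply, conj_trivial]
  field_simp

theorem norm_kl_sq {x : Idx d → ℝ} (hx : x (Sum.inr ()) ≠ 0) :
    ‖kl x‖ ^ 2 = 1 + lorentzForm d x / x (Sum.inr ()) ^ 2 := by
  rw [← real_inner_self_eq_norm_sq, inner_kl hx hx, lorBil_self, sq]

theorem kl_mem_sphere_iff {x : Idx d → ℝ} (hx : x (Sum.inr ()) ≠ 0) :
    kl x ∈ Metric.sphere (0 : EuclideanSpace ℝ (Fin d)) 1 ↔ lorentzForm d x = 0 := by
  rw [mem_sphere_zero_iff_norm, ← sq_eq_sq₀ (norm_nonneg _) zero_le_one, norm_kl_sq hx]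
  simp [hx]

/-- The null vectors over the limit set. -/
def limitCone (Γ : Subgroup (SO0 d)) : Set (Idx d → ℝ) :=
  {x | x (Sum.inr ()) ≠ 0 ∧ kl x ∈ limitSet Γ}

theorem limitCone_smul {Γ : Subgroup (SO0 d)} {x : Idx d → ℝ} (hx : x ∈ limitCone Γ) {c : ℝ}
    (hc : c ≠ 0) : c • x ∈ limitCone Γ :=
  ⟨by simpa using ⟨hc, hx.1⟩, by rw [kl_smul hc]; exact hx.2⟩

theorem isClosed_limitSet (Γ : Subgroup (SO0 d)) : IsClosed (limitSet Γ) :=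
  Metric.isClosed_sphere.inter isClosed_closure

theorem limitCone_of_tendsto {Γ : Subgroup (SO0 d)} {x : ℕ → Idx d → ℝ} {y : Idx d → ℝ}
    (hx : ∀ n, x n ∈ limitCone Γ) (h : Tendsto x atTop (𝓝 y)) (hy : y (Sum.inr ()) ≠ 0) :
    y ∈ limitCone Γ :=
  ⟨hy, (isClosed_limitSet Γ).mem_of_tendsto ((continuousAt_kl hy).tendsto.comp h)
    (Eventually.of_forall fun n => (hx n).2)⟩

theorem lorentzForm_of_mem_limitCone {Γ : Subgroup (SO0 d)} {x : Idx d → ℝ}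
    (hx : x ∈ limitCone Γ) : lorentzForm d x = 0 := (kl_mem_sphere_iff hx.1).1 hx.2.1

theorem inr_ne_zero_of_null {x : Idx d → ℝ} (hx : lorentzForm d x = 0) (h0 : x ≠ 0) :
    x (Sum.inr ()) ≠ 0 := by
  intro h
  apply h0
  rw [lorentzForm, h] at hx
  have h1 := (Finset.sum_eq_zero_iff_of_nonneg (s := Finset.univ)
    (f := fun i : Fin d => x (Sum.inl i) ^ 2) fun i _ => sq_nonneg _).1 (by linarith)
  ext (i | ⟨⟩)
  · exact pow_eq_zero_iff (two_ne_zero) |>.1 (h1 i (Finset.mem_univ i))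
  · exact h

theorem coe_inv_mulVec_mulVec (g : SO0 d) (x : Idx d → ℝ) :
    (g⁻¹).1.1 *ᵥ (g.1.1 *ᵥ x) = x := by
  rw [Matrix.mulVec_mulVec]
  have : (g⁻¹).1.1 * g.1.1 = (1 : Matrix (Idx d) (Idx d) ℝ) := by
    change ((g⁻¹ * g : SO0 d)).1.1 = _
    rw [inv_mul_cancel]; rfl
  rw [this, Matrix.one_mulVec]

/-- The projective action of `γ` on the Klein model is continuous where it is defined and permutes
the orbit of `o`, so it preserves the accumulation points of that orbit. -/
theorem limitCone_mulVec {Γ : Subgroup (SO0 d)} {x : Idx d → ℝ} (hx : x ∈ limitCone Γ)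
    {γ : SO0 d} (hγ : γ ∈ Γ) : γ.1.1 *ᵥ x ∈ limitCone Γ := by
  have hnull : lorentzForm d (γ.1.1 *ᵥ x) = 0 := by
    rw [γ.2.1, lorentzForm_of_mem_limitCone hx]
  have hne : (γ.1.1 *ᵥ x) (Sum.inr ()) ≠ 0 := by
    refine inr_ne_zero_of_null hnull fun h => hx.1 ?_
    have := coe_inv_mulVec_mulVec γ x
    rw [h, Matrix.mulVec_zero] at this
    rw [← this]; rfl
  refine ⟨hne, (kl_mem_sphere_iff hne).2 hnull, ?_⟩
  let hom : EuclideanSpace ℝ (Fin d) → Idx d → ℝ := fun v => Sum.elim v (fun _ => 1)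
  have hhom : Continuous hom := by
    refine continuous_pi fun a => ?_
    rcases a with i | ⟨⟩
    · exact (continuous_apply i).comp (PiLp.continuous_ofLp 2 _)
    · exact continuous_const
  have hkl : ∀ y : Idx d → ℝ, y (Sum.inr ()) ≠ 0 → hom (kl y) = (y (Sum.inr ()))⁻¹ • y := by
    intro y hy
    ext (i | ⟨⟩)
    · simp [hom, kl]; field_simp
    · simp [hom, hy]
  have hF : ∀ y : Idx d → ℝ, y (Sum.inr ()) ≠ 0 →
      kl (γ.1.1 *ᵥ hom (kl y)) = kl (γ.1.1 *ᵥ y) := by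
    intro y hy
    rw [hkl y hy, Matrix.mulVec_smul, kl_smul (inv_ne_zero hy)]
  have hcont : ContinuousAt (fun v => kl (γ.1.1 *ᵥ hom v)) (kl x) := by
    refine ContinuousAt.comp (g := kl) (continuousAt_kl ?_)
      (Continuous.matrix_mulVec continuous_const hhom).continuousAt
    rw [hkl x hx.1, Matrix.mulVec_smul]
    simpa using ⟨hx.1, hne⟩
  have hmem := mem_closure_image hcont hx.2.2
  rw [hF x hx.1] at hmem
  refine closure_mono ?_ hmem
  rintro _ ⟨_, ⟨δ, rfl⟩, rfl⟩
  refine ⟨⟨γ, hγ⟩ * δ, ?_⟩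
  simp only [klein_eq]
  rw [hF _ (by linarith [one_le_inr (δ • basePoint d).2])]
  change kl ((⟨γ, hγ⟩ * δ : Γ) • basePoint d).1 = kl ((⟨γ, hγ⟩ : Γ) • δ • basePoint d).1
  rw [mul_smul]

/-- The limit of a sequence of points near the orbit is in the limit set. -/
theorem mem_limitCone_of_bounded {Γ : Subgroup (SO0 d)} {q : ℕ → SO0 d} {C : ℝ}
    (hq : ∀ n, ∃ γ ∈ Γ, ht (γ * q n) ≤ C) {c : ℕ → ℝ} (hc : ∀ n, 0 < c n)
    (hc0 : Tendsto c atTop (𝓝 0)) {x : Idx d → ℝ} (hx : 0 < x (Sum.inr ()))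
    (hnull : lorentzForm d x = 0)
    (hlim : Tendsto (fun n => c n • (q n • basePoint d).1) atTop (𝓝 x)) :
    x ∈ limitCone Γ := by
  refine ⟨hx.ne', (kl_mem_sphere_iff hx.ne').2 hnull, ?_⟩
  choose γ hγ hb using hq
  let p : ℕ → Idx d → ℝ := fun n => ((γ n)⁻¹ • basePoint d).1
  let y : ℕ → Idx d → ℝ := fun n => (q n • basePoint d).1
  have hp1 : ∀ n, 1 ≤ p n (Sum.inr ()) := fun n => one_le_inr ((γ n)⁻¹ • basePoint d).2
  have hy1 : ∀ n, 1 ≤ y n (Sum.inr ()) := fun n => one_le_inr (q n • basePoint d).2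
  have hpy : ∀ n, -lorBil (p n) (y n) ≤ C := fun n => by
    have h1 : lorBil (p n) (y n) = lorBil (basePoint d).1 ((γ n * q n) • basePoint d).1 := by
      rw [← lorBil_smul (γ n)]
      change lorBil (γ n • (γ n)⁻¹ • basePoint d).1 (γ n • q n • basePoint d).1 = _
      rw [smul_inv_smul, mul_smul]
    rw [h1, lorBil_basePoint, neg_neg, ← ht_eq]
    exact hb n
  have hkly : Tendsto (fun n => kl (y n)) atTop (𝓝 (kl x)) := by
    have := (continuousAt_kl hx.ne').tendsto.comp hlim
    refine this.congr fun n => ?_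
    exact kl_smul (hc n).ne' _
  have hinv : Tendsto (fun n => (y n (Sum.inr ()))⁻¹) atTop (𝓝 0) := by
    have h1 : Tendsto (fun n => c n * y n (Sum.inr ())) atTop (𝓝 (x (Sum.inr ()))) :=
      (tendsto_pi_nhds.1 hlim) (Sum.inr ())
    have h2 := hc0.div h1 hx.ne'
    rw [zero_div] at h2
    refine h2.congr fun n => ?_
    have h3 := (hc n).ne'
    have h4 : y n (Sum.inr ()) ≠ 0 := by linarith [hy1 n]
    simp only [Pi.div_apply]
    field_simp
  -- In the Klein model the squared distance is `-2⟨p, y⟩ / (p_r y_r) - 1 / p_r² - 1 / y_r²`. A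
  -- bounded hyperbolic distance thus becomes a Euclidean distance tending to `0` as `y` goes to
  -- infinity.
  have hdist : ∀ n, ‖kl (p n) - kl (y n)‖ ^ 2 ≤ 2 * C * (y n (Sum.inr ()))⁻¹ := fun n => by
    have hp0 : p n (Sum.inr ()) ≠ 0 := by linarith [hp1 n]
    have hy0 : y n (Sum.inr ()) ≠ 0 := by linarith [hy1 n]
    rw [norm_sub_sq_real, norm_kl_sq hp0, norm_kl_sq hy0, inner_kl hp0 hy0,
      (show lorentzForm d (p n) = -1 from ((γ n)⁻¹ • basePoint d).2.1),
      (show lorentzForm d (y n) = -1 from (q n • basePoint d).2.1)]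
    have hC : 0 ≤ C := by linarith [one_le_ht (γ n * q n), hb n]
    have e1 : 0 ≤ 1 / p n (Sum.inr ()) ^ 2 := by positivity
    have e2 : 0 ≤ 1 / y n (Sum.inr ()) ^ 2 := by positivity
    have e3 : -lorBil (p n) (y n) / (p n (Sum.inr ()) * y n (Sum.inr ()))
        ≤ C * (y n (Sum.inr ()))⁻¹ := by
      rw [div_le_iff₀ (by nlinarith [hp1 n, hy1 n])]
      calc -lorBil (p n) (y n) ≤ C := hpy n
        _ ≤ C * p n (Sum.inr ()) := le_mul_of_one_le_right hC (hp1 n)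
        _ = _ := by field_simp
    rw [neg_div] at e3
    rw [neg_div, neg_div]
    linarith
  have hdiff : Tendsto (fun n => kl (p n) - kl (y n)) atTop (𝓝 0) := by
    have h1 : Tendsto (fun n => 2 * C * (y n (Sum.inr ()))⁻¹) atTop (𝓝 0) := by
      simpa using hinv.const_mul (2 * C)
    have h2 : Tendsto (fun n => ‖kl (p n) - kl (y n)‖ ^ 2) atTop (𝓝 0) :=
      squeeze_zero (fun n => sq_nonneg _) hdist h1
    rw [tendsto_zero_iff_norm_tendsto_zero]
    have h3 := h2.sqrt
    simpa [Real.sqrt_sq (norm_nonneg _)] using h3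
  have hklp : Tendsto (fun n => kl (p n)) atTop (𝓝 (kl x)) := by
    simpa using hdiff.add hkly
  refine mem_closure_of_tendsto hklp (Eventually.of_forall fun n => ?_)
  exact ⟨⟨(γ n)⁻¹, Γ.inv_mem (hγ n)⟩, rfl⟩

/-- The vectors `f₊` and `f₋`. -/
def nullVec (d : ℕ) [NeZero d] (a : LIdx d) : Idx d → ℝ := (lightEquiv d).symm (Pi.single a 1)

theorem lightEquiv_mulVec_nullVec (g : SO0 d) (a : LIdx d) :
    lightEquiv d (g.1.1 *ᵥ nullVec d a) = fun b => lm g b a := by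
  rw [← lm_mulVec, nullVec, LinearEquiv.apply_symm_apply, Matrix.mulVec_single_one]
  rfl

theorem inr_mulVec_nullVec_pos (g : SO0 d) {a : LIdx d} (ha : a = 𝔭 ∨ a = 𝔪) :
    0 < (g.1.1 *ᵥ nullVec d a) (Sum.inr ()) := by
  have h := lm_time_pos g ha
  rw [← (lightEquiv d).symm_apply_apply (g.1.1 *ᵥ nullVec d a), lightEquiv_mulVec_nullVec,
    lightEquiv_symm_inr]
  exact h

theorem lorentzForm_mulVec_nullVec (g : SO0 d) {a : LIdx d} (ha : a = 𝔭 ∨ a = 𝔪) :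
    lorentzForm d (g.1.1 *ᵥ nullVec d a) = 0 := by
  rw [g.2.1, lorentzForm_eq, nullVec, LinearEquiv.apply_symm_apply]
  rcases ha with rfl | rfl <;> simp [lightBil]

theorem mul_boost_smul_basePoint (g : SO0 d) (t : ℝ) :
    ((g * boost d t) • basePoint d).1 = (Real.exp t / 2) • (g.1.1 *ᵥ nullVec d 𝔭)
      + Real.exp (-t) • (g.1.1 *ᵥ nullVec d 𝔪) := by
  have h1 : ((g * boost d t) • basePoint d).1 = g.1.1 *ᵥ ((boost d t).1.1 *ᵥ (basePoint d).1) := by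
    rw [mul_smul]; rfl
  have h2 : (basePoint d).1 = (1 / 2 : ℝ) • nullVec d 𝔭 + nullVec d 𝔪 := by
    apply (lightEquiv d).injective
    rw [map_add, map_smul, nullVec, nullVec, LinearEquiv.apply_symm_apply,
      LinearEquiv.apply_symm_apply, basePoint_eq]
    refine funext (lidx_cases ?_ (fun i => ?_) ?_)
    · rw [lightEquiv_plus]; simp
    · rw [lightEquiv_mid]; simp
    · rw [lightEquiv_minus]; simp
  have h3 : ∀ a, (boost d t).1.1 *ᵥ nullVec d a = Real.exp (wt a * t) • nullVec d a := by
    intro a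
    apply (lightEquiv d).injective
    rw [← lm_mulVec, lm_boost, map_smul, nullVec, LinearEquiv.apply_symm_apply]
    ext b
    rw [Matrix.mulVec_diagonal]
    by_cases e : b = a
    · subst e; simp
    · simp [e]
  rw [h1, h2, Matrix.mulVec_add, Matrix.mulVec_smul, h3, h3, Matrix.mulVec_add, Matrix.mulVec_smul,
    Matrix.mulVec_smul, Matrix.mulVec_smul, smul_smul]
  simp only [wt, Sum.elim_inl, Sum.elim_inr, one_mul, neg_one_mul]
  congr 2
  ring

theorem tendsto_exp_neg_nat : Tendsto (fun n : ℕ => Real.exp (-(n : ℝ))) atTop (𝓝 0) :=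
  Real.tendsto_exp_neg_atTop_nhds_zero.comp tendsto_natCast_atTop_atTop

/-- A flow line that is bounded modulo `Γ` stays within bounded distance of the orbit `Γ o`, so both
of its endpoints are limits of that orbit. -/
theorem mem_limitCone_of_mem_RF {Γ : Subgroup (SO0 d)} {g : SO0 d} (hg : cl Γ g ∈ RF Γ) :
    g.1.1 *ᵥ nullVec d 𝔭 ∈ limitCone Γ ∧ g.1.1 *ᵥ nullVec d 𝔪 ∈ limitCone Γ := by
  obtain ⟨N, hN⟩ := exists_ht_bound hg
  have hb : ∀ t, ∃ γ ∈ Γ, ht (γ * (g * boost d t)) ≤ N := fun t =>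
    hN _ (subset_closure ⟨t, rfl⟩)
  have h0 := tendsto_exp_neg_nat
  have h00 : Tendsto (fun n : ℕ => Real.exp (-(n : ℝ)) * Real.exp (-(n : ℝ))) atTop (𝓝 0) := by
    simpa using h0.mul h0
  constructor
  · refine mem_limitCone_of_bounded (q := fun n : ℕ => g * boost d n)
      (c := fun n : ℕ => 2 * Real.exp (-(n : ℝ))) (fun n => hb n) (fun n => by positivity)
      (by simpa using h0.const_mul 2) (inr_mulVec_nullVec_pos g (Or.inl rfl))
      (lorentzForm_mulVec_nullVec g (Or.inl rfl)) ?_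
    have h := (h00.const_mul 2).smul_const (g.1.1 *ᵥ nullVec d 𝔪)
    have h2 := h.const_add (g.1.1 *ᵥ nullVec d 𝔭)
    rw [mul_zero, zero_smul, add_zero] at h2
    refine h2.congr fun n => ?_
    rw [mul_boost_smul_basePoint, smul_add, smul_smul, smul_smul]
    congr 1
    · rw [show 2 * Real.exp (-(n : ℝ)) * (Real.exp n / 2)
        = Real.exp (-(n : ℝ)) * Real.exp n by ring, ← Real.exp_add]
      simp
    · congr 1; ring
  · refine mem_limitCone_of_bounded (q := fun n : ℕ => g * boost d (-n))
      (c := fun n : ℕ => Real.exp (-(n : ℝ))) (fun n => hb (-n)) (fun n => by positivity)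
      h0 (inr_mulVec_nullVec_pos g (Or.inr rfl))
      (lorentzForm_mulVec_nullVec g (Or.inr rfl)) ?_
    have h := (h00.mul_const (1 / 2)).smul_const (g.1.1 *ᵥ nullVec d 𝔭)
    have h2 := h.add_const (g.1.1 *ᵥ nullVec d 𝔪)
    rw [zero_mul, zero_smul, zero_add] at h2
    refine h2.congr fun n => ?_
    rw [mul_boost_smul_basePoint, smul_add, smul_smul, smul_smul]
    congr 1
    · congr 1; ring
    · rw [neg_neg, ← Real.exp_add]
      simp

/-- In the Klein model a point of the geodesic is a convex combination of the two endpoints; the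
weights are the time coordinates of the two null summands. -/
theorem mul_boost_smul_mem_hypHull {Γ : Subgroup (SO0 d)} {g : SO0 d}
    (hp : g.1.1 *ᵥ nullVec d 𝔭 ∈ limitCone Γ) (hm : g.1.1 *ᵥ nullVec d 𝔪 ∈ limitCone Γ) (t : ℝ) :
    (g * boost d t) • basePoint d ∈ hypHull d (limitSet Γ) := by
  change klein d _ ∈ convexHull ℝ (limitSet Γ)
  rw [klein_eq, mul_boost_smul_basePoint]
  have hp1 := inr_mulVec_nullVec_pos g (Or.inl rfl : (𝔭 : LIdx d) = 𝔭 ∨ (𝔭 : LIdx d) = 𝔪)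
  have hm1 := inr_mulVec_nullVec_pos g (Or.inr rfl : (𝔪 : LIdx d) = 𝔭 ∨ (𝔪 : LIdx d) = 𝔪)
  set x := g.1.1 *ᵥ nullVec d 𝔭
  set y := g.1.1 *ᵥ nullVec d 𝔪
  have hA : 0 < Real.exp t / 2 * x (Sum.inr ()) := by positivity
  have hB : 0 < Real.exp (-t) * y (Sum.inr ()) := by positivity
  have hs : 0 < Real.exp t / 2 * x (Sum.inr ()) + Real.exp (-t) * y (Sum.inr ()) := by positivity
  have hmem := (convex_convexHull ℝ (limitSet Γ)) (subset_convexHull ℝ _ hp.2)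
    (subset_convexHull ℝ _ hm.2)
    (a := Real.exp t / 2 * x (Sum.inr ()) /
      (Real.exp t / 2 * x (Sum.inr ()) + Real.exp (-t) * y (Sum.inr ())))
    (b := Real.exp (-t) * y (Sum.inr ()) /
      (Real.exp t / 2 * x (Sum.inr ()) + Real.exp (-t) * y (Sum.inr ())))
    (by positivity) (by positivity) (by field_simp)
  convert hmem using 1
  ext i
  simp only [kl, Pi.add_apply, Pi.smul_apply, smul_eq_mul, PiLp.add_apply, PiLp.smul_apply]
  field_simp

instance (Γ : Subgroup (SO0 d)) : ContinuousConstSMul Γ (HypSpace d) where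
  continuous_const_smul γ := by
    refine Continuous.subtype_mk (f := fun x : HypSpace d => γ.1.1.1 *ᵥ x.1) ?_ _
    exact Continuous.matrix_mulVec continuous_const continuous_subtype_val

theorem IsConvexCocompact.exists_bound {Γ : Subgroup (SO0 d)} (h : IsConvexCocompact Γ) :
    ∃ n : ℕ, ∀ x ∈ hypHull d (limitSet Γ), ∃ γ : Γ, (γ • x).1 (Sum.inr ()) ≤ n := by
  have hcont : Continuous fun x : HypSpace d => x.1 (Sum.inr ()) :=
    (continuous_apply _).comp continuous_subtype_val
  obtain ⟨n, hn⟩ := h.elim_directed_cover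
    (fun n : ℕ => Quotient.mk (MulAction.orbitRel Γ (HypSpace d)) '' {x | x.1 (Sum.inr ()) < n})
    (fun n => isOpenMap_quotient_mk'_mul (Γ := Γ) (T := HypSpace d) _
      (isOpen_lt hcont continuous_const))
    (fun x _ => by
      obtain ⟨p, rfl⟩ := Quotient.exists_rep x
      obtain ⟨n, hn⟩ := exists_nat_gt (p.1 (Sum.inr ()))
      exact mem_iUnion.2 ⟨n, p, hn, rfl⟩)
    (directed_of_isDirected_le fun m n hmn => image_mono fun x (hx : x.1 (Sum.inr ()) < m) =>
      hx.trans_le (Nat.cast_le.2 hmn))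
  refine ⟨n, fun x hx => ?_⟩
  obtain ⟨y, hy, e⟩ := hn ⟨x, hx, rfl⟩
  obtain ⟨γ, hγ⟩ := MulAction.orbitRel_apply.1 (Quotient.exact e)
  refine ⟨γ, ?_⟩
  change (γ • x) = y at hγ
  rw [hγ]
  exact le_of_lt hy

/-- Points of the renormalized frame bundle are those with both endpoints in the limit set. -/
theorem mem_RF_iff {Γ : Subgroup (SO0 d)} (hΓ : DiscreteTopology Γ) (hcc : IsConvexCocompact Γ)
    (g : SO0 d) : cl Γ g ∈ RF Γ ↔
      g.1.1 *ᵥ nullVec d 𝔭 ∈ limitCone Γ ∧ g.1.1 *ᵥ nullVec d 𝔪 ∈ limitCone Γ := by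
  refine ⟨mem_limitCone_of_mem_RF, fun ⟨hp, hm⟩ => ?_⟩
  obtain ⟨n, hn⟩ := hcc.exists_bound
  have := t2Space_homSpace hΓ
  have hK : IsCompact (cl Γ '' {g | ht g ≤ n}) := (isCompact_ht_le _).image (continuous_cl Γ)
  refine hK.of_isClosed_subset isClosed_closure (closure_minimal ?_ hK.isClosed)
  rintro _ ⟨t, rfl⟩
  obtain ⟨γ, hγ⟩ := hn _ (mul_boost_smul_mem_hypHull hp hm t)
  refine ⟨γ * (g * boost d t), ?_, cl_mul_left γ.2 _⟩
  change ht _ ≤ _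
  rw [ht_eq, mul_smul]
  exact hγ

theorem exists_ht_bound_RF {Γ : Subgroup (SO0 d)} (hcc : IsConvexCocompact Γ) :
    ∃ n : ℕ, ∀ g, cl Γ g ∈ RF Γ → ∃ γ ∈ Γ, ht (γ * g) ≤ n := by
  obtain ⟨n, hn⟩ := hcc.exists_bound
  refine ⟨n, fun g hg => ?_⟩
  obtain ⟨hp, hm⟩ := mem_limitCone_of_mem_RF hg
  obtain ⟨γ, hγ⟩ := hn _ (mul_boost_smul_mem_hypHull hp hm 0)
  rw [boost_zero, mul_one] at hγ
  refine ⟨γ, γ.2, ?_⟩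
  rw [ht_eq, mul_smul]
  exact hγ

/-! ### Return times to the renormalized frame bundle -/

theorem mem_RF_boost {Γ : Subgroup (SO0 d)} {g : SO0 d} (hg : cl Γ g ∈ RF Γ) (u : ℝ) :
    cl Γ (g * boost d u) ∈ RF Γ := by
  have h : (range fun t : ℝ => translate (cl Γ (g * boost d u)) (boost d t))
      ⊆ range fun t : ℝ => translate (cl Γ g) (boost d t) := by
    rintro _ ⟨t, rfl⟩
    refine ⟨u + t, ?_⟩
    simp only [translate_cl, boost_add, mul_assoc]
  exact IsCompact.of_isClosed_subset hg isClosed_closure (closure_mono h)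

theorem mem_RF_congr {Γ : Subgroup (SO0 d)} {g g' : SO0 d} (h : cl Γ g = cl Γ g') (u : SO0 d) :
    cl Γ (g * u) ∈ RF Γ ↔ cl Γ (g' * u) ∈ RF Γ := by
  rw [← translate_cl, h, translate_cl]

theorem tendsto_mulVec {g : ℕ → SO0 d} {h : SO0 d} (hg : Tendsto g atTop (𝓝 h)) (x : Idx d → ℝ) :
    Tendsto (fun n => (g n).1.1 *ᵥ x) atTop (𝓝 (h.1.1 *ᵥ x)) := by
  have h1 := (isClosedEmbedding_coe (d := d)).continuous.tendsto h |>.comp hg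
  have h2 : Continuous fun M : Matrix (Idx d) (Idx d) ℝ => M *ᵥ x :=
    Continuous.matrix_mulVec continuous_id continuous_const
  exact (h2.tendsto _).comp h1

theorem mem_RF_of_tendsto {Γ : Subgroup (SO0 d)} (hΓ : DiscreteTopology Γ)
    (hcc : IsConvexCocompact Γ) {g : ℕ → SO0 d} {h : SO0 d} (hg : ∀ n, cl Γ (g n) ∈ RF Γ)
    (hlim : Tendsto g atTop (𝓝 h)) : cl Γ h ∈ RF Γ := by
  rw [mem_RF_iff hΓ hcc]
  exact ⟨limitCone_of_tendsto (fun n => (mem_limitCone_of_mem_RF (hg n)).1) (tendsto_mulVec hlim _)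
      (inr_mulVec_nullVec_pos h (Or.inl rfl)).ne',
    limitCone_of_tendsto (fun n => (mem_limitCone_of_mem_RF (hg n)).2) (tendsto_mulVec hlim _)
      (inr_mulVec_nullVec_pos h (Or.inr rfl)).ne'⟩

theorem exists_RF_subseq {Γ : Subgroup (SO0 d)} (hΓ : DiscreteTopology Γ)
    (hcc : IsConvexCocompact Γ) {g : ℕ → SO0 d} (hg : ∀ n, cl Γ (g n) ∈ RF Γ) :
    ∃ (g' : ℕ → SO0 d) (h : SO0 d) (φ : ℕ → ℕ), (∀ n, cl Γ (g' n) = cl Γ (g n)) ∧ StrictMono φ ∧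
      Tendsto (g' ∘ φ) atTop (𝓝 h) ∧ cl Γ h ∈ RF Γ := by
  obtain ⟨N, hN⟩ := exists_ht_bound_RF hcc
  choose γ hγ hb using fun n => hN _ (hg n)
  have hcl : ∀ n, cl Γ (γ n * g n) = cl Γ (g n) := fun n => cl_mul_left (hγ n) _
  obtain ⟨h, -, φ, hφ, hlim⟩ := (isCompact_ht_le (N : ℝ)).tendsto_subseq
    (x := fun n => γ n * g n) hb
  refine ⟨fun n => γ n * g n, h, φ, hcl, hφ, hlim, ?_⟩
  exact mem_RF_of_tendsto hΓ hcc (fun n => by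
    change cl Γ (γ (φ n) * g (φ n)) ∈ _
    rw [hcl]; exact hg _) hlim

/-- The parameter of the point `h f₋` of the boundary, seen from `f₊`. -/
def horoPar (h : SO0 d) : HVec d := fun i => lm h (𝔴 i) 𝔪 / lm h 𝔪 𝔪

theorem mulVec_horoPar {h : SO0 d} (hh : lm h 𝔪 𝔪 ≠ 0) :
    h.1.1 *ᵥ nullVec d 𝔪 = lm h 𝔪 𝔪 • ((horo (horoPar h)).1.1 *ᵥ nullVec d 𝔪) := by
  apply (lightEquiv d).injective
  rw [map_smul, lightEquiv_mulVec_nullVec, lightEquiv_mulVec_nullVec, lm_horo]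
  refine funext (lidx_cases ?_ (fun i => ?_) ?_)
  · have hn := lm_null h (Or.inr rfl : (𝔪 : LIdx d) = 𝔭 ∨ (𝔪 : LIdx d) = 𝔪)
    simp only [Pi.smul_apply, smul_eq_mul, horoMat, Matrix.of_apply, Sum.elim_inl, Sum.elim_inr,
      dotProduct, horoPar, ← sq, div_pow]
    rw [← Finset.sum_div, hn]
    field_simp
  · simp only [Pi.smul_apply, smul_eq_mul, horoMat, Matrix.of_apply, Sum.elim_inl, Sum.elim_inr,
      horoPar]
    field_simp
  · simp [horoMat]

theorem coe_mul_mulVec (g h : SO0 d) (x : Idx d → ℝ) :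
    (g * h).1.1 *ᵥ x = g.1.1 *ᵥ (h.1.1 *ᵥ x) := by
  rw [Matrix.mulVec_mulVec]; rfl

theorem horo_mulVec_plus (s : HVec d) : (horo s).1.1 *ᵥ nullVec d 𝔭 = nullVec d 𝔭 := by
  apply (lightEquiv d).injective
  rw [lightEquiv_mulVec_nullVec, lm_horo, nullVec, LinearEquiv.apply_symm_apply]
  refine funext (lidx_cases ?_ (fun i => ?_) ?_) <;> simp [horoMat]

/-- The element `k * horo (horoPar h)` has the forward endpoint of `k` and the backward endpoint of
`k * h`. This turns a limit point into a return time to `RF`. -/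
theorem mem_RF_horoPar {Γ : Subgroup (SO0 d)} (hΓ : DiscreteTopology Γ)
    (hcc : IsConvexCocompact Γ) {k h : SO0 d} (hk : cl Γ k ∈ RF Γ) (hh : lm h 𝔪 𝔪 ≠ 0)
    (hkh : (k * h).1.1 *ᵥ nullVec d 𝔪 ∈ limitCone Γ) : cl Γ (k * horo (horoPar h)) ∈ RF Γ := by
  rw [mem_RF_iff hΓ hcc, coe_mul_mulVec, coe_mul_mulVec, horo_mulVec_plus]
  refine ⟨(mem_limitCone_of_mem_RF hk).1, ?_⟩
  rw [coe_mul_mulVec, mulVec_horoPar hh, Matrix.mulVec_smul] at hkh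
  have := limitCone_smul hkh (inv_ne_zero hh)
  rwa [inv_smul_smul₀ hh] at this

/-- The value at `s` of the polynomial with the monomials in `A` and the coefficients `a`. -/
def pv (A : Finset ({i : Fin d // i ≠ 0} →₀ ℕ)) (a : ({i : Fin d // i ≠ 0} →₀ ℕ) → ℝ)
    (s : HVec d) : ℝ := ∑ m ∈ A, a m * ∏ i, s i ^ m i

theorem eq_zero_of_pv_eq_zero {A : Finset ({i : Fin d // i ≠ 0} →₀ ℕ)}
    {a : ({i : Fin d // i ≠ 0} →₀ ℕ) → ℝ} (h : ∀ s, pv A a s = 0) : ∀ m ∈ A, a m = 0 := by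
  have hq : (∑ m ∈ A, MvPolynomial.monomial m (a m)) = 0 := by
    refine MvPolynomial.funext fun s => ?_
    rw [map_sum, map_zero, ← h s, pv]
    refine Finset.sum_congr rfl fun m _ => ?_
    rw [MvPolynomial.eval_monomial, Finsupp.prod_fintype _ _ fun i => pow_zero _]
  intro m hm
  have := congrArg (MvPolynomial.coeff m) hq
  rw [MvPolynomial.coeff_sum] at this
  simpa [MvPolynomial.coeff_monomial, hm] using this

theorem exists_poly_lm_conj (g : SO0 d) (a b : LIdx d) :
    ∃ p : MvPolynomial (Idx d × Idx d) ℝ, ∀ γ : SO0 d,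
      MvPolynomial.eval (fun ij => γ.1.1 ij.1 ij.2) p = lm (g⁻¹ * γ * g) a b := by
  refine ⟨∑ i, ∑ j, MvPolynomial.C ((lm g⁻¹ * lightConj d (Matrix.single i j 1) * lm g) a b) *
    MvPolynomial.X (i, j), fun γ => ?_⟩
  simp only [map_sum, map_mul, MvPolynomial.eval_C, MvPolynomial.eval_X]
  rw [lm_mul, lm_mul]
  conv_rhs => rw [lm_eq γ, Matrix.matrix_eq_sum_single γ.1.1]
  simp only [map_sum, Matrix.mul_sum, Matrix.sum_mul, Matrix.sum_apply]
  refine Finset.sum_congr rfl fun i _ => Finset.sum_congr rfl fun j _ => ?_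
  have : Matrix.single i j (γ.1.1 i j) = γ.1.1 i j • Matrix.single i j (1 : ℝ) := by
    rw [Matrix.smul_single, smul_eq_mul, mul_one]
  rw [this, map_smul, Matrix.mul_smul, Matrix.smul_mul, Matrix.smul_apply, smul_eq_mul, mul_comm]

/-- A polynomial that vanishes on all the return times vanishes identically. -/
theorem pv_eq_zero_of_return {Γ : Subgroup (SO0 d)} (hΓ : DiscreteTopology Γ)
    (hcc : IsConvexCocompact Γ) (hz : IsZariskiDense Γ) {g : SO0 d} (hg : cl Γ g ∈ RF Γ)
    {A : Finset ({i : Fin d // i ≠ 0} →₀ ℕ)} {a : ({i : Fin d // i ≠ 0} →₀ ℕ) → ℝ}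
    (h : ∀ s, cl Γ (g * horo s) ∈ RF Γ → pv A a s = 0) (s : HVec d) : pv A a s = 0 := by
  choose p hp using fun x => exists_poly_lm_conj g x (𝔪 : LIdx d)
  -- `N` clears the denominators of `pv` at `horoPar (g⁻¹ γ g)`. The additional `1` leaves a
  -- positive power of the denominator in every term, so that `q` vanishes also at those `γ` for
  -- which `horoPar` is meaningless.
  set N : ℕ := 1 + ∑ m ∈ A, ∑ i, m i with hN
  have hNm : ∀ m ∈ A, ∑ i, m i + 1 ≤ N := fun m hm => by
    have := Finset.single_le_sum (f := fun m : ({i : Fin d // i ≠ 0} →₀ ℕ) => ∑ i, m i)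
      (fun _ _ => Nat.zero_le _) hm
    omega
  let q : MvPolynomial (Idx d × Idx d) ℝ :=
    ∑ m ∈ A, MvPolynomial.C (a m) * p 𝔪 ^ (N - ∑ i, m i) * ∏ i, p (𝔴 i) ^ m i
  have hq : ∀ γ : SO0 d, MvPolynomial.eval (fun ij => γ.1.1 ij.1 ij.2) q =
      ∑ m ∈ A, a m * lm (g⁻¹ * γ * g) 𝔪 𝔪 ^ (N - ∑ i, m i) *
        ∏ i, lm (g⁻¹ * γ * g) (𝔴 i) 𝔪 ^ m i := fun γ => by
    simp only [q, map_sum, map_mul, map_pow, map_prod, MvPolynomial.eval_C, hp]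
  have hall := hz q fun γ hγ => by
    rw [hq]
    by_cases h0 : lm (g⁻¹ * γ * g) 𝔪 𝔪 = 0
    · refine Finset.sum_eq_zero fun m hm => ?_
      have := hNm m hm
      rw [h0, zero_pow (by omega), mul_zero, zero_mul]
    · have hmem : cl Γ (g * horo (horoPar (g⁻¹ * γ * g))) ∈ RF Γ := by
        refine mem_RF_horoPar hΓ hcc hg h0 ?_
        rw [show g * (g⁻¹ * γ * g) = γ * g by group, coe_mul_mulVec]
        exact limitCone_mulVec (mem_limitCone_of_mem_RF hg).2 hγ
      have hv := h _ hmem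
      rw [← mul_zero (lm (g⁻¹ * γ * g) 𝔪 𝔪 ^ N), ← hv, pv, Finset.mul_sum]
      refine Finset.sum_congr rfl fun m hm => ?_
      have h1 : ∏ i, lm (g⁻¹ * γ * g) (𝔴 i) 𝔪 ^ m i =
          lm (g⁻¹ * γ * g) 𝔪 𝔪 ^ (∑ i, m i) * ∏ i, horoPar (g⁻¹ * γ * g) i ^ m i := by
        rw [← Finset.prod_pow_eq_pow_sum, ← Finset.prod_mul_distrib]
        refine Finset.prod_congr rfl fun i _ => ?_
        rw [← mul_pow, horoPar, mul_div_cancel₀ _ h0]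
      have h2 : lm (g⁻¹ * γ * g) 𝔪 𝔪 ^ N =
          lm (g⁻¹ * γ * g) 𝔪 𝔪 ^ (N - ∑ i, m i) * lm (g⁻¹ * γ * g) 𝔪 𝔪 ^ (∑ i, m i) := by
        rw [← pow_add]; congr 1; have := hNm m hm; omega
      rw [h1, h2]
      ring
  -- By Zariski density `q` vanishes on the whole group. At a conjugate of `horo s` the denominator
  -- is `1` and `q` reduces to `pv A a s`.
  have hs := hall (g * horo s * g⁻¹)
  rw [hq, show g⁻¹ * (g * horo s * g⁻¹) * g = horo s by group, lm_horo] at hs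
  rw [← hs, pv]
  refine Finset.sum_congr rfl fun m _ => ?_
  simp [horoMat]

/-- The backward endpoint of `h * horo s` is a limit point. Seen from `g n` it has a parameter `t
n`, and `t n` tends to `s`. -/
theorem mem_RF_limit_return {Γ : Subgroup (SO0 d)} (hΓ : DiscreteTopology Γ)
    (hcc : IsConvexCocompact Γ) {g : ℕ → SO0 d} {h : SO0 d} (hg : ∀ n, cl Γ (g n) ∈ RF Γ)
    (hlim : Tendsto g atTop (𝓝 h)) {s : HVec d} (hs : cl Γ (h * horo s) ∈ RF Γ) :
    ∃ t : ℕ → HVec d, Tendsto t atTop (𝓝 s) ∧ ∀ᶠ n in atTop, cl Γ (g n * horo (t n)) ∈ RF Γ := by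
  have hk : Tendsto (fun n => (g n)⁻¹ * (h * horo s)) atTop (𝓝 (horo s)) := by
    have := hlim.inv.mul_const (h * horo s)
    rwa [inv_mul_cancel_left] at this
  have hm : Tendsto (fun n => lm ((g n)⁻¹ * (h * horo s)) 𝔪 𝔪) atTop (𝓝 1) := by
    have := tendsto_lm hk 𝔪 𝔪
    rw [lm_horo] at this
    simpa [horoMat] using this
  refine ⟨fun n => horoPar ((g n)⁻¹ * (h * horo s)), ?_, ?_⟩
  · rw [tendsto_pi_nhds]
    intro i
    have h1 := (tendsto_lm hk (𝔴 i) 𝔪).div hm one_ne_zero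
    rw [lm_horo] at h1
    simp only [horoMat, Matrix.of_apply, Sum.elim_inl, Sum.elim_inr, div_one] at h1
    exact h1
  · filter_upwards [hm.eventually_ne one_ne_zero] with n hn
    refine mem_RF_horoPar hΓ hcc (hg n) hn ?_
    rw [mul_inv_cancel_left]
    exact (mem_limitCone_of_mem_RF hs).2

/-- Return times are uniformly non-degenerate for polynomials, at scale one. -/
theorem exists_return_scale_one {Γ : Subgroup (SO0 d)} (hΓ : DiscreteTopology Γ)
    (hcc : IsConvexCocompact Γ) (hz : IsZariskiDense Γ)
    (A : Finset ({i : Fin d // i ≠ 0} →₀ ℕ)) :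
    ∃ c > 0, ∃ R > 0, ∀ g, cl Γ g ∈ RF Γ → ∀ a : ({i : Fin d // i ≠ 0} →₀ ℕ) → ℝ,
      ∃ s, cl Γ (g * horo s) ∈ RF Γ ∧ ‖s‖ ≤ R ∧ ∀ m ∈ A, c * |a m| ≤ |pv A a s| := by
  -- Compactness: in a sequence of counterexamples the frames converge in `RF` modulo `Γ` and the
  -- normalized coefficients converge on the unit sphere. The limiting polynomial vanishes at every
  -- return time of the limiting frame, which Zariski density forbids.
  by_contra! hcon
  choose g₀ hg₀ a ha₀ using fun n : ℕ =>
    hcon (1 / (n + 1 : ℝ)) (by positivity) (n + 1 : ℝ) (by positivity)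
  obtain ⟨g, h, φ, hcl, hφ, hlim, hh⟩ := exists_RF_subseq hΓ hcc hg₀
  have ha : ∀ n s, cl Γ (g n * horo s) ∈ RF Γ → ‖s‖ ≤ n + 1 →
      ∃ m ∈ A, |pv A (a n) s| < 1 / (n + 1 : ℝ) * |a n m| := fun n s hs hsn =>
    ha₀ n s ((mem_RF_congr (hcl n) _).1 hs) hsn
  let b : ℕ → A → ℝ := fun n m => a n m
  have hb0 : ∀ n, 0 < ‖b n‖ := fun n => by
    -- The time `0` is always a return time, and the strict inequality there shows that the
    -- coefficients are not all zero.
    obtain ⟨m, hm, hlt⟩ := ha n 0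
      (by rw [horo_zero, mul_one, hcl]; exact hg₀ n) (by rw [norm_zero]; positivity)
    refine norm_pos_iff.2 fun h0 => ?_
    have : a n m = 0 := congrFun h0 ⟨m, hm⟩
    rw [this, abs_zero, mul_zero] at hlt
    exact absurd hlt (not_lt.2 (abs_nonneg _))
  have hunit : ∀ n, (‖b (φ n)‖⁻¹ • b (φ n)) ∈ Metric.sphere (0 : A → ℝ) 1 := fun n => by
    rw [mem_sphere_zero_iff_norm, norm_smul, norm_inv, norm_norm, inv_mul_cancel₀ (hb0 _).ne']
  obtain ⟨β, hβ, ψ, hψ, hlimβ⟩ := (isCompact_sphere (0 : A → ℝ) 1).tendsto_subseq hunit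
  let α : ({i : Fin d // i ≠ 0} →₀ ℕ) → ℝ := fun m => if hm : m ∈ A then β ⟨m, hm⟩ else 0
  have hpvα : ∀ s, pv A α s = ∑ m : A, β m * ∏ i, s i ^ m.1 i := fun s => by
    rw [pv, ← Finset.sum_coe_sort]
    exact Finset.sum_congr rfl fun m _ => by simp [α]
  have hpva : ∀ n s, pv A (a n) s = ∑ m : A, b n m * ∏ i, s i ^ m.1 i := fun n s => by
    rw [pv, ← Finset.sum_coe_sort]
  have hvan : ∀ s, cl Γ (h * horo s) ∈ RF Γ → pv A α s = 0 := by
    intro s hs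
    obtain ⟨t, ht, htm⟩ := mem_RF_limit_return hΓ hcc (g := fun n => g (φ (ψ n)))
      (fun n => by rw [hcl]; exact hg₀ _) (hlim.comp hψ.tendsto_atTop) hs
    have hconv : Tendsto (fun n => ∑ m : A, (‖b (φ (ψ n))‖⁻¹ • b (φ (ψ n))) m *
        ∏ i, t n i ^ m.1 i) atTop (𝓝 (∑ m : A, β m * ∏ i, s i ^ m.1 i)) := by
      refine tendsto_finsetSum _ fun m _ => ((tendsto_pi_nhds.1 hlimβ) m).mul ?_
      exact tendsto_finsetProd _ fun i _ => ((tendsto_pi_nhds.1 ht) i).pow _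
    rw [hpvα]
    refine tendsto_nhds_unique hconv ?_
    have hidx : Tendsto (fun n => φ (ψ n)) atTop atTop := hφ.tendsto_atTop.comp hψ.tendsto_atTop
    have hsmall : Tendsto (fun n => 1 / ((φ (ψ n) : ℝ) + 1)) atTop (𝓝 0) :=
      tendsto_one_div_add_atTop_nhds_zero_nat.comp hidx
    have hbd : ∀ᶠ n in atTop, ‖t n‖ ≤ (φ (ψ n) : ℝ) + 1 := by
      have h1 : ∀ᶠ n in atTop, ‖t n‖ < ‖s‖ + 1 := ht.norm.eventually_lt_const (by linarith)
      have h2 : ∀ᶠ n in atTop, ‖s‖ ≤ (φ (ψ n) : ℝ) :=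
        (tendsto_natCast_atTop_atTop.comp hidx).eventually_ge_atTop _
      filter_upwards [h1, h2] with n h3 h4
      linarith
    refine squeeze_zero_norm' ?_ hsmall
    filter_upwards [htm, hbd] with n h1 h2
    obtain ⟨m, hm, hlt⟩ := ha _ _ h1 h2
    have e : ∑ m : A, (‖b (φ (ψ n))‖⁻¹ • b (φ (ψ n))) m * ∏ i, t n i ^ m.1 i
        = ‖b (φ (ψ n))‖⁻¹ * pv A (a (φ (ψ n))) (t n) := by
      rw [hpva, Finset.mul_sum]
      exact Finset.sum_congr rfl fun m _ => by simp only [Pi.smul_apply, smul_eq_mul]; ring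
    rw [e, norm_mul, norm_inv, norm_norm, Real.norm_eq_abs]
    rw [inv_mul_le_iff₀ (hb0 _)]
    have hle : |a (φ (ψ n)) m| ≤ ‖b (φ (ψ n))‖ := norm_le_pi_norm (b (φ (ψ n))) ⟨m, hm⟩
    calc _ ≤ 1 / ((φ (ψ n) : ℝ) + 1) * |a (φ (ψ n)) m| := hlt.le
      _ ≤ 1 / ((φ (ψ n) : ℝ) + 1) * ‖b (φ (ψ n))‖ := by gcongr
      _ = _ := mul_comm _ _
  have hzero := eq_zero_of_pv_eq_zero (pv_eq_zero_of_return hΓ hcc hz hh hvan)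
  have hβ0 : β = 0 := funext fun m => by
    have := hzero m m.2
    simpa [α] using this
  rw [hβ0, mem_sphere_zero_iff_norm, norm_zero] at hβ
  exact zero_ne_one hβ

/-- Return times are uniformly non-degenerate for polynomials, at every scale. -/
theorem exists_return {Γ : Subgroup (SO0 d)} (hΓ : DiscreteTopology Γ)
    (hcc : IsConvexCocompact Γ) (hz : IsZariskiDense Γ)
    (A : Finset ({i : Fin d // i ≠ 0} →₀ ℕ)) :
    ∃ c > 0, ∃ R₀ > 0, ∀ g, cl Γ g ∈ RF Γ → ∀ (a : ({i : Fin d // i ≠ 0} →₀ ℕ) → ℝ) (R : ℝ), 0 < R →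
      ∃ s, cl Γ (g * horo s) ∈ RF Γ ∧ ‖s‖ ≤ R₀ * R ∧
        ∀ m ∈ A, c * (R ^ (∑ i, m i) * |a m|) ≤ |pv A a s| := by
  obtain ⟨c, hc, R₀, hR₀, h⟩ := exists_return_scale_one hΓ hcc hz A
  refine ⟨c, hc, R₀, hR₀, fun g hg a R hR => ?_⟩
  -- Flowing for time `log R` preserves `RF` and rescales the horospherical parameter by `R`, which
  -- reduces to scale one with the coefficients multiplied by `R ^ |m|`.
  obtain ⟨s, hs, hsR, hm⟩ := h (g * boost d (Real.log R)) (mem_RF_boost hg _)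
    fun m => R ^ (∑ i, m i) * a m
  refine ⟨R • s, ?_, ?_, fun m hmA => ?_⟩
  · have e : g * boost d (Real.log R) * horo s * boost d (-Real.log R) = g * horo (R • s) := by
      have := boost_conj_horo (-Real.log R) s
      rw [neg_neg, Real.exp_log hR] at this
      rw [← this]
      simp only [mul_assoc]
    have := mem_RF_boost hs (-Real.log R)
    rwa [e] at this
  · rw [norm_smul, Real.norm_of_nonneg hR.le, mul_comm]
    gcongr
  · have e : pv A (fun m => R ^ (∑ i, m i) * a m) s = pv A a (R • s) := by
      unfold pv
      refine Finset.sum_congr rfl fun m _ => ?_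
      simp only [Pi.smul_apply, smul_eq_mul, mul_pow, Finset.prod_mul_distrib,
        Finset.prod_pow_eq_pow_sum]
      ring
    have := hm m hmA
    rw [e, abs_mul, abs_of_pos (pow_pos hR _)] at this
    exact this

/-! ### Recurrence of horospherical orbits -/

theorem eventually_eq_one_of_tendsto {Γ : Subgroup (SO0 d)} (hΓ : DiscreteTopology Γ)
    {γ : ℕ → SO0 d} (hγ : ∀ n, γ n ∈ Γ) (h : Tendsto γ atTop (𝓝 1)) : ∀ᶠ n in atTop, γ n = 1 := by
  have h1 : Tendsto (fun n => (⟨γ n, hγ n⟩ : Γ)) atTop (𝓝 1) :=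
    tendsto_subtype_rng.2 h
  rw [nhds_discrete, tendsto_pure] at h1
  exact h1.mono fun n hn => congrArg Subtype.val hn

theorem exists_RF_lift {Γ : Subgroup (SO0 d)} (hΓ : DiscreteTopology Γ)
    (hcc : IsConvexCocompact Γ) {g : ℕ → SO0 d} (hg : ∀ n, cl Γ (g n) ∈ RF Γ) :
    ∃ (γ : ℕ → SO0 d) (h : SO0 d) (φ : ℕ → ℕ), (∀ n, γ n ∈ Γ) ∧ StrictMono φ ∧
      Tendsto (fun n => γ (φ n) * g (φ n)) atTop (𝓝 h) ∧ cl Γ h ∈ RF Γ := by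
  obtain ⟨g', h, φ, hcl, hφ, hlim, hh⟩ := exists_RF_subseq hΓ hcc hg
  refine ⟨fun n => g' n * (g n)⁻¹, h, φ, fun n => cl_eq_iff.1 (hcl n).symm, hφ, ?_, hh⟩
  simp only [inv_mul_cancel_right]
  exact hlim

/-- The injectivity radius is bounded below on the renormalized frame bundle. -/
theorem exists_injective_nhds {Γ : Subgroup (SO0 d)} (hΓ : DiscreteTopology Γ)
    (hcc : IsConvexCocompact Γ) : ∃ O ∈ 𝓝 (1 : SO0 d), ∀ g, cl Γ g ∈ RF Γ → ∀ δ ∈ O,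
      g * δ * g⁻¹ ∈ Γ → δ = 1 := by
  by_contra! hcon
  have hfr : ∃ᶠ δ in 𝓝 (1 : SO0 d), ∃ g, cl Γ g ∈ RF Γ ∧ g * δ * g⁻¹ ∈ Γ ∧ δ ≠ 1 := by
    rw [frequently_iff]
    intro O hO
    obtain ⟨g, hg, δ, hδ, h1, h2⟩ := hcon O hO
    exact ⟨δ, hδ, g, hg, h1, h2⟩
  obtain ⟨δ, hδ, hP⟩ := exists_seq_forall_of_frequently hfr
  choose g hg hgδ hne using hP
  obtain ⟨γ, h, φ, hγ, hφ, hlim, -⟩ := exists_RF_lift hΓ hcc hg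
  have hδφ := hδ.comp hφ.tendsto_atTop
  have hconj : Tendsto (fun n => (γ (φ n) * g (φ n)) * δ (φ n) * (γ (φ n) * g (φ n))⁻¹) atTop
      (𝓝 1) := by
    have := (hlim.mul hδφ).mul hlim.inv
    simpa using this
  obtain ⟨n, hn⟩ := (eventually_eq_one_of_tendsto hΓ (fun n => by
    have := Γ.mul_mem (Γ.mul_mem (hγ (φ n)) (hgδ (φ n))) (Γ.inv_mem (hγ (φ n)))
    convert this using 1
    group) hconj).exists
  exact hne (φ n) (conj_eq_one_iff.1 hn)

theorem exists_cocompact_lift {Γ : Subgroup (SO0 d)} (hc : CompactSpace (HomSpace Γ))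
    (g : ℕ → SO0 d) : ∃ (γ : ℕ → SO0 d) (h : SO0 d) (φ : ℕ → ℕ), (∀ n, γ n ∈ Γ) ∧ StrictMono φ ∧
      Tendsto (fun n => γ (φ n) * g (φ n)) atTop (𝓝 h) := by
  obtain ⟨N, hN⟩ := exists_ht_bound (isCompact_univ (X := HomSpace Γ))
  choose γ hγ hb using fun n => hN (g n) (mem_univ _)
  obtain ⟨h, -, φ, hφ, hlim⟩ := (isCompact_ht_le (N : ℝ)).tendsto_subseq
    (x := fun n => γ n * g n) hb
  exact ⟨γ, h, φ, hγ, hφ, hlim⟩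

theorem exists_Omega_subseq {Γ₁ Γ₂ : Subgroup (SO0 d)} (hΓ₁ : DiscreteTopology Γ₁)
    (hcc : IsConvexCocompact Γ₁) (hc : CompactSpace (HomSpace Γ₂))
    {z : ℕ → HomSpace Γ₁ × HomSpace Γ₂} (hz : ∀ n, z n ∈ Omega Γ₁ Γ₂) :
    ∃ w ∈ Omega Γ₁ Γ₂, ∃ (φ : ℕ → ℕ) (g : ℕ → SO0 d × SO0 d), StrictMono φ ∧
      Tendsto g atTop (𝓝 1) ∧ ∀ n, z (φ n) = act w (g n) := by
  choose a ha using fun n => cl_surjective Γ₁ (z n).1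
  choose b hb using fun n => cl_surjective Γ₂ (z n).2
  obtain ⟨γ, h, φ, hγ, hφ, hlim, hh⟩ := exists_RF_lift hΓ₁ hcc (g := a)
    (fun n => by rw [ha]; exact (hz n).1)
  obtain ⟨δ, k, ψ, hδ, hψ, hlim'⟩ := exists_cocompact_lift hc fun n => b (φ n)
  refine ⟨(cl Γ₁ h, cl Γ₂ k), ⟨hh, mem_univ _⟩, φ ∘ ψ,
    fun n => (h⁻¹ * (γ (φ (ψ n)) * a (φ (ψ n))), k⁻¹ * (δ (ψ n) * b (φ (ψ n)))),
    hφ.comp hψ, ?_, fun n => ?_⟩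
  · have h1 := (hlim.comp hψ.tendsto_atTop).const_mul h⁻¹
    have h2 := hlim'.const_mul k⁻¹
    rw [inv_mul_cancel] at h1 h2
    exact h1.prodMk_nhds h2
  · rw [act_cl]
    simp only [mul_inv_cancel_left, cl_mul_left (hγ _), cl_mul_left (hδ _), ha, hb,
      Function.comp_apply]

theorem tendsto_act {Γ₁ Γ₂ : Subgroup (SO0 d)} (z : HomSpace Γ₁ × HomSpace Γ₂)
    {g : ℕ → SO0 d × SO0 d} {h : SO0 d × SO0 d} (hg : Tendsto g atTop (𝓝 h)) :
    Tendsto (fun n => act z (g n)) atTop (𝓝 (act z h)) := by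
  obtain ⟨z₁, z₂⟩ := z
  obtain ⟨a, rfl⟩ := cl_surjective Γ₁ z₁
  obtain ⟨b, rfl⟩ := cl_surjective Γ₂ z₂
  exact (((continuous_cl Γ₁).comp ((continuous_const_mul a).comp continuous_fst)).prodMk
    ((continuous_cl Γ₂).comp ((continuous_const_mul b).comp continuous_snd))).tendsto h |>.comp hg

theorem diag_horo_mem (s : HVec d) : ((horo s, horo s) : SO0 d × SO0 d) ∈ diagU d :=
  ⟨horo s, horo_mem s, rfl⟩

theorem mem_diagU_iff {u : SO0 d × SO0 d} : u ∈ diagU d ↔ ∃ s : HVec d, u = (horo s, horo s) := by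
  constructor
  · rintro ⟨v, hv, rfl⟩
    obtain ⟨s, rfl⟩ := mem_horospherical_iff.1 hv
    exact ⟨s, rfl⟩
  · rintro ⟨s, rfl⟩
    exact diag_horo_mem s

theorem act_horo_mem_Omega_iff {Γ₁ Γ₂ : Subgroup (SO0 d)} (a b : SO0 d) (g : SO0 d × SO0 d) :
    act (cl Γ₁ a, cl Γ₂ b) g ∈ Omega Γ₁ Γ₂ ↔ cl Γ₁ (a * g.1) ∈ RF Γ₁ := by
  rw [act_cl]
  exact ⟨fun h => h.1, fun h => ⟨h, mem_univ _⟩⟩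

/-- A relatively minimal set has a point with returns transverse to the parabolic subgroup. -/
theorem exists_transverse_return [Nonempty {i : Fin d // i ≠ 0}] {Γ₁ Γ₂ : Subgroup (SO0 d)}
    (hΓ₁ : DiscreteTopology Γ₁) (hcc : IsConvexCocompact Γ₁) (hz : IsZariskiDense Γ₁)
    (hc : CompactSpace (HomSpace Γ₂)) {X Y : Set (HomSpace Γ₁ × HomSpace Γ₂)}
    (hY : IsRelMinimal X Y) :
    ∃ w ∈ Y ∩ Omega Γ₁ Γ₂, ∃ᶠ g in 𝓝 (1 : SO0 d × SO0 d), act w g ∈ Y ∧ ¬ IsPar g.1 := by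
  obtain ⟨i⟩ := ‹Nonempty {i : Fin d // i ≠ 0}›
  obtain ⟨⟨z₁, z₂⟩, hzY, hzΩ⟩ := hY.nonempty
  obtain ⟨a, rfl⟩ := cl_surjective Γ₁ z₁
  obtain ⟨b, rfl⟩ := cl_surjective Γ₂ z₂
  have ha : cl Γ₁ a ∈ RF Γ₁ := hzΩ.1
  have hs : ∀ n : ℕ, ∃ s : HVec d, cl Γ₁ (a * horo s) ∈ RF Γ₁ ∧ (n : ℝ) ≤ |s i| := by
    obtain ⟨c, hc, R₀, hR₀, h⟩ := exists_return hΓ₁ hcc hz {Finsupp.single i 1}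
    intro n
    -- Applied to the polynomial `s i`, the scale `(n + 1) / c` forces `|s i| ≥ n + 1`.
    obtain ⟨s, hs, -, hm⟩ := h a ha (fun _ => 1) ((n + 1) / c) (by positivity)
    refine ⟨s, hs, ?_⟩
    have h1 := hm _ (Finset.mem_singleton_self _)
    have e1 : ∑ j, (Finsupp.single i 1 : {i : Fin d // i ≠ 0} →₀ ℕ) j = 1 := by
      simp [Finsupp.single_apply]
    have e2 : pv {Finsupp.single i 1} (fun _ => 1) s = s i := by
      rw [pv, Finset.sum_singleton, one_mul, Finset.prod_eq_single i]
      · simp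
      · intro j _ hj; simp [hj.symm]
      · simp
    rw [e1, e2, abs_one, mul_one, pow_one, mul_div_cancel₀ _ hc.ne'] at h1
    linarith
  choose s hsRF hsn using hs
  obtain ⟨w, hwΩ, φ, g, hφ, hg, hzg⟩ := exists_Omega_subseq hΓ₁ hcc hc
    (z := fun n => act (cl Γ₁ a, cl Γ₂ b) (horo (s n), horo (s n)))
    (fun n => (act_horo_mem_Omega_iff a b _).2 (hsRF n))
  have hYn : ∀ n, act w (g n) ∈ Y := fun n => by
    rw [← hzg]; exact hY.invariant _ hzY _ (diag_horo_mem _)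
  have hwY : w ∈ Y := by
    have := tendsto_act w hg
    rw [act_one] at this
    exact hY.isClosed.mem_of_tendsto this (Eventually.of_forall hYn)
  refine ⟨w, ⟨hwY, hwΩ⟩, ?_⟩
  -- Otherwise all small returns `g n` have parabolic first component `p n`. It will follow that the
  -- return times `s (φ n)` converge, although they were chosen unbounded.
  by_contra hcon
  rw [not_frequently] at hcon
  obtain ⟨w₁, w₂⟩ := w
  obtain ⟨a', rfl⟩ := cl_surjective Γ₁ w₁
  obtain ⟨b', rfl⟩ := cl_surjective Γ₂ w₂
  have ha' : cl Γ₁ a' ∈ RF Γ₁ := hwΩ.1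
  let p : ℕ → SO0 d := fun n => (g n).1
  have hp1 : Tendsto p atTop (𝓝 1) := (continuous_fst.tendsto _).comp hg
  have hpar : ∀ᶠ n in atTop, IsPar (p n) := by
    filter_upwards [hg.eventually hcon] with n hn
    by_contra h
    exact hn ⟨hYn n, h⟩
  have hcl : ∀ n, cl Γ₁ (a * horo (s (φ n))) = cl Γ₁ (a' * p n) := fun n =>
    congrArg Prod.fst (hzg n)
  have hcl2 : ∀ n, cl Γ₁ a = cl Γ₁ (a' * p n * horo (-s (φ n))) := fun n => by
    have := congrArg (fun x => translate x (horo (-s (φ n)))) (hcl n)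
    simp only [translate_cl] at this
    rwa [horo_neg, mul_inv_cancel_right, ← horo_neg] at this
  obtain ⟨O, hO, hinj⟩ := exists_injective_nhds hΓ₁ hcc
  obtain ⟨O₃, hO₃, hmulO⟩ : ∃ O₃ ∈ 𝓝 (1 : SO0 d), ∀ x ∈ O₃, ∀ y ∈ O₃, ∀ z ∈ O₃, x * y * z⁻¹ ∈ O := by
    have hf : Tendsto (fun q : SO0 d × SO0 d × SO0 d => q.1 * q.2.1 * q.2.2⁻¹)
        (𝓝 1 ×ˢ (𝓝 1 ×ˢ 𝓝 1)) (𝓝 1) := by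
      rw [← nhds_prod_eq, ← nhds_prod_eq]
      have hcont : Continuous fun q : SO0 d × SO0 d × SO0 d => q.1 * q.2.1 * q.2.2⁻¹ := by
        fun_prop
      simpa using hcont.tendsto (1, 1, 1)
    have h1 := hf hO
    rw [mem_map, mem_prod_iff] at h1
    obtain ⟨U, hU, V, hV, hUV⟩ := h1
    rw [mem_prod_iff] at hV
    obtain ⟨V₁, hV₁, V₂, hV₂, hV12⟩ := hV
    exact ⟨U ∩ (V₁ ∩ V₂), inter_mem hU (inter_mem hV₁ hV₂), fun x hx y hy z hz =>
      hUV (⟨hx.1, hV12 ⟨hy.2.1, hz.2.2⟩⟩ : (x, y, z) ∈ U ×ˢ V)⟩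
  obtain ⟨N, hN⟩ := eventually_atTop.1
    (hpar.and (hp1.eventually (eventually_isPar_boost_conj hO₃)))
  -- Comparing two returns gives an element of a conjugate of `Γ₁`. Under the flow its horospherical
  -- factor contracts and its parabolic factors stay small, while the base point stays in `RF`; the
  -- lower bound on the injectivity radius makes it trivial.
  have hkey : ∀ m ≥ N, p N * horo (s (φ m) - s (φ N)) * (p m)⁻¹ = 1 := by
    intro m hm
    set δ := p N * horo (s (φ m) - s (φ N)) * (p m)⁻¹ with hδ
    have hmem : a' * δ * a'⁻¹ ∈ Γ₁ := by
      have h1 := (hcl2 m).symm.trans (hcl2 N)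
      rw [cl_eq_iff] at h1
      convert h1 using 1
      have e : horo (s (φ m) - s (φ N)) = horo (-s (φ N)) * (horo (-s (φ m)))⁻¹ := by
        rw [← horo_neg, neg_neg, ← horo_add, neg_add_eq_sub]
      rw [hδ, e]
      group
    obtain ⟨t, ht, ht0⟩ := (((tendsto_boost_conj_horo (s (φ m) - s (φ N))).eventually hO₃).and
      (eventually_ge_atTop (0 : ℝ))).exists
    have hbb : boost d t * boost d (-t) = 1 := by simpa using boost_neg_mul d (-t)
    have hin : boost d (-t) * δ * boost d t ∈ O := by
      have h1 := hmulO _ ((hN N le_rfl).2 (hN N le_rfl).1 t ht0) _ ht _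
        ((hN m hm).2 (hN m hm).1 t ht0)
      convert h1 using 1
      rw [hδ, boost_neg]
      group
    have h2 := hinj (a' * boost d t) (mem_RF_boost ha' t) _ hin (by
      convert hmem using 1
      rw [boost_neg]
      group)
    rw [boost_neg] at h2
    have h3 : (boost d t)⁻¹ * δ * ((boost d t)⁻¹)⁻¹ = 1 := by rw [inv_inv]; exact h2
    exact conj_eq_one_iff.1 h3
  have hconv : Tendsto (fun m => lm ((p N)⁻¹ * p m) (𝔴 i) 𝔪) atTop (𝓝 (lm ((p N)⁻¹) (𝔴 i) 𝔪)) := by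
    have := hp1.const_mul (p N)⁻¹
    rw [mul_one] at this
    exact tendsto_lm this _ _
  have hval : ∀ m ≥ N, lm ((p N)⁻¹ * p m) (𝔴 i) 𝔪 = s (φ m) i - s (φ N) i := fun m hm => by
    have h1 : (p N)⁻¹ * p m = horo (s (φ m) - s (φ N)) := by
      have := hkey m hm
      rw [mul_inv_eq_one] at this
      rw [← this, inv_mul_cancel_left]
    rw [h1, lm_horo]
    simp [horoMat]
  have hbd := hconv.abs.eventually_lt_const (lt_add_one _)
  have hlarge : ∀ᶠ m in atTop, |lm ((p N)⁻¹) (𝔴 i) 𝔪| + 1 + |s (φ N) i| ≤ (φ m : ℝ) :=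
    (tendsto_natCast_atTop_atTop.comp hφ.tendsto_atTop).eventually_ge_atTop _
  obtain ⟨m, ⟨h1, h2⟩, h3⟩ := ((hbd.and hlarge).and (eventually_ge_atTop N)).exists
  rw [hval m h3] at h1
  have h4 := hsn (φ m)
  have h5 : |s (φ m) i| ≤ |s (φ m) i - s (φ N) i| + |s (φ N) i| := by
    simpa using abs_add_le (s (φ m) i - s (φ N) i) (s (φ N) i)
  linarith

/-! ### Polynomial expansions -/

/-- The matrix `horoMat (c • s)` with entries that are polynomials in `s`. -/
def horoPoly (d : ℕ) [NeZero d] (c : ℝ) :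
    Matrix (LIdx d) (LIdx d) (MvPolynomial {i : Fin d // i ≠ 0} ℝ) :=
  Matrix.of (Sum.elim (fun _ => Sum.elim (fun _ => 1)
      (Sum.elim (fun i => MvPolynomial.C c * MvPolynomial.X i)
        (fun _ => MvPolynomial.C (c ^ 2 / 2) * ∑ i, MvPolynomial.X i ^ 2)))
    (Sum.elim (fun i => Sum.elim (fun _ => 0)
        (Sum.elim (fun j => if i = j then 1 else 0)
          (fun _ => MvPolynomial.C c * MvPolynomial.X i)))
      (fun _ => Sum.elim (fun _ => 0) (Sum.elim (fun _ => 0) (fun _ => 1)))))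

theorem eval_horoPoly (c : ℝ) (s : HVec d) (a b : LIdx d) :
    MvPolynomial.eval s (horoPoly d c a b) = horoMat (c • s) a b := by
  rcases a with ⟨⟩ | i | ⟨⟩ <;> rcases b with ⟨⟩ | j | ⟨⟩ <;>
    simp [horoPoly, horoMat, dotProduct, apply_ite (MvPolynomial.eval s)]
  rw [Finset.mul_sum, Finset.sum_div]
  refine Finset.sum_congr rfl fun i _ => ?_
  ring

/-- The coefficients of the entries of `horo (-s) * K * horo s` as polynomials in `s`. -/
def conjCoeff (K : Matrix (LIdx d) (LIdx d) ℝ) (a b : LIdx d) (m : {i : Fin d // i ≠ 0} →₀ ℕ) : ℝ :=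
  ∑ j, ∑ k, K j k * (horoPoly d (-1) a j * horoPoly d 1 k b).coeff m

/-- The coefficients of the `f₊`-component of `horo (-s) x` as a polynomial in `s`. -/
def vecCoeff (x : LIdx d → ℝ) (m : {i : Fin d // i ≠ 0} →₀ ℕ) : ℝ :=
  ∑ j, x j * (horoPoly d (-1) 𝔭 j).coeff m

/-- The finite set `A` contains the monomials that occur in the polynomial expansions. -/
structure IsExpSupport (A : Finset ({i : Fin d // i ≠ 0} →₀ ℕ)) : Prop where
  zero_mem : 0 ∈ A
  single_mem : ∀ i, Finsupp.single i 1 ∈ A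
  mul_subset : ∀ a j k b, (horoPoly d (-1) a j * horoPoly d 1 k b).support ⊆ A
  subset : ∀ j, (horoPoly d (-1) 𝔭 j).support ⊆ A

theorem exists_finset_superset {α β : Type*} [Finite α] (F : α → Finset β) :
    ∃ A : Finset β, ∀ a, F a ⊆ A := by
  classical
  cases nonempty_fintype α
  exact ⟨Finset.univ.biUnion F, fun a => Finset.subset_biUnion_of_mem F (Finset.mem_univ a)⟩

theorem exists_isExpSupport (d : ℕ) [NeZero d] :
    ∃ A : Finset ({i : Fin d // i ≠ 0} →₀ ℕ), IsExpSupport A := by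
  classical
  obtain ⟨A₁, h₁⟩ := exists_finset_superset fun q : LIdx d × LIdx d × LIdx d × LIdx d =>
    (horoPoly d (-1) q.1 q.2.1 * horoPoly d 1 q.2.2.1 q.2.2.2).support
  obtain ⟨A₂, h₂⟩ := exists_finset_superset fun j : LIdx d => (horoPoly d (-1) 𝔭 j).support
  obtain ⟨A₃, h₃⟩ := exists_finset_superset fun i : {i : Fin d // i ≠ 0} =>
    ({Finsupp.single i 1} : Finset ({i : Fin d // i ≠ 0} →₀ ℕ))
  refine ⟨{0} ∪ A₃ ∪ (A₁ ∪ A₂), ⟨?_, fun i => ?_, fun a j k b => ?_, fun j => ?_⟩⟩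
  · exact Finset.mem_union_left _ (Finset.mem_union_left _ (Finset.mem_singleton_self _))
  · exact Finset.mem_union_left _ (Finset.mem_union_right _ (h₃ i (Finset.mem_singleton_self _)))
  · exact (h₁ (a, j, k, b)).trans (Finset.subset_union_left.trans Finset.subset_union_right)
  · exact (h₂ j).trans (Finset.subset_union_right.trans Finset.subset_union_right)

theorem eval_eq_pv {A : Finset ({i : Fin d // i ≠ 0} →₀ ℕ)}
    {p : MvPolynomial {i : Fin d // i ≠ 0} ℝ} (hp : p.support ⊆ A) (s : HVec d) :
    MvPolynomial.eval s p = pv A (fun m => p.coeff m) s := by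
  rw [MvPolynomial.eval_eq', pv]
  refine Finset.sum_subset hp fun m _ hm => ?_
  rw [MvPolynomial.notMem_support_iff.1 hm, zero_mul]

theorem pv_sum_mul {α : Type*} (t : Finset α) (A : Finset ({i : Fin d // i ≠ 0} →₀ ℕ)) (c : α → ℝ)
    (f : α → ({i : Fin d // i ≠ 0} →₀ ℕ) → ℝ) (s : HVec d) :
    pv A (fun m => ∑ j ∈ t, c j * f j m) s = ∑ j ∈ t, c j * pv A (f j) s := by
  simp only [pv, Finset.sum_mul, Finset.mul_sum]
  rw [Finset.sum_comm]
  exact Finset.sum_congr rfl fun _ _ => Finset.sum_congr rfl fun _ _ => by ring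

theorem pv_conjCoeff {A : Finset ({i : Fin d // i ≠ 0} →₀ ℕ)} (hA : IsExpSupport A)
    (K : Matrix (LIdx d) (LIdx d) ℝ) (a b : LIdx d) (s : HVec d) :
    pv A (conjCoeff K a b) s = (horoMat (-s) * K * horoMat s) a b := by
  have h1 : ∀ j k, pv A (fun m => (horoPoly d (-1) a j * horoPoly d 1 k b).coeff m) s =
      horoMat (-s) a j * horoMat s k b := fun j k => by
    rw [← eval_eq_pv (hA.mul_subset a j k b), map_mul, eval_horoPoly, eval_horoPoly, one_smul,
      neg_one_smul]
  have h2 : conjCoeff K a b = fun m => ∑ q : LIdx d × LIdx d, K q.1 q.2 *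
      (horoPoly d (-1) a q.1 * horoPoly d 1 q.2 b).coeff m := by
    ext m
    rw [conjCoeff, Fintype.sum_prod_type]
  rw [h2, pv_sum_mul, Fintype.sum_prod_type]
  simp only [h1, Matrix.mul_apply, Finset.sum_mul]
  rw [Finset.sum_comm]
  exact Finset.sum_congr rfl fun _ _ => Finset.sum_congr rfl fun _ _ => by ring

theorem pv_vecCoeff {A : Finset ({i : Fin d // i ≠ 0} →₀ ℕ)} (hA : IsExpSupport A)
    (x : LIdx d → ℝ) (s : HVec d) : pv A (vecCoeff x) s = (horoMat (-s) *ᵥ x) 𝔭 := by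
  have h1 : ∀ j, pv A (fun m => (horoPoly d (-1) 𝔭 j).coeff m) s = horoMat (-s) 𝔭 j := fun j => by
    rw [← eval_eq_pv (hA.subset j), eval_horoPoly, neg_one_smul]
  unfold vecCoeff
  rw [pv_sum_mul]
  simp only [h1, Matrix.mulVec, dotProduct]
  exact Finset.sum_congr rfl fun _ _ => mul_comm _ _

theorem vecCoeff_single (x : LIdx d → ℝ) (i : {i : Fin d // i ≠ 0}) :
    vecCoeff x (Finsupp.single i 1) = -x (𝔴 i) := by
  classical
  have h0 : (Finsupp.single i 1 : {i : Fin d // i ≠ 0} →₀ ℕ) ≠ 0 := by simp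
  have h2 : ∀ j, (Finsupp.single j 2 : {i : Fin d // i ≠ 0} →₀ ℕ) ≠ Finsupp.single i 1 := by
    intro j h
    have := congrArg (fun f => f i) h
    simp only [Finsupp.single_apply] at this
    split_ifs at this; all_goals simp at this
  simp only [vecCoeff, Fintype.sum_sum_type, Finset.univ_unique, Finset.sum_singleton,
    PUnit.default_eq_unit, horoPoly, Matrix.of_apply, Sum.elim_inl, Sum.elim_inr]
  rw [MvPolynomial.coeff_one, if_neg h0.symm]
  simp only [MvPolynomial.coeff_C_mul, MvPolynomial.coeff_sum, MvPolynomial.coeff_X_pow,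
    MvPolynomial.coeff_X, h2, Finsupp.single_left_inj one_ne_zero]
  simp

theorem tendsto_conjCoeff {K : ℕ → Matrix (LIdx d) (LIdx d) ℝ}
    (hK : ∀ a b, Tendsto (fun n => K n a b) atTop (𝓝 0)) (a b : LIdx d)
    (m : {i : Fin d // i ≠ 0} →₀ ℕ) : Tendsto (fun n => conjCoeff (K n) a b m) atTop (𝓝 0) := by
  have : Tendsto (fun n => conjCoeff (K n) a b m) atTop (𝓝 (∑ j : LIdx d, ∑ k : LIdx d, 0 *
      (horoPoly d (-1) a j * horoPoly d 1 k b).coeff m)) :=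
    tendsto_finsetSum _ fun j _ => tendsto_finsetSum _ fun k _ => (hK j k).mul_const _
  simpa using this

theorem tendsto_vecCoeff {x : ℕ → LIdx d → ℝ} (hx : ∀ a, Tendsto (fun n => x n a) atTop (𝓝 0))
    (m : {i : Fin d // i ≠ 0} →₀ ℕ) : Tendsto (fun n => vecCoeff (x n) m) atTop (𝓝 0) := by
  have : Tendsto (fun n => vecCoeff (x n) m) atTop (𝓝 (∑ j : LIdx d, 0 *
      (horoPoly d (-1) 𝔭 j).coeff m)) :=
    tendsto_finsetSum _ fun j _ => (hx j).mul_const _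
  simpa using this

theorem sum_pos_of_ne_zero {m : {i : Fin d // i ≠ 0} →₀ ℕ} (hm : m ≠ 0) : 0 < ∑ i, m i := by
  refine Nat.pos_of_ne_zero fun h => hm (Finsupp.ext fun i => ?_)
  exact (Finset.sum_eq_zero_iff.1 h) i (Finset.mem_univ i)

/-- Rescaling polynomials with small coefficients so that the non-constant part has size `ε`. -/
theorem exists_scale {J : Type*} [Fintype J] (A : Finset ({i : Fin d // i ≠ 0} →₀ ℕ))
    {f : ℕ → J → ({i : Fin d // i ≠ 0} →₀ ℕ) → ℝ}
    (hf : ∀ j m, Tendsto (fun n => f n j m) atTop (𝓝 0))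
    (hne : ∀ n, ∃ j, ∃ m ∈ A, m ≠ 0 ∧ f n j m ≠ 0) {ε : ℝ} (hε : 0 < ε) :
    ∃ R : ℕ → ℝ, (∀ n, 0 < R n) ∧ Tendsto R atTop atTop ∧
      (∀ n j, ∀ m ∈ A, m ≠ 0 → R n ^ (∑ i, m i) * |f n j m| ≤ ε) ∧
      ∀ n, ∃ j, ∃ m ∈ A, m ≠ 0 ∧ R n ^ (∑ i, m i) * |f n j m| = ε := by
  classical
  have hR : ∀ n, ∃ R : ℝ, 0 < R ∧ (∀ j, ∀ m ∈ A, m ≠ 0 → R ^ (∑ i, m i) * |f n j m| ≤ ε) ∧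
      ∃ j, ∃ m ∈ A, m ≠ 0 ∧ R ^ (∑ i, m i) * |f n j m| = ε := by
    intro n
    let T : Finset (J × ({i : Fin d // i ≠ 0} →₀ ℕ)) :=
      (Finset.univ ×ˢ A).filter fun q => q.2 ≠ 0 ∧ f n q.1 q.2 ≠ 0
    have hT : T.Nonempty := by
      obtain ⟨j, m, hm, h0, h1⟩ := hne n
      exact ⟨(j, m), by simp [T, hm, h0, h1]⟩
    -- `r q` is the scale at which the monomial `q` alone reaches size `ε`. The least such scale
    -- makes one monomial equal to `ε` and keeps all the others below it.
    let r : J × ({i : Fin d // i ≠ 0} →₀ ℕ) → ℝ := fun q =>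
      (ε / |f n q.1 q.2|) ^ (((∑ i, q.2 i : ℕ) : ℝ)⁻¹)
    have hr0 : ∀ q ∈ T, 0 < r q ∧ r q ^ (∑ i, q.2 i) = ε / |f n q.1 q.2| := fun q hq => by
      simp only [T, Finset.mem_filter] at hq
      have h1 : 0 < ε / |f n q.1 q.2| := div_pos hε (abs_pos.2 hq.2.2)
      exact ⟨Real.rpow_pos_of_pos h1 _,
        Real.rpow_inv_natCast_pow h1.le (sum_pos_of_ne_zero hq.2.1).ne'⟩
    obtain ⟨q, hq, hmin⟩ := T.exists_min_image r hT
    refine ⟨r q, (hr0 q hq).1, fun j m hm h0 => ?_, q.1, q.2, ?_⟩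
    · by_cases h1 : f n j m = 0
      · rw [h1, abs_zero, mul_zero]; exact hε.le
      · have hmem : (j, m) ∈ T := by simp [T, hm, h0, h1]
        calc r q ^ (∑ i, m i) * |f n j m| ≤ r (j, m) ^ (∑ i, m i) * |f n j m| := by
              have := (hr0 q hq).1.le
              gcongr
              exact hmin _ hmem
          _ = ε := by
              rw [(hr0 _ hmem).2, div_mul_cancel₀ _ (abs_ne_zero.2 h1)]
    · have hq' := hq
      simp only [T, Finset.mem_filter, Finset.mem_product, Finset.mem_univ, true_and] at hq'
      exact ⟨hq'.1, hq'.2.1, by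
        rw [(hr0 q hq).2, div_mul_cancel₀ _ (abs_ne_zero.2 hq'.2.2)]⟩
  choose R h1 h2 h3 using hR
  refine ⟨R, h1, ?_, h2, h3⟩
  rw [tendsto_atTop]
  intro K₀
  set K := max K₀ 1
  have hK1 : 1 ≤ K := le_max_right _ _
  set D := ∑ m ∈ A, ∑ i, m i
  -- Since the coefficients tend to `0`, at any bounded scale every nonconstant monomial is
  -- eventually below `ε`; the scale attaining equality must therefore tend to infinity.
  have hsmall : ∀ᶠ n in atTop, ∀ j, ∀ m ∈ A, |f n j m| < ε / K ^ D := by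
    rw [eventually_all]
    intro j
    rw [Finset.eventually_all]
    intro m _
    have := (hf j m).abs
    rw [abs_zero] at this
    exact this.eventually_lt_const (by positivity)
  filter_upwards [hsmall] with n hn
  refine (le_max_left K₀ 1).trans ?_
  by_contra! hlt
  obtain ⟨j, m, hm, h0, heq⟩ := h3 n
  have h5 : R n ^ (∑ i, m i) ≤ K ^ D := by
    calc R n ^ (∑ i, m i) ≤ K ^ (∑ i, m i) := by
          gcongr
          exact (h1 n).le
      _ ≤ K ^ D := pow_le_pow_right₀ hK1 (Finset.single_le_sum
          (f := fun m : ({i : Fin d // i ≠ 0} →₀ ℕ) => ∑ i, m i) (fun _ _ => Nat.zero_le _) hm)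
  have h6 : R n ^ (∑ i, m i) * |f n j m| < ε := by
    have hKD : 0 < K ^ D := by positivity
    calc R n ^ (∑ i, m i) * |f n j m| ≤ K ^ D * |f n j m| := by gcongr
      _ < K ^ D * (ε / K ^ D) := by gcongr; exact hn j m hm
      _ = ε := by field_simp
  exact absurd heq h6.ne

theorem abs_pv_le {A : Finset ({i : Fin d // i ≠ 0} →₀ ℕ)}
    {a : ({i : Fin d // i ≠ 0} →₀ ℕ) → ℝ} {R R₀ ε : ℝ} (hR₀ : 0 < R₀)
    (ha : ∀ m ∈ A, m ≠ 0 → R ^ (∑ i, m i) * |a m| ≤ ε) (ha0 : |a 0| ≤ ε) {s : HVec d}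
    (hs : ‖s‖ ≤ R₀ * R) : |pv A a s| ≤ (∑ m ∈ A, R₀ ^ (∑ i, m i)) * ε := by
  rw [pv, Finset.sum_mul]
  refine (Finset.abs_sum_le_sum_abs _ _).trans (Finset.sum_le_sum fun m hm => ?_)
  have h1 : |∏ i, s i ^ m i| ≤ R₀ ^ (∑ i, m i) * R ^ (∑ i, m i) := by
    rw [← mul_pow, ← Finset.prod_pow_eq_pow_sum, Finset.abs_prod]
    refine Finset.prod_le_prod (fun _ _ => abs_nonneg _) fun i _ => ?_
    rw [abs_pow]
    gcongr
    exact (norm_le_pi_norm s i).trans hs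
  rw [abs_mul]
  by_cases h0 : m = 0
  · subst h0
    simpa using ha0
  · calc |a m| * |∏ i, s i ^ m i| ≤ |a m| * (R₀ ^ (∑ i, m i) * R ^ (∑ i, m i)) := by gcongr
      _ = R₀ ^ (∑ i, m i) * (R ^ (∑ i, m i) * |a m|) := by ring
      _ ≤ R₀ ^ (∑ i, m i) * ε := by gcongr; exact ha m hm h0

/-! ### Projection to the Levi subgroup -/

theorem lightBil_inv (g : SO0 d) (x y : LIdx d → ℝ) :
    lightBil (lm g⁻¹ *ᵥ x) y = lightBil x (lm g *ᵥ y) := by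
  rw [← lightBil_lm g, Matrix.mulVec_mulVec, lm_mul_inv, Matrix.one_mulVec]

theorem lm_inv_minus_minus (g : SO0 d) : lm g⁻¹ 𝔪 𝔪 = lm g 𝔭 𝔭 := by
  have := lightBil_inv g (Pi.single 𝔪 1) (Pi.single 𝔭 1)
  simpa [lightBil] using this

theorem lm_inv_mid_minus (g : SO0 d) (i : {i : Fin d // i ≠ 0}) :
    lm g⁻¹ (𝔴 i) 𝔪 = -lm g 𝔭 (𝔴 i) := by
  have := lightBil_inv g (Pi.single 𝔪 1) (Pi.single (𝔴 i) 1)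
  simpa [lightBil, Pi.single_apply] using this

/-- The inverse of `b` is its adjoint, so the first row of `b` determines the last column of `b⁻¹`.
If the middle of that row vanishes, nullity shows that `b⁻¹`, hence `b`, preserves the line of `f₋`.
-/
theorem lm_col_minus {b : SO0 d} (h : ∀ i, lm b 𝔭 (𝔴 i) = 0) (h0 : lm b 𝔭 𝔭 ≠ 0) :
    lm b 𝔭 𝔪 = 0 ∧ (∀ i, lm b (𝔴 i) 𝔪 = 0) ∧ lm b 𝔭 𝔭 * lm b 𝔪 𝔪 = 1 := by
  have hcol : lm b⁻¹ *ᵥ Pi.single 𝔪 1 = lm b 𝔭 𝔭 • Pi.single 𝔪 1 := by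
    rw [Matrix.mulVec_single_one]
    refine funext (lidx_cases ?_ (fun i => ?_) ?_)
    · have hn := lm_null b⁻¹ (Or.inr rfl : (𝔪 : LIdx d) = 𝔭 ∨ (𝔪 : LIdx d) = 𝔪)
      simpa [lm_inv_mid_minus, h, lm_inv_minus_minus, h0] using hn.symm
    · simp [lm_inv_mid_minus, h]
    · simp [lm_inv_minus_minus]
  have h1 : (Pi.single 𝔪 1 : LIdx d → ℝ) = lm b 𝔭 𝔭 • (lm b).col 𝔪 := by
    rw [← Matrix.mulVec_single_one, ← Matrix.mulVec_smul, ← hcol, Matrix.mulVec_mulVec, lm_mul_inv,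
      Matrix.one_mulVec]
  refine ⟨?_, fun i => ?_, ?_⟩
  · have := congrFun h1 𝔭
    simpa [h0] using this.symm
  · have := congrFun h1 (𝔴 i)
    simpa [h0] using this.symm
  · have := congrFun h1 𝔪
    simpa using this.symm

theorem abs_sum_mul_le {ι : Type*} [Fintype ι] {u v : ι → ℝ} {a b : ℝ} (ha : 0 ≤ a)
    (hu : ∀ i, |u i| ≤ a) (hv : ∀ i, |v i| ≤ b) :
    |∑ i, u i * v i| ≤ Fintype.card ι * (a * b) := by
  refine (Finset.abs_sum_le_sum_abs _ _).trans ?_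
  rw [← nsmul_eq_mul]
  refine Finset.sum_le_card_nsmul _ _ _ fun i _ => ?_
  rw [abs_mul]
  exact mul_le_mul (hu i) (hv i) (abs_nonneg _) ha

theorem lm_horo_mul_plus (s : HVec d) (g : SO0 d) (b : LIdx d) : lm (horo (-s) * g) 𝔭 b =
    lm g 𝔭 b - ∑ i, s i * lm g (𝔴 i) b + (s ⬝ᵥ s) / 2 * lm g 𝔪 b := by
  rw [lm_mul, lm_horo]
  have := horoMat_mulVec_plus (-s) fun a => lm g a b
  simp only [Pi.neg_apply, neg_mul, Finset.sum_neg_distrib, neg_dotProduct_neg] at this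
  rw [sub_eq_add_neg]
  exact this

theorem lm_horo_mul_mid (s : HVec d) (g : SO0 d) (i : {i : Fin d // i ≠ 0}) (b : LIdx d) :
    lm (horo (-s) * g) (𝔴 i) b = lm g (𝔴 i) b - s i * lm g 𝔪 b := by
  rw [lm_mul, lm_horo]
  have := horoMat_mulVec_mid (-s) (fun a => lm g a b) i
  rw [Pi.neg_apply, neg_mul, ← sub_eq_add_neg] at this
  exact this

theorem lm_horo_mul_minus (s : HVec d) (g : SO0 d) (b : LIdx d) :
    lm (horo (-s) * g) 𝔪 b = lm g 𝔪 b := by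
  rw [lm_mul, lm_horo]
  exact horoMat_mulVec_minus (-s) fun a => lm g a b

theorem lm_mul_horo_plus (g : SO0 d) (σ : HVec d) (a : LIdx d) :
    lm (g * horo σ) a 𝔭 = lm g a 𝔭 := by
  rw [lm_mul, lm_horo]
  simp [Matrix.mul_apply, Fintype.sum_sum_type, horoMat]

theorem lm_mul_horo_mid (g : SO0 d) (σ : HVec d) (a : LIdx d) (i : {i : Fin d // i ≠ 0}) :
    lm (g * horo σ) a (𝔴 i) = lm g a (𝔴 i) + σ i * lm g a 𝔭 := by
  rw [lm_mul, lm_horo]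
  simp [Matrix.mul_apply, Fintype.sum_sum_type, horoMat]
  ring

set_option maxHeartbeats 2000000 in
/-- Sheared elements can be corrected by the horospherical group so that they stay bounded. -/
theorem exists_levi_bound (d : ℕ) [NeZero d] {R₀ : ℝ} (hR₀ : 0 < R₀) :
    ∃ C > 0, ∀ (g : SO0 d) (s : HVec d) (R ε : ℝ), 1 ≤ R → 0 < ε → ε ≤ 1 / 2 → ‖s‖ ≤ R₀ * R →
      (∀ a b, |lm g a b - lm 1 a b| ≤ ε) → (∀ i, R * |lm g (𝔴 i) 𝔭| ≤ ε) →
      |lm (horo (-s) * g) 𝔭 𝔭 - 1| ≤ 1 / 2 →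
      ∃ σ : HVec d, lm (horo (-s) * g * horo σ) 𝔭 𝔭 = lm (horo (-s) * g) 𝔭 𝔭 ∧
        (∀ i, lm (horo (-s) * g * horo σ) 𝔭 (𝔴 i) = 0) ∧
        (∀ i, |lm (horo (-s) * g * horo σ) (𝔴 i) 𝔭| ≤ C / R) ∧
        ∀ a b, |lm (horo (-s) * g * horo σ) a b - lm 1 a b|
          ≤ C * (ε + |lm (horo (-s) * g) 𝔭 𝔭 - 1|) := by
  set D : ℝ := ((Fintype.card {i : Fin d // i ≠ 0} : ℕ) : ℝ) with hD
  have hD0 : 0 ≤ D := Nat.cast_nonneg _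
  -- `C₂ * R` bounds the first row of `horo (-s) * g` off the corner; `C` is the sum of the
  -- constants needed for the blocks of the corrected matrix.
  set C₂ : ℝ := 2 + 2 * D * R₀ + 4 * D ^ 2 * R₀ ^ 2 with hC₂
  have hC₂0 : 0 < C₂ := by positivity
  set C : ℝ := 2 + D + D * R₀ + 8 * D * R₀ + 2 * C₂ * (1 + R₀ * D) + 8 * D + 2 * C₂ * D with hC
  have hC0 : 0 < C := by positivity
  refine ⟨C, hC0, fun g s R ε hR hε hε2 hs hg hx hα => ?_⟩
  have hR0 : 0 < R := by linarith
  set e : ℝ := ε / R with he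
  have he0 : 0 < e := by positivity
  have heε : e ≤ ε := div_le_self hε.le hR
  have hRe : R * e = ε := by rw [he]; field_simp
  have hx' : ∀ i, |lm g (𝔴 i) 𝔭| ≤ e := fun i => by
    rw [he, le_div_iff₀ hR0, mul_comm]; exact hx i
  have hsi : ∀ i, |s i| ≤ R₀ * R := fun i => (norm_le_pi_norm s i).trans hs
  have hR0R : 0 ≤ R₀ * R := by positivity
  have hone : ∀ a b, |lm (1 : SO0 d) a b| ≤ 1 := fun a b => by
    rw [lm_one, Matrix.one_apply]; split_ifs <;> simp
  have hg2 : ∀ a b, |lm g a b| ≤ 2 := fun a b => by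
    have h1 := hg a b
    have h2 := hone a b
    have h3 := abs_add_le (lm g a b - lm 1 a b) (lm 1 a b)
    rw [sub_add_cancel] at h3
    linarith
  have hα0 : 1 / 2 ≤ lm g 𝔭 𝔭 := by
    have h1 := (abs_le.1 (hg 𝔭 𝔭)).1
    rw [lm_one, Matrix.one_apply_eq] at h1
    linarith
  set α := lm (horo (-s) * g) 𝔭 𝔭 with hαdef
  have hα2 : 1 / 2 ≤ α := by linarith [(abs_le.1 hα).1]
  set β := lm g 𝔪 𝔭 with hβ
  have hβ0 : 0 ≤ β := (lm_future g).1
  -- The first column is null, so its `𝔪`-entry is quadratic in its middle entries. This gain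
  -- absorbs the factors of order `R` coming from `s` and from `σ`.
  have hβe : β ≤ D * e ^ 2 := by
    have hn := lm_null g (Or.inl rfl : (𝔭 : LIdx d) = 𝔭 ∨ (𝔭 : LIdx d) = 𝔪)
    have h1 := abs_sum_mul_le he0.le hx' hx'
    simp only [← sq] at h1
    rw [hn] at h1
    have h2 := (le_abs_self _).trans h1
    have h3 : β ≤ 2 * lm g 𝔭 𝔭 * lm g 𝔪 𝔭 := by nlinarith
    exact h3.trans h2
  have hβe1 : β ≤ D * e := by
    refine hβe.trans ?_
    gcongr
    nlinarith
  have hμ : ∀ i, |lm g 𝔪 (𝔴 i)| ≤ 8 * D * e := fun i => by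
    have h1 := lm_mid_plus g i
    have h2 := abs_sum_mul_le (u := fun j => lm g (𝔴 j) (𝔴 i)) (v := fun j => lm g (𝔴 j) 𝔭)
      (by norm_num : (0 : ℝ) ≤ 2) (fun j => hg2 _ _) hx'
    have h3 : |lm g 𝔭 (𝔴 i) * β| ≤ 2 * (D * e) := by
      rw [abs_mul, abs_of_nonneg hβ0]
      exact mul_le_mul (hg2 _ _) hβe1 hβ0 (by norm_num)
    have h4 : |lm g 𝔪 (𝔴 i) * lm g 𝔭 𝔭| ≤ D * (2 * e) + 2 * (D * e) := by
      have e1 : lm g 𝔪 (𝔴 i) * lm g 𝔭 𝔭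
          = ∑ j, lm g (𝔴 j) (𝔴 i) * lm g (𝔴 j) 𝔭 - lm g 𝔭 (𝔴 i) * β := by linarith
      rw [e1]
      exact (abs_sub _ _).trans (add_le_add h2 h3)
    rw [abs_mul, abs_of_nonneg (by linarith : (0 : ℝ) ≤ lm g 𝔭 𝔭)] at h4
    nlinarith [abs_nonneg (lm g 𝔪 (𝔴 i))]
  have hw' : ∀ j, |lm (horo (-s) * g) (𝔴 j) 𝔭| ≤ (1 + R₀ * D) * e := fun j => by
    rw [lm_horo_mul_mid]
    refine (abs_sub _ _).trans ?_
    have h1 : |s j * lm g 𝔪 𝔭| ≤ R₀ * R * (D * e ^ 2) := by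
      rw [abs_mul, abs_of_nonneg hβ0]
      exact mul_le_mul (hsi j) hβe hβ0 hR0R
    have h2 : R₀ * R * (D * e ^ 2) = R₀ * D * e * (R * e) := by ring
    have h3 : R₀ * D * e * (R * e) ≤ R₀ * D * e := by
      rw [hRe]
      exact mul_le_of_le_one_right (by positivity) (by linarith)
    linarith [hx' j]
  have hp' : ∀ i, |lm (horo (-s) * g) 𝔭 (𝔴 i)| ≤ C₂ * R := fun i => by
    rw [lm_horo_mul_plus]
    have h1 := abs_sum_mul_le hR0R hsi fun j => hg2 (𝔴 j) (𝔴 i)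
    have h2 := abs_sum_mul_le hR0R hsi hsi
    have h3 : |(s ⬝ᵥ s) / 2 * lm g 𝔪 (𝔴 i)| ≤ D * (R₀ * R * (R₀ * R)) / 2 * (8 * D * e) := by
      rw [abs_mul, abs_div, abs_two]
      exact mul_le_mul (by gcongr; exact h2) (hμ i) (abs_nonneg _) (by positivity)
    have h4 : D * (R₀ * R * (R₀ * R)) / 2 * (8 * D * e) = 4 * D ^ 2 * R₀ ^ 2 * R * (R * e) := by
      ring
    have h5 : 4 * D ^ 2 * R₀ ^ 2 * R * (R * e) ≤ 4 * D ^ 2 * R₀ ^ 2 * R := by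
      rw [hRe]
      exact mul_le_of_le_one_right (by positivity) (by linarith)
    have h6 := abs_add_le (lm g 𝔭 (𝔴 i) - ∑ j, s j * lm g (𝔴 j) (𝔴 i))
      ((s ⬝ᵥ s) / 2 * lm g 𝔪 (𝔴 i))
    have h7 := abs_sub (lm g 𝔭 (𝔴 i)) (∑ j, s j * lm g (𝔴 j) (𝔴 i))
    have h8 := hg2 𝔭 (𝔴 i)
    rw [hC₂]
    linarith
  -- This `σ` annihilates the middle of the first row. It has size `O(R)`, but it multiplies only
  -- entries of the first column, which are `O(ε / R)`.
  let σ : HVec d := fun i => -lm (horo (-s) * g) 𝔭 (𝔴 i) / α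
  have hσ : ∀ i, |σ i| ≤ 2 * C₂ * R := fun i => by
    simp only [σ]
    rw [abs_div, abs_neg, div_le_iff₀ (abs_pos.2 (by linarith)), abs_of_pos (by linarith : 0 < α)]
    have := hp' i
    have h2 : C₂ * R ≤ 2 * C₂ * R * α := by
      have : 0 < C₂ * R := by positivity
      nlinarith
    linarith
  have hz : ∀ i, lm (horo (-s) * g * horo σ) 𝔭 (𝔴 i) = 0 := fun i => by
    rw [lm_mul_horo_mid]
    simp only [σ]
    rw [div_mul_cancel₀ _ (by linarith), add_neg_cancel]
  have hpp : lm (horo (-s) * g * horo σ) 𝔭 𝔭 = α := lm_mul_horo_plus _ _ _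
  obtain ⟨hpm, him, hmm⟩ := lm_col_minus hz (by rw [hpp]; linarith)
  rw [hpp] at hmm
  have hαa := abs_nonneg (α - 1)
  have hD8 : 0 ≤ D * R₀ := by positivity
  have hC2D : 0 ≤ C₂ * D := by positivity
  have hC2RD : 0 ≤ C₂ * (1 + R₀ * D) := by positivity
  have hCle : ∀ {c₁ : ℝ}, c₁ ≤ C → c₁ * ε ≤ C * (ε + |α - 1|) := fun {c₁} h => by
    have h1 : c₁ * ε ≤ C * ε := by gcongr
    have h2 : 0 ≤ C * |α - 1| := by positivity
    linarith
  have hCle2 : ∀ {c₁ : ℝ}, c₁ ≤ C → c₁ * |α - 1| ≤ C * (ε + |α - 1|) := fun {c₁} h => by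
    have h1 : c₁ * |α - 1| ≤ C * |α - 1| := by gcongr
    have h2 : 0 ≤ C * ε := by positivity
    linarith
  have hmid : ∀ j, |lm (horo (-s) * g * horo σ) (𝔴 j) 𝔭| ≤ (1 + R₀ * D) * e := fun j => by
    rw [lm_mul_horo_plus]; exact hw' j
  refine ⟨σ, hpp, hz, fun i => ?_, ?_⟩
  · refine (hmid i).trans ?_
    rw [he, ← mul_div_assoc]
    gcongr
    nlinarith
  refine lidx_cases (lidx_cases ?_ (fun j => ?_) ?_) (fun i => lidx_cases ?_ (fun j => ?_) ?_)
    (lidx_cases ?_ (fun j => ?_) ?_)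
  · rw [hpp, lm_one, Matrix.one_apply_eq]
    linarith [hCle2 (c₁ := 1) (by linarith)]
  · rw [hz, lm_one, Matrix.one_apply_ne (by simp), sub_zero, abs_zero]
    positivity
  · rw [hpm, lm_one, Matrix.one_apply_ne (by simp), sub_zero, abs_zero]
    positivity
  · rw [lm_one, Matrix.one_apply_ne (by simp), sub_zero]
    refine (hmid i).trans (le_trans ?_ (hCle (c₁ := 1 + R₀ * D) (by linarith)))
    gcongr
  · have h1 : |s i * lm g 𝔪 (𝔴 j)| ≤ 8 * D * R₀ * ε := by
      rw [abs_mul]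
      calc |s i| * |lm g 𝔪 (𝔴 j)| ≤ (R₀ * R) * (8 * D * e) :=
            mul_le_mul (hsi i) (hμ j) (abs_nonneg _) hR0R
        _ = 8 * D * R₀ * (R * e) := by ring
        _ = _ := by rw [hRe]
    have h2 : |σ j * lm (horo (-s) * g) (𝔴 i) 𝔭| ≤ 2 * C₂ * (1 + R₀ * D) * ε := by
      rw [abs_mul]
      calc |σ j| * |lm (horo (-s) * g) (𝔴 i) 𝔭| ≤ (2 * C₂ * R) * ((1 + R₀ * D) * e) :=
            mul_le_mul (hσ j) (hw' i) (abs_nonneg _) (by positivity)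
        _ = 2 * C₂ * (1 + R₀ * D) * (R * e) := by ring
        _ = _ := by rw [hRe]
    rw [lm_mul_horo_mid, lm_horo_mul_mid]
    have h3 := hg (𝔴 i) (𝔴 j)
    have h4 := hCle (c₁ := 1 + 8 * D * R₀ + 2 * C₂ * (1 + R₀ * D)) (by linarith)
    rw [abs_le] at h1 h2 h3 ⊢
    constructor <;> linarith
  · rw [him, lm_one, Matrix.one_apply_ne (by simp), sub_zero, abs_zero]
    positivity
  · rw [lm_mul_horo_plus, lm_horo_mul_minus, lm_one, Matrix.one_apply_ne (by simp), sub_zero,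
      abs_of_nonneg hβ0]
    refine (hβe1.trans ?_).trans (hCle (c₁ := D) (by linarith))
    gcongr
  · rw [lm_mul_horo_mid, lm_horo_mul_minus, lm_horo_mul_minus, lm_one,
      Matrix.one_apply_ne (by simp), sub_zero]
    have h1 : |σ j * lm g 𝔪 𝔭| ≤ 2 * C₂ * D * ε := by
      rw [abs_mul, abs_of_nonneg hβ0]
      calc |σ j| * β ≤ (2 * C₂ * R) * (D * e ^ 2) :=
            mul_le_mul (hσ j) hβe hβ0 (by positivity)
        _ = 2 * C₂ * D * e * (R * e) := by ring
        _ ≤ 2 * C₂ * D * ε * 1 := by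
            rw [hRe]
            gcongr
            linarith
        _ = _ := mul_one _
    have h2 : |lm g 𝔪 (𝔴 j)| ≤ 8 * D * ε := (hμ j).trans (by gcongr)
    refine (abs_add_le _ _).trans ?_
    have h4 := hCle (c₁ := 8 * D + 2 * C₂ * D) (by linarith)
    linarith
  · rw [lm_one, Matrix.one_apply_eq]
    have h1 : lm (horo (-s) * g * horo σ) 𝔪 𝔪 - 1 = -(α - 1) / α := by
      field_simp
      linarith
    rw [h1, abs_div, abs_neg, div_le_iff₀ (abs_pos.2 (by linarith)),
      abs_of_pos (by linarith : 0 < α)]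
    have h2 := hCle2 (c₁ := 2) (by linarith)
    have h3 : 0 ≤ C * (ε + |α - 1|) := by positivity
    nlinarith

/-! ### Polynomial divergence of horospherical orbits -/

/-- The centralizer of the geodesic flow. -/
def IsLevi (g : SO0 d) : Prop := ∀ a b, wt a ≠ wt b → lm g a b = 0

theorem IsLevi.boost_conj {h : SO0 d} (hh : IsLevi h) (t : ℝ) :
    boost d (-t) * h * boost d t = h := by
  apply lm_injective
  ext a b
  rw [lm_boost_conj]
  by_cases hab : wt a = wt b
  · simp [hab]
  · rw [hh a b hab, mul_zero]

theorem IsLevi.conj_mem {h u : SO0 d} (hh : IsLevi h) (hu : u ∈ horospherical d) :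
    h⁻¹ * u * h ∈ horospherical d := by
  have h1 : Tendsto (fun t : ℝ => h⁻¹ * (boost d (-t) * u * boost d t) * h) atTop
      (𝓝 (h⁻¹ * 1 * h)) := (Tendsto.const_mul h⁻¹ hu).mul_const h
  rw [mul_one, inv_mul_cancel] at h1
  refine h1.congr fun t => ?_
  have h2 : boost d (-t) * h⁻¹ * boost d t = h⁻¹ := by
    have := congrArg (fun x => x⁻¹) (hh.boost_conj t)
    simpa [boost_neg, mul_assoc] using this
  calc h⁻¹ * (boost d (-t) * u * boost d t) * h
      = (boost d (-t) * h⁻¹ * boost d t) * (boost d (-t) * u * boost d t) *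
        (boost d (-t) * h * boost d t) := by rw [h2, hh.boost_conj]
    _ = boost d (-t) * (h⁻¹ * u * h) * boost d t := by
        rw [boost_neg]; group

/-- The two vanishing conditions make the lines of `f₋` and `f₊` invariant; an element fixing both
endpoints of the flow axis is block diagonal. -/
theorem isLevi_of_entries {h : SO0 d} (h1 : ∀ i, lm h 𝔭 (𝔴 i) = 0) (h2 : ∀ i, lm h (𝔴 i) 𝔭 = 0)
    (h0 : lm h 𝔭 𝔭 ≠ 0) : IsLevi h := by
  obtain ⟨e1, e2, -⟩ := lm_col_minus h1 h0
  have hpar := isPar_of_mid h2 h0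
  intro a b hab
  rcases lt_or_gt_of_ne hab with hlt | hlt
  · exact hpar.lm_eq_zero hlt
  · rcases a with ⟨⟨⟩⟩ | i | ⟨⟨⟩⟩ <;> rcases b with ⟨⟨⟩⟩ | j | ⟨⟨⟩⟩ <;>
      first
        | exact h1 _
        | exact e1
        | exact e2 _
        | (exfalso; norm_num [wt] at hlt)

/-- A closed set invariant under the diagonal horospherical group contains the translate of a
relatively minimal set by `(h, horo t * h)` as soon as it contains one translated point. -/
theorem forall_act_mem_of_mem {Γ₁ Γ₂ : Subgroup (SO0 d)}
    {X Y X' : Set (HomSpace Γ₁ × HomSpace Γ₂)} (hY : IsRelMinimal X Y) (hX'c : IsClosed X')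
    (hX' : IsInvariantUnder (diagU d) X') {h : SO0 d} (hh : IsLevi h) {t : HVec d}
    {y : HomSpace Γ₁ × HomSpace Γ₂} (hy : y ∈ Y ∩ Omega Γ₁ Γ₂)
    (hmem : act y (h, horo t * h) ∈ X') : ∀ y' ∈ Y, act y' (h, horo t * h) ∈ X' := by
  have hclosed : IsClosed {y' : HomSpace Γ₁ × HomSpace Γ₂ | act y' (h, horo t * h) ∈ X'} :=
    hX'c.preimage (continuous_act _)
  have hsub : orbitOf y (diagU d) ⊆ {y' | act y' (h, horo t * h) ∈ X'} := by
    rintro _ ⟨u, hu, rfl⟩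
    obtain ⟨s, rfl⟩ := mem_diagU_iff.1 hu
    -- Since `𝒰` is abelian and normalized by `h`, the pair `(h, horo t * h)` normalizes `U`. The
    -- `U`-orbit of the translated point is therefore the translate of the orbit of `y`, and that
    -- orbit is dense in `Y`.
    obtain ⟨s', hs'⟩ := mem_horospherical_iff.1 (hh.conj_mem (horo_mem s))
    have h1 := hX' _ hmem _ (diag_horo_mem s')
    rw [act_act, ← hs'] at h1
    rw [Set.mem_ofPred_eq, act_act]
    convert h1 using 2
    refine Prod.ext ?_ ?_
    · simp only [Prod.fst_mul]; group
    · simp only [Prod.snd_mul]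
      rw [← mul_assoc, horo_mul_comm]; group
  exact fun y' hy' => hclosed.closure_subset_iff.2 hsub (hY.dense y hy hy')

/-- The polynomials that control the divergence of a pair of horospherical orbits. -/
def expCoeff (K : Matrix (LIdx d) (LIdx d) ℝ) (x : LIdx d → ℝ) :
    Option (LIdx d × LIdx d) → ({i : Fin d // i ≠ 0} →₀ ℕ) → ℝ
  | none => vecCoeff x
  | some q => conjCoeff K q.1 q.2

/-- The deviation of the first column from that of the identity. -/
def colDev (g : SO0 d) : LIdx d → ℝ := fun a => lm g a 𝔭 - lm 1 a 𝔭

theorem pv_conj_sub {A : Finset ({i : Fin d // i ≠ 0} →₀ ℕ)} (hA : IsExpSupport A)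
    (k : SO0 d) (a b : LIdx d) (s : HVec d) :
    pv A (conjCoeff (lm k - 1) a b) s = lm (horo (-s) * k * horo s) a b - lm 1 a b := by
  rw [pv_conjCoeff hA, mul_sub, sub_mul, mul_one, ← horoMat_add, neg_add_cancel, horoMat_zero,
    lm_mul, lm_mul, lm_horo, lm_horo, lm_one, Matrix.sub_apply]

theorem pv_vec_sub {A : Finset ({i : Fin d // i ≠ 0} →₀ ℕ)} (hA : IsExpSupport A)
    (g : SO0 d) (s : HVec d) :
    pv A (vecCoeff (colDev g)) s = lm (horo (-s) * g) 𝔭 𝔭 - 1 := by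
  rw [pv_vecCoeff hA, lm_horo_mul_plus, horoMat_mulVec_plus]
  simp only [colDev, lm_one, Matrix.one_apply_eq, Matrix.one_apply_ne (Sum.inr_ne_inl), sub_zero,
    Pi.neg_apply, neg_mul, Finset.sum_neg_distrib, neg_dotProduct_neg]
  ring

theorem pv_eq_of_coeff {A : Finset ({i : Fin d // i ≠ 0} →₀ ℕ)}
    {a : ({i : Fin d // i ≠ 0} →₀ ℕ) → ℝ} (h : ∀ m ∈ A, m ≠ 0 → a m = 0) (s t : HVec d) :
    pv A a s = pv A a t := by
  refine Finset.sum_congr rfl fun m hm => ?_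
  by_cases h0 : m = 0
  · simp [h0]
  · rw [h m hm h0, zero_mul, zero_mul]

/-- If all nonconstant coefficients vanish, there is no drift: the linear coefficients of the first
polynomial say that `g` is parabolic, and constancy of the conjugates of `k` says that `k` commutes
with `𝒰`. -/
theorem exists_expCoeff_ne_zero [Nonempty {i : Fin d // i ≠ 0}]
    {A : Finset ({i : Fin d // i ≠ 0} →₀ ℕ)} (hA : IsExpSupport A) {g k : SO0 d}
    (h0 : lm g 𝔭 𝔭 ≠ 0) (h : ¬ (IsPar g ∧ ∃ t : HVec d, k = horo t)) :
    ∃ j, ∃ m ∈ A, m ≠ 0 ∧ expCoeff (lm k - 1) (colDev g) j m ≠ 0 := by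
  by_contra! hcon
  refine h ⟨isPar_of_mid (fun i => ?_) h0, eq_horo_of_commute fun t => ?_⟩
  · have h1 := hcon none _ (hA.single_mem i) (by simp)
    simp only [expCoeff, vecCoeff_single, colDev, lm_one,
      Matrix.one_apply_ne (Sum.inr_ne_inl), sub_zero, neg_eq_zero] at h1
    exact h1
  · have h1 : horo (-t) * k * horo t = horo (-0) * k * horo (0 : HVec d) := by
      apply lm_injective
      ext a b
      have := pv_eq_of_coeff (hcon (some (a, b))) t 0
      simp only [expCoeff, pv_conj_sub hA, sub_left_inj] at this
      exact this
    rw [neg_zero, horo_zero, one_mul, mul_one, horo_neg, mul_assoc, inv_mul_eq_iff_eq_mul] at h1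
    exact h1

/-- Returns to the renormalized frame bundle at which a pair of nearby orbits has diverged to
distance comparable to `ε`. -/
theorem exists_sheared_return {Γ : Subgroup (SO0 d)} (hΓ : DiscreteTopology Γ)
    (hcc : IsConvexCocompact Γ) (hz : IsZariskiDense Γ)
    {A : Finset ({i : Fin d // i ≠ 0} →₀ ℕ)} (hA : IsExpSupport A) :
    ∃ C > 0, ∃ c > 0, ∃ ε₀ > 0, ∃ R₀ > 0, ∀ (a g k : SO0 d) (R ε : ℝ), cl Γ a ∈ RF Γ → 1 ≤ R →
      0 < ε → ε ≤ ε₀ → (∀ a b, |lm g a b - lm 1 a b| ≤ ε) →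
      (∀ j, |expCoeff (lm k - 1) (colDev g) j 0| ≤ ε) →
      (∀ j, ∀ m ∈ A, m ≠ 0 → R ^ (∑ i, m i) * |expCoeff (lm k - 1) (colDev g) j m| ≤ ε) →
      (∃ j, ∃ m ∈ A, m ≠ 0 ∧ R ^ (∑ i, m i) * |expCoeff (lm k - 1) (colDev g) j m| = ε) →
      ∃ s σ : HVec d, cl Γ (a * horo s) ∈ RF Γ ∧ ‖s‖ ≤ R₀ * R ∧
        lm (horo (-s) * g * horo σ) 𝔭 𝔭 = lm (horo (-s) * g) 𝔭 𝔭 ∧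
        (∀ i, lm (horo (-s) * g * horo σ) 𝔭 (𝔴 i) = 0) ∧
        (∀ i, |lm (horo (-s) * g * horo σ) (𝔴 i) 𝔭| ≤ C / R) ∧
        (∀ a b, |lm (horo (-s) * g * horo σ) a b - lm 1 a b| ≤ C * ε) ∧
        (∀ a b, |lm (horo (-s) * k * horo s) a b - lm 1 a b| ≤ C * ε) ∧
        c * ε ≤ |lm (horo (-s) * g * horo σ) 𝔭 𝔭 - 1| +
          ∑ a, ∑ b, |lm (horo (-s) * k * horo s) a b - lm 1 a b| := by
  obtain ⟨c, hc, R₀, hR₀, hret⟩ := exists_return hΓ hcc hz A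
  obtain ⟨C₂, hC₂, hlevi⟩ := exists_levi_bound d hR₀
  set C₁ : ℝ := ∑ m ∈ A, R₀ ^ (∑ i, m i) with hC₁
  have hC₁0 : 0 ≤ C₁ := Finset.sum_nonneg fun m _ => by positivity
  refine ⟨C₂ * (1 + C₁) + C₁, by positivity, c, hc, 1 / (2 * (C₁ + 1)), by positivity, R₀, hR₀,
    fun a g k R ε ha hR hε hε0 hg h0 hm heq => ?_⟩
  obtain ⟨j, m, hmA, hm0, hjm⟩ := heq
  -- The return time is adapted to the polynomial with a monomial of size exactly `ε`. This gives
  -- the lower bound; the upper bounds hold for every `s` of size `R₀ * R`.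
  obtain ⟨s, hs, hsR, hlow⟩ := hret a ha (expCoeff (lm k - 1) (colDev g) j) R (by linarith)
  have hup : ∀ j, |pv A (expCoeff (lm k - 1) (colDev g) j) s| ≤ C₁ * ε := fun j =>
    abs_pv_le hR₀ (hm j) (h0 j) hsR
  have hCε : (C₁ + 1) * ε ≤ 1 / 2 := by
    have : (C₁ + 1) * ε ≤ (C₁ + 1) * (1 / (2 * (C₁ + 1))) := by gcongr
    refine this.trans (le_of_eq ?_)
    field_simp
  have hα : |lm (horo (-s) * g) 𝔭 𝔭 - 1| ≤ C₁ * ε := by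
    rw [← pv_vec_sub hA]; exact hup none
  have hC₁ε : 0 ≤ C₁ * ε := by positivity
  -- The linear coefficients of the corner polynomial are `-lm g (𝔴 i) 𝔭`, so their bound at scale
  -- `R` is the smallness required of the first column. The condition `ε ≤ ε₀` keeps the corner
  -- entry within `1 / 2` of `1`.
  obtain ⟨σ, h1, h2, h3, h4⟩ := hlevi g s R ε hR hε (by linarith) hsR hg (fun i => by
    have := hm none _ (hA.single_mem i) (by simp)
    simp only [expCoeff, vecCoeff_single, colDev, lm_one,
      Matrix.one_apply_ne (Sum.inr_ne_inl), sub_zero, abs_neg] at this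
    have e1 : ∑ j, (Finsupp.single i 1 : {i : Fin d // i ≠ 0} →₀ ℕ) j = 1 := by
      simp [Finsupp.single_apply]
    rwa [e1, pow_one] at this) (by linarith)
  have hle : C₂ ≤ C₂ * (1 + C₁) + C₁ := by nlinarith
  refine ⟨s, σ, hs, hsR, h1, h2, fun i => (h3 i).trans (by gcongr), fun a b => ?_, fun a b => ?_,
    ?_⟩
  · refine (h4 a b).trans ?_
    have : C₂ * (ε + |lm (horo (-s) * g) 𝔭 𝔭 - 1|) ≤ C₂ * (ε + C₁ * ε) := by gcongr
    linarith
  · rw [← pv_conj_sub hA]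
    refine (hup (some (a, b))).trans ?_
    gcongr
    have : 0 ≤ C₂ * (1 + C₁) := by positivity
    linarith
  · have hl := hlow m hmA
    rw [hjm] at hl
    refine hl.trans ?_
    have hnn : 0 ≤ ∑ a, ∑ b, |lm (horo (-s) * k * horo s) a b - lm 1 a b| :=
      Finset.sum_nonneg fun _ _ => Finset.sum_nonneg fun _ _ => abs_nonneg _
    rcases j with _ | ⟨a, b⟩
    · rw [h1, ← pv_vec_sub hA]
      exact le_add_of_nonneg_right hnn
    · have e : |pv A (expCoeff (lm k - 1) (colDev g) (some (a, b))) s|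
          = |lm (horo (-s) * k * horo s) a b - lm 1 a b| := by
        rw [← pv_conj_sub hA]; rfl
      rw [e]
      refine le_add_of_nonneg_of_le (abs_nonneg _) ?_
      refine le_trans ?_ (Finset.single_le_sum (f := fun a =>
        ∑ b, |lm (horo (-s) * k * horo s) a b - lm 1 a b|)
        (fun _ _ => Finset.sum_nonneg fun _ _ => abs_nonneg _) (Finset.mem_univ a))
      exact Finset.single_le_sum (f := fun b => |lm (horo (-s) * k * horo s) a b - lm 1 a b|)
        (fun _ _ => abs_nonneg _) (Finset.mem_univ b)

/-- In the variable `s / R` the nonconstant coefficients stay bounded, and a fixed shift `t` becomes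
`t / R → 0`. Hence the limiting values do not change under bounded translations of `s`. -/
theorem tendsto_pv_shift {A : Finset ({i : Fin d // i ≠ 0} →₀ ℕ)}
    {f : ℕ → ({i : Fin d // i ≠ 0} →₀ ℕ) → ℝ} {R : ℕ → ℝ} (hR0 : ∀ n, 0 < R n)
    (hR : Tendsto R atTop atTop) {ε : ℝ}
    (hf : ∀ n, ∀ m ∈ A, m ≠ 0 → R n ^ (∑ i, m i) * |f n m| ≤ ε) {s : ℕ → HVec d} {s' : HVec d}
    (hs : Tendsto (fun n => (R n)⁻¹ • s n) atTop (𝓝 s')) (t : HVec d) :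
    Tendsto (fun n => pv A (f n) (s n + t) - pv A (f n) (s n)) atTop (𝓝 0) := by
  have hst : Tendsto (fun n => (R n)⁻¹ • (s n + t)) atTop (𝓝 s') := by
    have h1 : Tendsto (fun n => (R n)⁻¹ • t) atTop (𝓝 ((0 : ℝ) • t)) :=
      hR.inv_tendsto_atTop.smul_const t
    have := hs.add h1
    rw [zero_smul, add_zero] at this
    exact this.congr fun n => (smul_add _ _ _).symm
  have hprod : ∀ (m : {i : Fin d // i ≠ 0} →₀ ℕ) {v : ℕ → HVec d},
      Tendsto v atTop (𝓝 s') → Tendsto (fun n => ∏ i, v n i ^ m i) atTop (𝓝 (∏ i, s' i ^ m i)) :=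
    fun m v hv => tendsto_finsetProd _ fun i _ => ((tendsto_pi_nhds.1 hv) i).pow _
  have hscale : ∀ (m : {i : Fin d // i ≠ 0} →₀ ℕ) (v : HVec d) n,
      ∏ i, v i ^ m i = R n ^ (∑ i, m i) * ∏ i, ((R n)⁻¹ • v) i ^ m i := fun m v n => by
    rw [← Finset.prod_pow_eq_pow_sum, ← Finset.prod_mul_distrib]
    refine Finset.prod_congr rfl fun i _ => ?_
    rw [← mul_pow, Pi.smul_apply, smul_eq_mul, mul_inv_cancel_left₀ (hR0 n).ne']
  have hterm : ∀ m ∈ A, Tendsto (fun n => f n m * ∏ i, (s n + t) i ^ m i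
      - f n m * ∏ i, s n i ^ m i) atTop (𝓝 0) := by
    intro m hm
    by_cases h0 : m = 0
    · simp [h0]
    · have h1 : Tendsto (fun n => ε * |∏ i, ((R n)⁻¹ • (s n + t)) i ^ m i
          - ∏ i, ((R n)⁻¹ • s n) i ^ m i|) atTop (𝓝 0) := by
        have := (((hprod m hst).sub (hprod m hs)).abs).const_mul ε
        rwa [sub_self, abs_zero, mul_zero] at this
      refine squeeze_zero_norm (fun n => ?_) h1
      rw [hscale m (s n + t) n, hscale m (s n) n, Real.norm_eq_abs]
      rw [show ∀ x y z w : ℝ, x * (y * z) - x * (y * w) = (y * x) * (z - w) by intros; ring, abs_mul,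
        abs_mul, abs_of_pos (pow_pos (hR0 n) _)]
      exact mul_le_mul_of_nonneg_right (hf n m hm h0) (abs_nonneg _)
  have := tendsto_finsetSum A hterm
  simp only [Finset.sum_const_zero] at this
  refine this.congr fun n => ?_
  rw [pv, pv, ← Finset.sum_sub_distrib]

/-- This converts a lower bound on the displacement of the matrix `horo t` into a lower bound on
`‖t‖`. -/
theorem exists_sum_abs_horoMat_le (d : ℕ) [NeZero d] : ∃ K > 0, ∀ t : HVec d, ‖t‖ ≤ 1 →
    ∑ a, ∑ b, |horoMat t a b - (1 : Matrix (LIdx d) (LIdx d) ℝ) a b| ≤ K * ‖t‖ := by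
  set D : ℝ := ((Fintype.card {i : Fin d // i ≠ 0} : ℕ) : ℝ) with hD
  have hD0 : 0 ≤ D := Nat.cast_nonneg _
  set L : ℝ := ((Fintype.card (LIdx d) : ℕ) : ℝ) with hL
  have hL0 : 0 ≤ L := Nat.cast_nonneg _
  refine ⟨L * (L * (1 + D)) + 1, by positivity, fun t ht => ?_⟩
  have hent : ∀ a b, |horoMat t a b - (1 : Matrix (LIdx d) (LIdx d) ℝ) a b| ≤ (1 + D) * ‖t‖ := by
    have hti : ∀ i, |t i| ≤ (1 + D) * ‖t‖ := fun i => by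
      have := norm_le_pi_norm t i
      rw [Real.norm_eq_abs] at this
      nlinarith [norm_nonneg t]
    have hpos : 0 ≤ (1 + D) * ‖t‖ := by positivity
    have htt : |(t ⬝ᵥ t) / 2| ≤ (1 + D) * ‖t‖ := by
      have h1 := abs_sum_mul_le (norm_nonneg t) (fun i => norm_le_pi_norm t i)
        fun i => norm_le_pi_norm t i
      rw [abs_div, abs_two]
      have h2 : |t ⬝ᵥ t| ≤ D * (‖t‖ * ‖t‖) := h1
      have h3 : D * (‖t‖ * ‖t‖) ≤ D * (‖t‖ * 1) := by gcongr
      nlinarith [norm_nonneg t]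
    intro a b
    rcases a with ⟨⟨⟩⟩ | i | ⟨⟨⟩⟩ <;> rcases b with ⟨⟨⟩⟩ | j | ⟨⟨⟩⟩ <;>
      simp [horoMat, Matrix.one_apply, hpos, hti, htt]
  calc ∑ a, ∑ b, |horoMat t a b - (1 : Matrix (LIdx d) (LIdx d) ℝ) a b|
      ≤ ∑ _a : LIdx d, ∑ _b : LIdx d, (1 + D) * ‖t‖ :=
        Finset.sum_le_sum fun a _ => Finset.sum_le_sum fun b _ => hent a b
    _ = L * (L * ((1 + D) * ‖t‖)) := by
        simp only [Finset.sum_const, Finset.card_univ, nsmul_eq_mul, hL]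
    _ ≤ _ := by nlinarith [norm_nonneg t]

theorem tendsto_expCoeff {g k : ℕ → SO0 d} (hg : Tendsto g atTop (𝓝 1)) (hk : Tendsto k atTop (𝓝 1))
    (j : Option (LIdx d × LIdx d)) (m : {i : Fin d // i ≠ 0} →₀ ℕ) :
    Tendsto (fun n => expCoeff (lm (k n) - 1) (colDev (g n)) j m) atTop (𝓝 0) := by
  rcases j with _ | ⟨a, b⟩
  · refine tendsto_vecCoeff (fun a => ?_) m
    have := (tendsto_lm hg a 𝔭).sub_const (lm 1 a 𝔭)
    rwa [sub_self] at this
  · refine tendsto_conjCoeff (fun a b => ?_) a b m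
    have := (tendsto_lm hk a b).sub_const (lm 1 a b)
    rw [sub_self] at this
    simpa [lm_one] using this

/-- Rescaled limits of pairs of nearby horospherical orbits that return to `Ω`: translates of a
relatively minimal set by elements of controlled size of `{(h, u h)}`, with `h` in the centralizer
of the geodesic flow and `u` horospherical. -/
theorem exists_levi_translate [Nonempty {i : Fin d // i ≠ 0}] {Γ₁ Γ₂ : Subgroup (SO0 d)}
    (hΓ₁ : DiscreteTopology Γ₁) (hcc : IsConvexCocompact Γ₁) (hz : IsZariskiDense Γ₁)
    (hc : CompactSpace (HomSpace Γ₂)) {X Y X' : Set (HomSpace Γ₁ × HomSpace Γ₂)}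
    (hY : IsRelMinimal X Y) (hX'c : IsClosed X') (hX' : IsInvariantUnder (diagU d) X') :
    ∃ C > 0, ∃ c > 0, ∃ ε₀ > 0, ∀ w ∈ Y ∩ Omega Γ₁ Γ₂, ∀ g : ℕ → SO0 d × SO0 d,
      Tendsto g atTop (𝓝 1) → (∀ n, act w (g n) ∈ X') →
      (∀ n, ¬ (IsPar (g n).1 ∧ ∃ t : HVec d, (g n).2 * ((g n).1)⁻¹ = horo t)) →
      ∀ ε, 0 < ε → ε ≤ ε₀ → ∃ (h : SO0 d) (t : HVec d), IsLevi h ∧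
        (∀ y ∈ Y, act y (h, horo t * h) ∈ X') ∧ (∀ a b, |lm h a b - lm 1 a b| ≤ C * ε) ∧
        ‖t‖ ≤ C * ε ∧ c * ε ≤ |lm h 𝔭 𝔭 - 1| + ‖t‖ ∧
        ((∀ n, (g n).1 = 1) → lm h 𝔭 𝔭 = 1) := by
  obtain ⟨A, hA⟩ := exists_isExpSupport d
  obtain ⟨C, hC, c, hc0, ε₁, hε₁, R₀, hR₀, hsh⟩ := exists_sheared_return hΓ₁ hcc hz hA
  obtain ⟨K, hK, hKt⟩ := exists_sum_abs_horoMat_le d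
  refine ⟨C, hC, c / (1 + K), by positivity, min ε₁ (1 / (2 * C)), by positivity,
    fun w hw g hg hgX hgne ε hε hεle => ?_⟩
  have hε1 : ε ≤ ε₁ := hεle.trans (min_le_left _ _)
  have hCε : C * ε ≤ 1 / 2 := by
    have : C * ε ≤ C * (1 / (2 * C)) := by gcongr; exact hεle.trans (min_le_right _ _)
    refine this.trans (le_of_eq ?_)
    field_simp
  have hpp : ∀ h : SO0 d, |lm h 𝔭 𝔭 - lm (1 : SO0 d) 𝔭 𝔭| ≤ 1 / 2 → lm h 𝔭 𝔭 ≠ 0 := fun h hh h0 => by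
    rw [h0, lm_one, Matrix.one_apply_eq] at hh
    norm_num at hh
  have hg1 : Tendsto (fun n => (g n).1) atTop (𝓝 1) := (continuous_fst.tendsto _).comp hg
  have hg2 : Tendsto (fun n => (g n).2) atTop (𝓝 1) := (continuous_snd.tendsto _).comp hg
  have hk : Tendsto (fun n => (g n).2 * ((g n).1)⁻¹) atTop (𝓝 1) := by
    have := hg2.mul hg1.inv
    rwa [inv_one, mul_one] at this
  -- pass to a tail on which the coefficients do not vanish identically
  obtain ⟨N, hN⟩ := eventually_atTop.1 (hg1.eventually (eventually_lm_lt one_half_pos))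
  obtain ⟨R, hR0, hR, hRle, hReq⟩ := exists_scale A
    (f := fun n => expCoeff (lm ((g (n + N)).2 * ((g (n + N)).1)⁻¹) - 1) (colDev (g (n + N)).1))
    (fun j m => (tendsto_expCoeff hg1 hk j m).comp (tendsto_add_atTop_nat N))
    (fun n => exists_expCoeff_ne_zero hA (hpp _ (hN (n + N) (by omega) 𝔭 𝔭).le) (hgne _)) hε
  have hev : ∀ᶠ n in atTop, 1 ≤ R n ∧ (∀ a b, |lm (g (n + N)).1 a b - lm 1 a b| ≤ ε) ∧
      ∀ j, |expCoeff (lm ((g (n + N)).2 * ((g (n + N)).1)⁻¹) - 1) (colDev (g (n + N)).1) j 0|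
        ≤ ε := by
    refine (hR.eventually_ge_atTop 1).and (Eventually.and ?_ (eventually_all.2 fun j => ?_))
    · filter_upwards [(tendsto_add_atTop_nat N).eventually (hg1.eventually (eventually_lm_lt hε))]
        with n hn a b using (hn a b).le
    · have := ((tendsto_expCoeff hg1 hk j 0).comp (tendsto_add_atTop_nat N)).abs
      rw [abs_zero] at this
      exact (this.eventually_lt_const hε).mono fun n hn => hn.le
  obtain ⟨N', hN'⟩ := eventually_atTop.1 hev
  obtain ⟨w₁, w₂⟩ := w
  obtain ⟨a₁, rfl⟩ := cl_surjective Γ₁ w₁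
  obtain ⟨a₂, rfl⟩ := cl_surjective Γ₂ w₂
  have ha : cl Γ₁ a₁ ∈ RF Γ₁ := hw.2.1
  -- returns, and convergent subsequences
  choose s σ hs hsR hbpp hb0 hbmid hb hzb hlow using fun n =>
    hsh a₁ (g (n + N' + N)).1 ((g (n + N' + N)).2 * ((g (n + N' + N)).1)⁻¹) (R (n + N')) ε ha
      (hN' (n + N') (by omega)).1 hε hε1 (hN' (n + N') (by omega)).2.1 (hN' (n + N') (by omega)).2.2
      (hRle (n + N')) (hReq (n + N'))
  set G : ℕ → SO0 d × SO0 d := fun n => g (n + N' + N) with hG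
  set b : ℕ → SO0 d := fun n => horo (-s n) * (G n).1 * horo (σ n) with hbdef
  set z : ℕ → SO0 d := fun n => horo (-s n) * ((G n).2 * ((G n).1)⁻¹) * horo (s n) with hzdef
  have hbd : ∀ {q : SO0 d}, (∀ a b, |lm q a b - lm 1 a b| ≤ C * ε) → ∀ a b, |lm q a b| ≤ 2 := by
    intro q hq a b
    have h1 := hq a b
    have h2 : |lm (1 : SO0 d) a b| ≤ 1 := by
      rw [lm_one, Matrix.one_apply]; split_ifs <;> simp
    have h3 := abs_add_le (lm q a b - lm 1 a b) (lm 1 a b)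
    rw [sub_add_cancel] at h3
    linarith
  obtain ⟨y, hyΩ, φ₁, δ, hφ₁, hδ, hyδ⟩ := exists_Omega_subseq hΓ₁ hcc hc
    (z := fun n => act (cl Γ₁ a₁, cl Γ₂ a₂) (horo (s n), horo (s n)))
    (fun n => (act_horo_mem_Omega_iff a₁ a₂ _).2 (hs n))
  obtain ⟨h, φ₂, hφ₂, hbh⟩ := exists_tendsto_subseq_of_bounded (g := b ∘ φ₁) (C := 2)
    fun n => hbd (hb _)
  obtain ⟨q, φ₃, hφ₃, hzq⟩ := exists_tendsto_subseq_of_bounded (g := z ∘ φ₁ ∘ φ₂) (C := 2)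
    fun n => hbd (hzb _)
  -- Convergence of the rescaled return times is needed for the shift invariance of the limiting
  -- polynomials.
  obtain ⟨s', -, φ₄, hφ₄, hss'⟩ := (isCompact_closedBall (0 : HVec d) R₀).tendsto_subseq
    (x := fun n => (R (φ₁ (φ₂ (φ₃ n)) + N'))⁻¹ • s (φ₁ (φ₂ (φ₃ n)))) (fun n => by
      rw [mem_closedBall_zero_iff, norm_smul, norm_inv, Real.norm_of_nonneg (hR0 _).le,
        inv_mul_le_iff₀ (hR0 _), mul_comm]
      exact hsR _)
  set ψ : ℕ → ℕ := fun n => φ₁ (φ₂ (φ₃ (φ₄ n))) with hψ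
  have hψm : Tendsto ψ atTop atTop :=
    (hφ₁.comp (hφ₂.comp (hφ₃.comp hφ₄))).tendsto_atTop
  have hbψ : Tendsto (fun n => b (ψ n)) atTop (𝓝 h) := hbh.comp (hφ₃.comp hφ₄).tendsto_atTop
  have hzψ : Tendsto (fun n => z (ψ n)) atTop (𝓝 q) := hzq.comp hφ₄.tendsto_atTop
  have hδψ : Tendsto (fun n => δ (φ₂ (φ₃ (φ₄ n)))) atTop (𝓝 1) :=
    hδ.comp (hφ₂.comp (hφ₃.comp hφ₄)).tendsto_atTop
  have hRψ : Tendsto (fun n => R (ψ n + N')) atTop atTop :=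
    (hR.comp (tendsto_add_atTop_nat N')).comp hψm
  have hbnd : ∀ {f : ℕ → SO0 d} {r : SO0 d}, Tendsto f atTop (𝓝 r) →
      (∀ n a b, |lm (f n) a b - lm 1 a b| ≤ C * ε) → ∀ a b, |lm r a b - lm 1 a b| ≤ C * ε :=
    fun hf hle a b => le_of_tendsto ((tendsto_lm hf a b).sub_const _).abs
      (Eventually.of_forall fun n => hle n a b)
  have hh1 := hbnd hbψ fun n => hb (ψ n)
  have hq1 := hbnd hzψ fun n => hzb (ψ n)
  have hhpp : lm h 𝔭 𝔭 ≠ 0 := hpp h ((hh1 _ _).trans hCε)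
  have hLevi : IsLevi h := by
    refine isLevi_of_entries (fun i => ?_) (fun i => ?_) hhpp
    · exact tendsto_nhds_unique (tendsto_lm hbψ _ _)
        (tendsto_const_nhds.congr fun n => (hb0 (ψ n) i).symm)
    · refine tendsto_nhds_unique (tendsto_lm hbψ _ _) (squeeze_zero_norm (fun n => hbmid (ψ n) i) ?_)
      exact tendsto_const_nhds.div_atTop hRψ
  -- Replacing `s n` by `s n + t` conjugates `z n` by `horo t` and does not change the limit, so `q`
  -- commutes with `𝒰`.
  obtain ⟨t, rfl⟩ : ∃ t : HVec d, q = horo t := by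
    refine eq_horo_of_commute fun t => ?_
    have hconj : horo (-t) * q * horo t = q := by
      apply lm_injective
      ext a b
      have h1 := tendsto_lm ((hzψ.const_mul (horo (-t))).mul_const (horo t)) a b
      have h2 := tendsto_lm hzψ a b
      have h3 := tendsto_pv_shift (A := A)
        (f := fun n => conjCoeff (lm ((G (ψ n)).2 * ((G (ψ n)).1)⁻¹) - 1) a b)
        (fun n => hR0 _) hRψ (fun n => hRle (ψ n + N') (some (a, b))) hss' t
      refine sub_eq_zero.1 (tendsto_nhds_unique (h1.sub h2) (h3.congr fun n => ?_))
      simp only [pv_conj_sub hA]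
      have e : ∀ x : SO0 d, horo (-(s (ψ n) + t)) * x * horo (s (ψ n) + t)
          = horo (-t) * (horo (-s (ψ n)) * x * horo (s (ψ n))) * horo t := fun x => by
        rw [horo_add, neg_add_rev, horo_add]
        group
      simp only [hψ] at e ⊢
      rw [e]
      ring
    rw [horo_neg, mul_assoc, inv_mul_eq_iff_eq_mul] at hconj
    exact hconj
  have hyY : y ∈ Y := by
    have h1 := tendsto_act y hδ
    rw [act_one] at h1
    refine hY.isClosed.mem_of_tendsto h1 (Eventually.of_forall fun n => ?_)
    rw [← hyδ]
    exact hY.invariant _ hw.1 _ (diag_horo_mem _)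
  -- The point `w g (u_σ, u_σ)` of `X'` equals `w (u_s, u_s) (b, z b)`, because `z b = u_{-s} g₂
  -- u_σ`; and `w (u_s, u_s) = y δ` with `δ → 1`.
  have hymem : act y (h, horo t * h) ∈ X' := by
    have h1 := tendsto_act y (hδψ.mul (hbψ.prodMk_nhds (hzψ.mul hbψ)))
    rw [one_mul] at h1
    refine hX'c.mem_of_tendsto h1 (Eventually.of_forall fun n => ?_)
    have h2 := hX' _ (hgX (ψ n + N' + N)) _ (diag_horo_mem (σ (ψ n)))
    have h3 := hyδ (φ₂ (φ₃ (φ₄ n)))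
    rw [← act_act, ← h3, act_act]
    rw [act_act] at h2
    convert h2 using 2
    refine Prod.ext ?_ ?_
    · simp only [Prod.fst_mul, hbdef, hG, horo_neg, hψ]
      group
    · simp only [Prod.snd_mul, hbdef, hzdef, hG, horo_neg, hψ]
      group
  have htn : ‖t‖ ≤ C * ε := by
    refine (pi_norm_le_iff_of_nonneg (by positivity)).2 fun i => ?_
    have := hq1 (𝔴 i) 𝔪
    rw [lm_horo, lm_one, Matrix.one_apply_ne (by simp), sub_zero] at this
    simpa [horoMat] using this
  refine ⟨h, t, hLevi, forall_act_mem_of_mem hY hX'c hX' hLevi ⟨hyY, hyΩ⟩ hymem, hh1, htn, ?_, ?_⟩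
  · have h1 : c * ε ≤ |lm h 𝔭 𝔭 - 1| + ∑ a, ∑ b, |lm (horo t) a b - lm 1 a b| :=
      ge_of_tendsto (((tendsto_lm hbψ 𝔭 𝔭).sub_const 1).abs.add
        (tendsto_finsetSum _ fun a _ => tendsto_finsetSum _ fun b _ =>
          ((tendsto_lm hzψ a b).sub_const _).abs)) (Eventually.of_forall fun n => hlow (ψ n))
    rw [lm_horo, lm_one] at h1
    have h2 := hKt t (htn.trans (hCε.trans (by norm_num)))
    have h3 := abs_nonneg (lm h 𝔭 𝔭 - 1)
    rw [div_mul_eq_mul_div, div_le_iff₀ (by positivity)]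
    nlinarith [norm_nonneg t]
  -- When `g` has trivial first component, `b` is a product of horospherical elements and its corner
  -- entry is `1`.
  · intro hone
    refine tendsto_nhds_unique (tendsto_lm hbψ 𝔭 𝔭) (tendsto_const_nhds.congr fun n => ?_)
    rw [hbpp]
    simp only [hone, mul_one, lm_horo]
    simp [horoMat]

theorem mem_diagH_iff {u : SO0 d × SO0 d} : u ∈ diagH d ↔ ∃ h, u = (h, h) :=
  ⟨fun ⟨h, hh⟩ => ⟨h, hh.symm⟩, fun ⟨h, hh⟩ => ⟨h, hh.symm⟩⟩

theorem IsInvariantUnder.diagU_of_diagH {Γ₁ Γ₂ : Subgroup (SO0 d)}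
    {X : Set (HomSpace Γ₁ × HomSpace Γ₂)} (hX : IsInvariantUnder (diagH d) X) :
    IsInvariantUnder (diagU d) X := fun z hz u hu => by
  obtain ⟨s, rfl⟩ := mem_diagU_iff.1 hu
  exact hX z hz _ (mem_diagH_iff.2 ⟨_, rfl⟩)

theorem isLevi_one : IsLevi (1 : SO0 d) := fun a b hab => by
  rw [lm_one, Matrix.one_apply_ne (fun h => hab (congrArg wt h))]

/-- If `X \ yH` is not closed, then `X` contains points `y (1, k)` with `k ≠ 1` arbitrarily small. -/
theorem exists_transverse_seq {Γ₁ Γ₂ : Subgroup (SO0 d)} {X : Set (HomSpace Γ₁ × HomSpace Γ₂)}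
    (hXc : IsClosed X) (hX : IsInvariantUnder (diagH d) X) {y : HomSpace Γ₁ × HomSpace Γ₂}
    (hy : ¬ IsClosed (X \ orbitOf y (diagH d))) :
    ∃ k : ℕ → SO0 d, Tendsto k atTop (𝓝 1) ∧ ∀ n, k n ≠ 1 ∧ act y (1, k n) ∈ X := by
  obtain ⟨x, hx, hxn⟩ : ∃ x ∈ closure (X \ orbitOf y (diagH d)), x ∉ X \ orbitOf y (diagH d) := by
    by_contra! hcon
    exact hy (isClosed_of_closure_subset hcon)
  have hxX : x ∈ X := hXc.closure_subset_iff.2 sdiff_subset hx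
  obtain ⟨u, hu, rfl⟩ : x ∈ orbitOf y (diagH d) := by
    by_contra h
    exact hxn ⟨hxX, h⟩
  obtain ⟨h, rfl⟩ := mem_diagH_iff.1 hu
  have hfr : ∃ᶠ g in 𝓝 (1 : SO0 d × SO0 d),
      act (act y (h, h)) g ∈ X \ orbitOf y (diagH d) := by
    have h1 := mem_closure_iff_frequently.1 hx
    have h2 := (isOpenMap_act (act y (h, h))).nhds_le (1 : SO0 d × SO0 d)
    simp only [act_one] at h2
    exact h1.filter_mono h2
  obtain ⟨g, hg, hgX⟩ := exists_seq_forall_of_frequently hfr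
  have hg1 : Tendsto (fun n => (g n).1) atTop (𝓝 1) := (continuous_fst.tendsto _).comp hg
  have hg2 : Tendsto (fun n => (g n).2) atTop (𝓝 1) := (continuous_snd.tendsto _).comp hg
  refine ⟨fun n => h * (g n).2 * ((g n).1)⁻¹ * h⁻¹, ?_, fun n => ⟨fun hk => ?_, ?_⟩⟩
  · have := ((hg2.const_mul h).mul hg1.inv).mul_const h⁻¹
    simpa using this
  · refine (hgX n).2 ⟨(h * (g n).1, h * (g n).1), mem_diagH_iff.2 ⟨_, rfl⟩, ?_⟩
    rw [act_act]
    congr 1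
    refine Prod.ext rfl ?_
    rw [mul_inv_eq_one, mul_inv_eq_iff_eq_mul] at hk
    exact hk
  · have h1 := hX _ (hgX n).1 _ (mem_diagH_iff.2 ⟨((g n).1)⁻¹ * h⁻¹, rfl⟩)
    rw [act_act, act_act] at h1
    convert h1 using 2
    refine Prod.ext ?_ ?_
    · simp only [Prod.fst_mul]; group
    · simp only [Prod.snd_mul]; group

/-- If some `k n` is already horospherical, minimality spreads it over `Y`. Otherwise the drift of
`(1, k n)` has corner entry `1`, so the lower bound falls entirely on `t`, and the factor `h` is
removed by the diagonal `H`. -/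
theorem exists_horo_translate [Nonempty {i : Fin d // i ≠ 0}] {Γ₁ Γ₂ : Subgroup (SO0 d)}
    (hΓ₁ : DiscreteTopology Γ₁) (hcc : IsConvexCocompact Γ₁) (hz : IsZariskiDense Γ₁)
    (hc : CompactSpace (HomSpace Γ₂)) {X Y : Set (HomSpace Γ₁ × HomSpace Γ₂)}
    (hXc : IsClosed X) (hX : IsInvariantUnder (diagH d) X) (hY : IsRelMinimal X Y)
    (hy : ∃ y ∈ Y ∩ Omega Γ₁ Γ₂, ¬ IsClosed (X \ orbitOf y (diagH d))) :
    ∃ s : HVec d, s ≠ 0 ∧ ∀ y ∈ Y, act y (1, horo s) ∈ X := by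
  obtain ⟨y, hyY, hyX⟩ := hy
  obtain ⟨k, hk, hkX⟩ := exists_transverse_seq hXc hX hyX
  by_cases hcase : ∃ n, ∃ t : HVec d, k n = horo t
  · obtain ⟨n, t, ht⟩ := hcase
    refine ⟨t, fun h0 => (hkX n).1 (by rw [ht, h0, horo_zero]), ?_⟩
    have h1 := forall_act_mem_of_mem hY hXc hX.diagU_of_diagH isLevi_one (t := t) hyY (by
      rw [mul_one, ← ht]; exact (hkX n).2)
    simpa only [mul_one] using h1
  · push Not at hcase
    obtain ⟨C, hC, c, hc0, ε₀, hε₀, hmain⟩ :=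
      exists_levi_translate hΓ₁ hcc hz hc hY hXc hX.diagU_of_diagH
    obtain ⟨h, t, -, hmem, -, -, hlow, hone⟩ := hmain y hyY (fun n => (1, k n))
      (tendsto_const_nhds.prodMk_nhds hk) (fun n => (hkX n).2)
      (fun n ⟨_, t, ht⟩ => hcase n t (by simpa using ht)) ε₀ hε₀ le_rfl
    rw [hone fun _ => rfl, sub_self, abs_zero, zero_add] at hlow
    refine ⟨t, fun h0 => ?_, fun y' hy' => ?_⟩
    · rw [h0, norm_zero] at hlow
      exact absurd hlow (not_le.2 (by positivity))
    · have h1 := hX _ (hmem y' hy') _ (mem_diagH_iff.2 ⟨h⁻¹, rfl⟩)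
      rw [act_act] at h1
      simpa using h1

/-! ### One-parameter subgroups -/

section BanachAlgebra

variable {𝔸 : Type*} [NormedRing 𝔸] [NormedAlgebra ℝ 𝔸] [CompleteSpace 𝔸]

theorem exp_add_smul (ξ : 𝔸) (s t : ℝ) :
    NormedSpace.exp ((s + t) • ξ) = NormedSpace.exp (s • ξ) * NormedSpace.exp (t • ξ) := by
  let : NormedAlgebra ℚ 𝔸 := .restrictScalars ℚ ℝ 𝔸
  rw [add_smul]
  exact NormedSpace.exp_add_of_commute (((Commute.refl ξ).smul_left s).smul_right t)

theorem exp_natCast_smul (ξ : 𝔸) (n : ℕ) (t : ℝ) :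
    NormedSpace.exp (((n : ℝ) * t) • ξ) = NormedSpace.exp (t • ξ) ^ n := by
  let : NormedAlgebra ℚ 𝔸 := .restrictScalars ℚ ℝ 𝔸
  rw [← NormedSpace.exp_nsmul, mul_smul, Nat.cast_smul_eq_nsmul]

theorem exp_zero_smul (ξ : 𝔸) : NormedSpace.exp ((0 : ℝ) • ξ) = 1 := by
  rw [zero_smul, NormedSpace.exp_zero]

theorem continuous_exp_smul (ξ : 𝔸) : Continuous fun t : ℝ => NormedSpace.exp (t • ξ) := by
  let : NormedAlgebra ℚ 𝔸 := .restrictScalars ℚ ℝ 𝔸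
  exact NormedSpace.exp_continuous.comp (continuous_id.smul continuous_const)

theorem norm_pow_sub_pow_le [NormOneClass 𝔸] {a b : 𝔸} {M : ℝ} (hM : 1 ≤ M) (ha : ‖a‖ ≤ M)
    (hb : ‖b‖ ≤ M) (n : ℕ) : ‖a ^ n - b ^ n‖ ≤ n * ‖a - b‖ * M ^ n := by
  induction n with
  | zero => simp
  | succ n ih =>
    have e : a ^ (n + 1) - b ^ (n + 1) = a ^ n * (a - b) + (a ^ n - b ^ n) * b := by
      rw [pow_succ, pow_succ, mul_sub, sub_mul]; abel
    have h1 : ‖a ^ n * (a - b)‖ ≤ M ^ n * ‖a - b‖ :=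
      (norm_mul_le _ _).trans (by
        gcongr
        exact (norm_pow_le a n).trans (by gcongr))
    have h2 : ‖(a ^ n - b ^ n) * b‖ ≤ n * ‖a - b‖ * M ^ n * M :=
      (norm_mul_le _ _).trans (by gcongr)
    have h3 : M ^ n * ‖a - b‖ ≤ M ^ n * ‖a - b‖ * M := le_mul_of_one_le_right (by positivity) hM
    rw [e]
    refine (norm_add_le _ _).trans ?_
    push_cast
    rw [pow_succ]
    nlinarith

/-- Powers of elements that approach the identity in the direction `ξ` converge to the one-parameter
group generated by `ξ`. -/
theorem tendsto_pow_exp [NormOneClass 𝔸] {a : ℕ → 𝔸} {ε : ℕ → ℝ} (hε : ∀ n, 0 < ε n)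
    (hε0 : Tendsto ε atTop (𝓝 0)) {ξ : 𝔸}
    (ha : Tendsto (fun n => (ε n)⁻¹ • (a n - 1)) atTop (𝓝 ξ)) {m : ℕ → ℕ} {r : ℝ}
    (hm : Tendsto (fun n => (m n : ℝ) * ε n) atTop (𝓝 r)) :
    Tendsto (fun n => a n ^ m n) atTop (𝓝 (NormedSpace.exp (r • ξ))) := by
  -- The exact exponentials `b n` have the desired powers. The difference of powers is at most `m ‖a
  -- - b‖ exp (ε K) ^ m`, where `‖a - b‖ = o(ε)` and `m ε` converges.
  set b : ℕ → 𝔸 := fun n => NormedSpace.exp (ε n • ξ) with hb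
  have hbξ : Tendsto (fun n => (ε n)⁻¹ • (b n - 1)) atTop (𝓝 ξ) := by
    have h1 := hasDerivAt_iff_tendsto_slope_zero.1 (hasDerivAt_exp_smul_const ξ (0 : ℝ))
    simp only [zero_add, exp_zero_smul, one_mul] at h1
    exact h1.comp (tendsto_nhdsWithin_iff.2 ⟨hε0, Eventually.of_forall fun n => (hε n).ne'⟩)
  have hbm : Tendsto (fun n => b n ^ m n) atTop (𝓝 (NormedSpace.exp (r • ξ))) := by
    have h1 := ((continuous_exp_smul ξ).tendsto r).comp hm
    exact h1.congr fun n => exp_natCast_smul ξ (m n) (ε n)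
  set K := ‖ξ‖ + 1 with hK
  have hle : ∀ {x : 𝔸} {t : ℝ}, 0 < t → ‖t⁻¹ • (x - 1)‖ < K → ‖x‖ ≤ Real.exp (t * K) := by
    intro x t ht hx
    rw [norm_smul, norm_inv, Real.norm_of_nonneg ht.le, inv_mul_lt_iff₀ ht] at hx
    have h1 : ‖x‖ ≤ ‖x - 1‖ + ‖(1 : 𝔸)‖ := by simpa using norm_add_le (x - 1) 1
    rw [norm_one] at h1
    linarith [Real.add_one_le_exp (t * K)]
  have hsub : Tendsto (fun n => a n ^ m n - b n ^ m n) atTop (𝓝 0) := by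
    have hdiff : Tendsto (fun n => ‖(ε n)⁻¹ • (a n - 1) - (ε n)⁻¹ • (b n - 1)‖) atTop (𝓝 0) := by
      have := (ha.sub hbξ).norm
      rwa [sub_self, norm_zero] at this
    have hbound : Tendsto (fun n => ((m n : ℝ) * ε n) *
        ‖(ε n)⁻¹ • (a n - 1) - (ε n)⁻¹ • (b n - 1)‖ * Real.exp ((m n : ℝ) * ε n * K)) atTop
        (𝓝 0) := by
      have := (hm.mul hdiff).mul ((Real.continuous_exp.tendsto _).comp (hm.mul_const K))
      simpa using this
    refine squeeze_zero_norm' ?_ hbound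
    filter_upwards [ha.norm.eventually_lt_const (lt_add_one ‖ξ‖),
      hbξ.norm.eventually_lt_const (lt_add_one ‖ξ‖)] with n h1 h2
    have hεK : 0 ≤ ε n * K := mul_nonneg (hε n).le (by positivity)
    refine (norm_pow_sub_pow_le (Real.one_le_exp hεK) (hle (hε n) h1) (hle (hε n) h2) _).trans
      (le_of_eq ?_)
    rw [← smul_sub, norm_smul, norm_inv, Real.norm_of_nonneg (hε n).le, sub_sub_sub_cancel_right,
      ← Real.exp_nat_mul, mul_assoc (m n : ℝ) (ε n), mul_inv_cancel_left₀ (hε n).ne', mul_assoc (m n : ℝ) (ε n) K]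
  simpa using hsub.add hbm

end BanachAlgebra

/-- The Banach algebra of operators on light-cone coordinates. -/
abbrev LOp (d : ℕ) [NeZero d] : Type := (LIdx d → ℝ) →L[ℝ] (LIdx d → ℝ)

/-- Matrices in light-cone coordinates as operators. -/
def toOp (d : ℕ) [NeZero d] : Matrix (LIdx d) (LIdx d) ℝ ≃ₐ[ℝ] LOp d :=
  Matrix.toLinAlgEquiv'.trans (Module.End.toContinuousLinearMap (LIdx d → ℝ))

theorem continuous_toOp : Continuous (toOp d) :=
  LinearMap.continuous_of_finiteDimensional (toOp d).toLinearMap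

theorem continuous_toOp_symm : Continuous (toOp d).symm :=
  LinearMap.continuous_of_finiteDimensional (toOp d).symm.toLinearMap

theorem exists_of_tendsto_toOp {g : ℕ → SO0 d} {T : LOp d}
    (h : Tendsto (fun n => toOp d (lm (g n))) atTop (𝓝 T)) :
    ∃ p : SO0 d, toOp d (lm p) = T ∧ Tendsto g atTop (𝓝 p) := by
  have h1 : Tendsto (fun n => lm (g n)) atTop (𝓝 ((toOp d).symm T)) := by
    have := (continuous_toOp_symm.tendsto T).comp h
    exact this.congr fun n => (toOp d).symm_apply_apply _
  obtain ⟨p, hp⟩ := isClosed_range_lm.mem_of_tendsto h1 (Eventually.of_forall fun n => ⟨g n, rfl⟩)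
  refine ⟨p, by rw [hp, AlgEquiv.apply_symm_apply], ?_⟩
  rw [isClosedEmbedding_lm.isInducing.tendsto_nhds_iff, hp]
  exact h1

theorem lm_pow (g : SO0 d) (n : ℕ) : lm (g ^ n) = lm g ^ n := by
  induction n with
  | zero => rw [pow_zero, pow_zero, lm_one]
  | succ n ih => rw [pow_succ, pow_succ, lm_mul, ih]

theorem toOp_lm_mul (g h : SO0 d) : toOp d (lm (g * h)) = toOp d (lm g) * toOp d (lm h) := by
  rw [lm_mul, map_mul]

theorem toOp_lm_inv {g : SO0 d} {N : LOp d} {r : ℝ} (h : toOp d (lm g) = NormedSpace.exp (r • N)) :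
    toOp d (lm g⁻¹) = NormedSpace.exp ((-r) • N) := by
  have h1 : toOp d (lm g) * NormedSpace.exp ((-r) • N) = 1 := by
    have h2 := exp_add_smul N r (-r)
    rw [add_neg_cancel, exp_zero_smul] at h2
    rw [h]
    exact h2.symm
  calc toOp d (lm g⁻¹) = toOp d (lm g⁻¹) * (toOp d (lm g) * NormedSpace.exp ((-r) • N)) := by
        rw [h1, mul_one]
    _ = _ := by rw [← mul_assoc, ← toOp_lm_mul, inv_mul_cancel, lm_one, map_one, one_mul]

theorem exists_tendsto_pow {g : ℕ → SO0 d} {ε : ℕ → ℝ} (hε : ∀ n, 0 < ε n)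
    (hε0 : Tendsto ε atTop (𝓝 0)) {N : Matrix (LIdx d) (LIdx d) ℝ}
    (hN : ∀ a b, Tendsto (fun n => (ε n)⁻¹ * (lm (g n) a b - lm 1 a b)) atTop (𝓝 (N a b)))
    {r : ℝ} (hr : 0 ≤ r) : ∃ p : SO0 d, toOp d (lm p) = NormedSpace.exp (r • toOp d N) ∧
      Tendsto (fun n => g n ^ ⌊r / ε n⌋₊) atTop (𝓝 p) := by
  refine exists_of_tendsto_toOp ?_
  have h1 : Tendsto (fun n => (ε n)⁻¹ • (lm (g n) - 1)) atTop (𝓝 N) := by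
    refine tendsto_pi_nhds.2 fun a => tendsto_pi_nhds.2 fun b => ?_
    have := hN a b
    rw [lm_one] at this
    exact this
  have h2 : Tendsto (fun n => (ε n)⁻¹ • (toOp d (lm (g n)) - 1)) atTop (𝓝 (toOp d N)) := by
    have := (continuous_toOp.tendsto N).comp h1
    refine this.congr fun n => ?_
    rw [Function.comp_apply, map_smul, map_sub, map_one]
  have h3 : Tendsto (fun n => (⌊r / ε n⌋₊ : ℝ) * ε n) atTop (𝓝 r) := by
    have h4 : Tendsto (fun n => r - ε n) atTop (𝓝 r) := by
      simpa using hε0.const_sub r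
    refine tendsto_of_tendsto_of_tendsto_of_le_of_le h4 tendsto_const_nhds (fun n => ?_)
      fun n => ?_
    · have h5 := Nat.lt_floor_add_one (r / ε n)
      rw [div_lt_iff₀ (hε n)] at h5
      change r - ε n ≤ _
      linarith
    · have h5 := Nat.floor_le (div_nonneg hr (hε n).le)
      rwa [le_div_iff₀ (hε n)] at h5
  refine (tendsto_pow_exp hε hε0 h2 h3).congr fun n => ?_
  rw [lm_pow, map_pow]

/-! ### Pairs in the normalizer of the horospherical group -/

/-- A horospherical element is recovered from its last column, so membership is an equation between
continuous functions. -/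
theorem isClosed_horospherical : IsClosed (horospherical d : Set (SO0 d)) := by
  have h : (horospherical d : Set (SO0 d)) =
      {u | lm u = horoMat fun i => lm u (𝔴 i) 𝔪} := by
    ext u
    rw [SetLike.mem_coe, mem_horospherical_iff, Set.mem_ofPred_eq]
    constructor
    · rintro ⟨s, rfl⟩
      rw [lm_horo]
      congr 1
    · intro hu
      exact ⟨_, lm_injective (hu.trans (lm_horo _).symm)⟩
  rw [h]
  have hc : Continuous fun u : SO0 d => lm (horo fun i => lm u (𝔴 i) 𝔪) :=
    continuous_lm.comp (continuous_horo.comp (continuous_pi fun i =>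
      (continuous_apply_apply (𝔴 i) 𝔪).comp continuous_lm))
  simp only [lm_horo] at hc
  exact isClosed_eq continuous_lm hc

theorem isClosed_isLevi : IsClosed {h : SO0 d | IsLevi h} := by
  simp only [IsLevi, Set.ofPred_forall]
  exact isClosed_iInter fun a => isClosed_iInter fun b => isClosed_iInter fun _ =>
    isClosed_eq ((continuous_apply_apply a b).comp continuous_lm) continuous_const

theorem isLevi_iff {h : SO0 d} : IsLevi h ↔ ∀ t, boost d (-t) * h * boost d t = h := by
  refine ⟨fun hh t => hh.boost_conj t, fun hh a b hab => ?_⟩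
  have h1 := lm_boost_conj 1 h a b
  rw [hh, mul_one] at h1
  by_contra h0
  have h2 : Real.exp (wt b - wt a) = 1 := by
    have := mul_right_cancel₀ h0 ((one_mul _).trans h1)
    exact this.symm
  rw [Real.exp_eq_one_iff, sub_eq_zero] at h2
  exact hab h2.symm

theorem IsLevi.mul {g h : SO0 d} (hg : IsLevi g) (hh : IsLevi h) : IsLevi (g * h) :=
  isLevi_iff.2 fun t => by
    calc boost d (-t) * (g * h) * boost d t
        = (boost d (-t) * g * boost d t) * (boost d (-t) * h * boost d t) := by
          rw [boost_neg]; group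
      _ = g * h := by rw [hg.boost_conj, hh.boost_conj]

theorem IsLevi.inv {h : SO0 d} (hh : IsLevi h) : IsLevi h⁻¹ :=
  isLevi_iff.2 fun t => by
    calc boost d (-t) * h⁻¹ * boost d t = (boost d (-t) * h * boost d t)⁻¹ := by
          rw [boost_neg]; group
      _ = h⁻¹ := by rw [hh.boost_conj]

/-- Pairs `(h, u h)` with `u` horospherical and `h` in the centralizer of the geodesic flow. -/
def leviHoro (d : ℕ) [NeZero d] : Subgroup (SO0 d × SO0 d) where
  carrier := {p | IsLevi p.1 ∧ p.2 * p.1⁻¹ ∈ horospherical d}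
  one_mem' := ⟨isLevi_one, by simp⟩
  mul_mem' := by
    rintro p q ⟨hp, hp'⟩ ⟨hq, hq'⟩
    refine ⟨hp.mul hq, ?_⟩
    have h1 := (horospherical d).mul_mem hp' (hp.inv.conj_mem hq')
    convert h1 using 1
    simp only [Prod.fst_mul, Prod.snd_mul]
    group
  inv_mem' := by
    rintro p ⟨hp, hp'⟩
    refine ⟨hp.inv, ?_⟩
    have h1 := hp.conj_mem ((horospherical d).inv_mem hp')
    convert h1 using 1
    simp only [Prod.fst_inv, Prod.snd_inv]
    group

theorem isClosed_leviHoro : IsClosed (leviHoro d : Set (SO0 d × SO0 d)) :=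
  (isClosed_isLevi.preimage continuous_fst).inter
    (isClosed_horospherical.preimage (continuous_snd.mul continuous_fst.inv))

/-- Write `p₂ v p₁⁻¹ = (p₂ p₁⁻¹) (p₁ v p₁⁻¹)`; the second factor is in `𝒰` because `p₁` normalizes
it. This is what keeps the final curve inside `U₂`. -/
theorem conj_mem_of_mem_leviHoro {p : SO0 d × SO0 d} (hp : p ∈ leviHoro d) {v : SO0 d}
    (hv : v ∈ horospherical d) : p.2 * v * p.1⁻¹ ∈ horospherical d := by
  have h1 := (horospherical d).mul_mem hp.2 (hp.1.inv.conj_mem hv)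
  convert h1 using 1
  group

/-! ### The analytic curve -/

/-- The infinitesimal generator of `r ↦ horo (r • τ)`. -/
def horoGen (τ : HVec d) : Matrix (LIdx d) (LIdx d) ℝ :=
  Matrix.of (Sum.elim (fun _ => Sum.elim (fun _ => 0) (Sum.elim τ (fun _ => 0)))
    (Sum.elim (fun i => Sum.elim (fun _ => 0) (Sum.elim (fun _ => 0) (fun _ => τ i)))
      (fun _ _ => 0)))

theorem tendsto_horoMat_sub {t : ℕ → HVec d} {ε : ℕ → ℝ} (ht : Tendsto t atTop (𝓝 0))
    {τ : HVec d} (hτ : Tendsto (fun n => (ε n)⁻¹ • t n) atTop (𝓝 τ)) (a b : LIdx d) :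
    Tendsto (fun n => (ε n)⁻¹ * (horoMat (t n) a b - (1 : Matrix (LIdx d) (LIdx d) ℝ) a b)) atTop
      (𝓝 (horoGen τ a b)) := by
  have h1 : ∀ i, Tendsto (fun n => (ε n)⁻¹ * t n i) atTop (𝓝 (τ i)) := tendsto_pi_nhds.1 hτ
  have h2 : Tendsto (fun n => (ε n)⁻¹ * ((t n ⬝ᵥ t n) / 2)) atTop (𝓝 0) := by
    have h3 : Tendsto (fun n => ∑ i, ((ε n)⁻¹ * t n i) * (t n i / 2)) atTop
        (𝓝 (∑ i, τ i * (0 / 2))) :=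
      tendsto_finsetSum _ fun i _ => (h1 i).mul (((tendsto_pi_nhds.1 ht) i).div_const 2)
    simp only [zero_div, mul_zero, Finset.sum_const_zero] at h3
    refine h3.congr fun n => ?_
    rw [dotProduct, Finset.sum_div, Finset.mul_sum]
    exact Finset.sum_congr rfl fun i _ => by ring
  rcases a with ⟨⟨⟩⟩ | i | ⟨⟨⟩⟩ <;> rcases b with ⟨⟨⟩⟩ | j | ⟨⟨⟩⟩ <;>
    simp [horoMat, horoGen, Matrix.one_apply, h1, h2]

theorem isCompact_setOf_abs_le {α β : Type*} (C : ℝ) :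
    IsCompact {f : α → β → ℝ | ∀ a b, |f a b| ≤ C} := by
  have h : {f : α → β → ℝ | ∀ a b, |f a b| ≤ C} =
      Set.pi univ fun _ => Set.pi univ fun _ => Icc (-C) C := by
    ext f
    simp only [Set.mem_ofPred_eq, Set.mem_pi, Set.mem_univ, true_implies, mem_Icc, abs_le]
  rw [h]
  exact isCompact_univ_pi fun _ => isCompact_univ_pi fun _ => isCompact_Icc

/-- A relatively minimal set is invariant under a one-parameter semigroup that is transverse to the
centralizer of the horospherical group. -/
theorem exists_generator [Nonempty {i : Fin d // i ≠ 0}] {Γ₁ Γ₂ : Subgroup (SO0 d)}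
    (hΓ₁ : DiscreteTopology Γ₁) (hcc : IsConvexCocompact Γ₁) (hz : IsZariskiDense Γ₁)
    (hc : CompactSpace (HomSpace Γ₂)) {X Y : Set (HomSpace Γ₁ × HomSpace Γ₂)}
    (hY : IsRelMinimal X Y) :
    ∃ (N : Matrix (LIdx d) (LIdx d) ℝ) (τ : HVec d), N 𝔪 𝔪 = -N 𝔭 𝔭 ∧
      (∀ a b, wt a ≠ wt b → N a b = 0) ∧ (N 𝔭 𝔭 ≠ 0 ∨ τ ≠ 0) ∧
      ∀ r : ℝ, ∃ p ∈ leviHoro d, toOp d (lm p.1) = NormedSpace.exp (r • toOp d N) ∧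
        toOp d (lm p.2) = NormedSpace.exp (r • toOp d (N + horoGen τ)) ∧
        (0 ≤ r → ∀ y ∈ Y, act y p ∈ Y) := by
  obtain ⟨w, hw, hfr⟩ := exists_transverse_return hΓ₁ hcc hz hc hY
  obtain ⟨g, hg, hgY⟩ := exists_seq_forall_of_frequently hfr
  obtain ⟨C, hC, c, hc0, ε₀, hε₀, hmain⟩ :=
    exists_levi_translate hΓ₁ hcc hz hc hY hY.isClosed hY.invariant
  -- Translates are taken at sizes `ε₀ / (n + 1)`. Below, `N` and `τ` are limits of their
  -- displacements divided by these sizes.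
  choose h' t' hLevi' hmem' hh' ht' hlow' _ using fun n : ℕ =>
    hmain w hw g hg (fun n => (hgY n).1) (fun n hn => (hgY n).2 hn.1) (ε₀ * (1 / ((n : ℝ) + 1)))
      (by positivity) (mul_le_of_le_one_right hε₀.le (by
        rw [div_le_one (by positivity)]
        linarith [Nat.cast_nonneg (α := ℝ) n]))
  set ε' : ℕ → ℝ := fun n => ε₀ * (1 / ((n : ℝ) + 1)) with hε'
  have hε'pos : ∀ n, 0 < ε' n := fun n => by positivity
  have hε'0 : Tendsto ε' atTop (𝓝 0) := by
    simpa only [mul_zero] using (tendsto_one_div_add_atTop_nhds_zero_nat (𝕜 := ℝ)).const_mul ε₀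
  obtain ⟨N, φ, hφ, hN'⟩ : ∃ (N : Matrix (LIdx d) (LIdx d) ℝ) (φ : ℕ → ℕ), StrictMono φ ∧
      ∀ a b, Tendsto (fun n => (ε' (φ n))⁻¹ * (lm (h' (φ n)) a b - lm 1 a b)) atTop
        (𝓝 (N a b)) := by
    obtain ⟨N, -, φ, hφ, hN'⟩ :=
      (isCompact_setOf_abs_le (α := LIdx d) (β := LIdx d) C).tendsto_subseq
        (x := fun n a b => (ε' n)⁻¹ * (lm (h' n) a b - lm 1 a b)) (fun n a b => by
          rw [abs_mul, abs_of_pos (inv_pos.2 (hε'pos n)), inv_mul_le_iff₀ (hε'pos n), mul_comm]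
          exact hh' n a b)
    exact ⟨N, φ, hφ, fun a b => tendsto_pi_nhds.1 ((tendsto_pi_nhds.1 hN') a) b⟩
  obtain ⟨τ, -, ψ, hψ, hτ⟩ := (isCompact_closedBall (0 : HVec d) C).tendsto_subseq
    (x := fun n => (ε' (φ n))⁻¹ • t' (φ n)) (fun n => by
      rw [mem_closedBall_zero_iff, norm_smul, norm_inv, Real.norm_of_nonneg (hε'pos _).le,
        inv_mul_le_iff₀ (hε'pos _), mul_comm]
      exact ht' _)
  have hφψ : Tendsto (fun n => φ (ψ n)) atTop atTop := (hφ.comp hψ).tendsto_atTop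
  set ε : ℕ → ℝ := fun n => ε' (φ (ψ n)) with hε
  set h : ℕ → SO0 d := fun n => h' (φ (ψ n)) with hh
  set t : ℕ → HVec d := fun n => t' (φ (ψ n)) with ht
  have hεpos : ∀ n, 0 < ε n := fun n => hε'pos _
  have hε0 : Tendsto ε atTop (𝓝 0) := hε'0.comp hφψ
  have hN : ∀ a b, Tendsto (fun n => (ε n)⁻¹ * (lm (h n) a b - lm 1 a b)) atTop (𝓝 (N a b)) :=
    fun a b => (hN' a b).comp hψ.tendsto_atTop
  replace hτ : Tendsto (fun n => (ε n)⁻¹ • t n) atTop (𝓝 τ) := hτ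
  have hh1 : Tendsto h atTop (𝓝 1) := by
    refine tendsto_iff_lm.2 fun a b => tendsto_iff_norm_sub_tendsto_zero.2 ?_
    refine squeeze_zero (fun n => norm_nonneg _) (fun n => hh' (φ (ψ n)) a b) ?_
    simpa only [mul_zero] using hε0.const_mul C
  have ht0 : Tendsto t atTop (𝓝 0) := by
    refine squeeze_zero_norm (fun n => ht' (φ (ψ n))) ?_
    simpa only [mul_zero] using hε0.const_mul C
  have hN2 : ∀ a b, Tendsto (fun n => (ε n)⁻¹ * (lm (horo (t n) * h n) a b - lm 1 a b)) atTop
      (𝓝 ((N + horoGen τ) a b)) := fun a b => by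
    have h1 : Tendsto (fun n => ∑ k, (ε n)⁻¹ * (horoMat (t n) a k
        - (1 : Matrix (LIdx d) (LIdx d) ℝ) a k) * lm (h n) k b) atTop
        (𝓝 (∑ k, horoGen τ a k * lm 1 k b)) :=
      tendsto_finsetSum _ fun k _ => (tendsto_horoMat_sub ht0 hτ a k).mul (tendsto_lm hh1 k b)
    have h2 := (hN a b).add h1
    have e : ∑ k, horoGen τ a k * lm 1 k b = horoGen τ a b := by
      rw [← Matrix.mul_apply, lm_one, mul_one]
    rw [e] at h2
    refine h2.congr fun n => ?_
    have e2 : ∑ k, (ε n)⁻¹ * (horoMat (t n) a k - (1 : Matrix (LIdx d) (LIdx d) ℝ) a k)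
        * lm (h n) k b = (ε n)⁻¹ * ((horoMat (t n) - 1) * lm (h n)) a b := by
      rw [Matrix.mul_apply, Finset.mul_sum]
      exact Finset.sum_congr rfl fun k _ => by rw [Matrix.sub_apply, mul_assoc]
    rw [e2, lm_mul, lm_horo, sub_mul, one_mul, Matrix.sub_apply]
    ring
  have hmW : ∀ n, (h n, horo (t n) * h n) ∈ leviHoro d := fun n =>
    ⟨hLevi' _, by
      change horo (t n) * h n * (h n)⁻¹ ∈ _
      rw [mul_inv_cancel_right]
      exact horo_mem _⟩
  have hpowY : ∀ n k, ∀ y ∈ Y, act y ((h n, horo (t n) * h n) ^ k) ∈ Y := fun n k => by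
    induction k with
    | zero => intro y hy; rwa [pow_zero, act_one]
    | succ k ih =>
      intro y hy
      rw [pow_succ, ← act_act]
      exact hmem' _ _ (ih y hy)
  refine ⟨N, τ, ?_, fun a b hab => ?_, ?_, fun r => ?_⟩
  -- This is the first-order form of the relation that the two corner entries of `h n` have product
  -- `1`.
  · have h1 : Tendsto (fun n => -((ε n)⁻¹ * (lm (h n) 𝔭 𝔭 - lm (1 : SO0 d) 𝔭 𝔭)) * lm (h n) 𝔪 𝔪) atTop
        (𝓝 (-N 𝔭 𝔭 * lm (1 : SO0 d) 𝔪 𝔪)) := (hN 𝔭 𝔭).neg.mul (tendsto_lm hh1 𝔪 𝔪)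
    rw [lm_one, Matrix.one_apply_eq, Matrix.one_apply_eq, mul_one] at h1
    refine tendsto_nhds_unique (hN 𝔪 𝔪) (h1.congr' ?_)
    have h2 : ∀ᶠ n in atTop, |lm (h n) 𝔭 𝔭 - lm (1 : SO0 d) 𝔭 𝔭| < 1 := by
      filter_upwards [hh1.eventually (eventually_lm_lt one_pos)] with n hn using hn 𝔭 𝔭
    filter_upwards [h2] with n hn
    have h0 : lm (h n) 𝔭 𝔭 ≠ 0 := fun h0 => by
      rw [h0, lm_one, Matrix.one_apply_eq] at hn
      norm_num at hn
    obtain ⟨-, -, h3⟩ := lm_col_minus (fun i => hLevi' (φ (ψ n)) 𝔭 (𝔴 i) (by simp [wt])) h0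
    rw [lm_one, Matrix.one_apply_eq]
    linear_combination (-(ε n)⁻¹) * h3
  · refine tendsto_nhds_unique (hN a b) (tendsto_const_nhds.congr fun n => ?_)
    rw [hLevi' (φ (ψ n)) a b hab, isLevi_one a b hab, sub_zero, mul_zero]
  -- The lower bound `c * ε` on the displacement survives division by `ε`, so the flow component of
  -- `N` and `τ` cannot both vanish.
  · by_contra! hcon
    have h1 : Tendsto (fun n => |(ε n)⁻¹ * (lm (h n) 𝔭 𝔭 - lm (1 : SO0 d) 𝔭 𝔭)| + ‖(ε n)⁻¹ • t n‖) atTop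
        (𝓝 (|N 𝔭 𝔭| + ‖τ‖)) := (hN 𝔭 𝔭).abs.add hτ.norm
    rw [hcon.1, hcon.2, abs_zero, norm_zero, add_zero] at h1
    have h2 : c ≤ 0 := ge_of_tendsto h1 (Eventually.of_forall fun n => by
      have h3 := hlow' (φ (ψ n))
      rw [abs_mul, norm_smul, norm_inv, Real.norm_of_nonneg (hεpos n).le,
        abs_of_pos (inv_pos.2 (hεpos n)), ← mul_add, le_inv_mul_iff₀ (hεpos n), mul_comm, lm_one,
        Matrix.one_apply_eq]
      exact h3)
    linarith
  · have key : ∀ r : ℝ, 0 ≤ r → ∃ p ∈ leviHoro d, toOp d (lm p.1) = NormedSpace.exp (r • toOp d N) ∧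
        toOp d (lm p.2) = NormedSpace.exp (r • toOp d (N + horoGen τ)) ∧
        ∀ y ∈ Y, act y p ∈ Y := fun r hr => by
      obtain ⟨p₁, hp₁, hl₁⟩ := exists_tendsto_pow hεpos hε0 hN hr
      obtain ⟨p₂, hp₂, hl₂⟩ := exists_tendsto_pow hεpos hε0 hN2 hr
      have hl : Tendsto (fun n => (h n, horo (t n) * h n) ^ ⌊r / ε n⌋₊) atTop (𝓝 (p₁, p₂)) :=
        hl₁.prodMk_nhds hl₂
      exact ⟨(p₁, p₂), isClosed_leviHoro.mem_of_tendsto hl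
        (Eventually.of_forall fun n => (leviHoro d).pow_mem (hmW n) _), hp₁, hp₂, fun y hy =>
        hY.isClosed.mem_of_tendsto (tendsto_act y hl) (Eventually.of_forall fun n => hpowY n _ y hy)⟩
    -- Negative `r` is obtained by inversion and carries no invariance of `Y`. It serves only to
    -- define the curve on both sides of `0`, so that it has a two-sided derivative there.
    rcases le_total 0 r with hr | hr
    · obtain ⟨p, hp, h1, h2, h3⟩ := key r hr
      exact ⟨p, hp, h1, h2, fun _ => h3⟩
    · obtain ⟨p, hp, h1, h2, h3⟩ := key (-r) (by linarith)
      rcases hr.eq_or_lt with rfl | hlt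
      · rw [neg_zero] at h1 h2
        exact ⟨p, hp, h1, h2, fun _ => h3⟩
      · refine ⟨p⁻¹, (leviHoro d).inv_mem hp, ?_, ?_, fun h0 => absurd h0 (not_le.2 hlt)⟩
        · have := toOp_lm_inv h1
          rwa [neg_neg] at this
        · have := toOp_lm_inv h2
          rwa [neg_neg] at this

theorem hasDerivAt_exp_conj {𝔸 : Type*} [NormedRing 𝔸] [NormedAlgebra ℝ 𝔸] [CompleteSpace 𝔸]
    (ξ η v : 𝔸) : HasDerivAt
      (fun r : ℝ => NormedSpace.exp (r • ξ) * v * NormedSpace.exp ((-r) • η)) (ξ * v - v * η) 0 := by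
  have h1 := (hasDerivAt_exp_smul_const ξ (0 : ℝ)).mul_const v
  have h2 := hasDerivAt_exp_smul_const (-η) (0 : ℝ)
  have h3 := h1.mul h2
  rw [exp_zero_smul, exp_zero_smul, one_mul, one_mul, mul_one, one_mul, mul_neg,
    ← sub_eq_add_neg] at h3
  refine h3.congr_of_eventuallyEq (Eventually.of_forall fun r => ?_)
  simp only [Pi.mul_apply, neg_smul, smul_neg]

theorem analyticAt_exp_conj {𝔸 : Type*} [NormedRing 𝔸] [NormedAlgebra ℝ 𝔸] [CompleteSpace 𝔸]
    (ξ η v : 𝔸) (r : ℝ) : AnalyticAt ℝ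
      (fun r : ℝ => NormedSpace.exp (r • ξ) * v * NormedSpace.exp ((-r) • η)) r := by
  have h : ∀ (ζ : 𝔸), AnalyticAt ℝ (fun r : ℝ => NormedSpace.exp (r • ζ)) r := fun ζ =>
    AnalyticAt.comp (f := fun r : ℝ => r • ζ) (NormedSpace.exp_analytic (𝕂 := ℝ) (r • ζ))
      (analyticAt_id.smul analyticAt_const)
  have h1 := ((h ξ).mul analyticAt_const (g := fun _ => v)).mul (h (-η))
  refine h1.congr (Eventually.of_forall fun r => ?_)
  simp only [Pi.mul_apply, neg_smul, smul_neg]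

/-- The matrix in the standard coordinates of an operator in light-cone coordinates. -/
def opEntries (d : ℕ) [NeZero d] : LOp d →L[ℝ] (Idx d → Idx d → ℝ) :=
  LinearMap.toContinuousLinearMap
    ((toOp d).symm.trans (lightConj d).symm).toLinearMap

theorem opEntries_injective : Function.Injective (opEntries d) :=
  ((toOp d).symm.trans (lightConj d).symm).injective

theorem opEntries_toOp_lm (g : SO0 d) : opEntries d (toOp d (lm g)) = fun i j => g.1.1 i j := by
  change (lightConj d).symm ((toOp d).symm (toOp d (lm g))) = _
  rw [AlgEquiv.symm_apply_apply, lm_eq, AlgEquiv.symm_apply_apply]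

theorem horoGen_eq_zero_iff {τ : HVec d} : horoGen τ = 0 ↔ τ = 0 := by
  constructor
  · intro h
    funext i
    exact congrFun (congrFun h (𝔴 i)) 𝔪
  · rintro rfl
    ext a b
    rcases a with ⟨⟨⟩⟩ | i | ⟨⟨⟩⟩ <;> rcases b with ⟨⟨⟩⟩ | j | ⟨⟨⟩⟩ <;> simp [horoGen]

/-- Compare the entries `(𝔭, 𝔪)`: they are `± N 𝔭 𝔭 * (s ⬝ᵥ s) / 2`, since the corner entries of `N`
are opposite. -/
theorem mul_horoMat_ne {N : Matrix (LIdx d) (LIdx d) ℝ} (hN : N 𝔪 𝔪 = -N 𝔭 𝔭)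
    (hN0 : ∀ a b, wt a ≠ wt b → N a b = 0) (h0 : N 𝔭 𝔭 ≠ 0) {s : HVec d} (hs : s ≠ 0) :
    N * horoMat s ≠ horoMat s * N := by
  intro h
  have h1 := congrFun (congrFun h 𝔭) 𝔪
  have e1 : ∀ i, N 𝔭 (𝔴 i) = 0 := fun i => hN0 _ _ (by simp [wt])
  have e2 : ∀ i, N (𝔴 i) 𝔪 = 0 := fun i => hN0 _ _ (by simp [wt])
  have e3 : N 𝔭 𝔪 = 0 := hN0 _ _ (by norm_num [wt])
  simp only [Matrix.mul_apply, Fintype.sum_sum_type, Finset.univ_unique, Finset.sum_singleton,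
    PUnit.default_eq_unit, e1, e2, e3, hN] at h1
  simp [horoMat] at h1
  have h2 : N 𝔭 𝔭 * (s ⬝ᵥ s) = 0 := by linarith
  rcases mul_eq_zero.1 h2 with h3 | h3
  · exact h0 h3
  · exact hs (dotProduct_self_eq_zero.1 h3)

/-- Translates of a relatively minimal set along an analytic curve in `U₂`. -/
theorem exists_analytic_curve [Nonempty {i : Fin d // i ≠ 0}] {Γ₁ Γ₂ : Subgroup (SO0 d)}
    (hΓ₁ : DiscreteTopology Γ₁) (hcc : IsConvexCocompact Γ₁) (hz : IsZariskiDense Γ₁)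
    (hc : CompactSpace (HomSpace Γ₂)) {X Y : Set (HomSpace Γ₁ × HomSpace Γ₂)}
    (hXc : IsClosed X) (hX : IsInvariantUnder (diagH d) X) (hY : IsRelMinimal X Y)
    (hy : ∃ y ∈ Y ∩ Omega Γ₁ Γ₂, ¬ IsClosed (X \ orbitOf y (diagH d))) :
    ∃ C : ℝ → U₂ d, AnalyticOnNhd ℝ (fun t => entries (C t).1) (Icc 0 1) ∧
      deriv (fun t => entries (C t).1) 0 ≠ 0 ∧
      ∀ y ∈ Y, ∀ t ∈ Icc (0 : ℝ) 1, act y (C t).1 ∈ X := by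
  obtain ⟨N, τ, hN, hN0, hne, hp⟩ := exists_generator hΓ₁ hcc hz hc hY
  choose p hpW hp1 hp2 hpY using hp
  -- The last condition on `v` is the nonvanishing of the derivative of the curve at `0`. The
  -- existence of a point with `X \ yH` not closed is used only when `τ = 0`.
  obtain ⟨v, hvX, hvU, hv⟩ : ∃ v : SO0 d, (∀ y ∈ Y, act y (1, v) ∈ X) ∧ v ∈ horospherical d ∧
      (N + horoGen τ) * lm v ≠ lm v * N := by
    by_cases hτ : τ = 0
    · obtain ⟨s, hs, hsX⟩ := exists_horo_translate hΓ₁ hcc hz hc hXc hX hY hy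
      refine ⟨horo s, hsX, horo_mem s, ?_⟩
      rw [horoGen_eq_zero_iff.2 hτ, add_zero, lm_horo]
      exact mul_horoMat_ne hN hN0 (hne.resolve_right (not_not.2 hτ)) hs
    · refine ⟨1, fun y hy => ?_, one_mem _, ?_⟩
      · rw [← Prod.one_eq_mk, act_one]
        exact hY.subset hy
      · rw [lm_one, mul_one, one_mul, ne_eq, add_eq_left, horoGen_eq_zero_iff]
        exact hτ
  let q : ℝ → SO0 d := fun r => (p r).2 * v * (p r).1⁻¹
  have hent : (fun r => entries ((1, q r) : SO0 d × SO0 d)) = fun r =>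
      ((fun i j => (1 : SO0 d).1.1 i j), opEntries d (NormedSpace.exp (r • toOp d (N + horoGen τ)) *
        toOp d (lm v) * NormedSpace.exp ((-r) • toOp d N))) := by
    funext r
    rw [← hp2, ← toOp_lm_inv (hp1 r), ← toOp_lm_mul, ← toOp_lm_mul, opEntries_toOp_lm]
    rfl
  refine ⟨fun r => ⟨(1, q r), Subgroup.mem_prod.2 ⟨Subgroup.mem_bot.2 rfl,
    conj_mem_of_mem_leviHoro (hpW r) hvU⟩⟩, ?_, ?_, fun y hyY r hr => ?_⟩
  · change AnalyticOnNhd ℝ (fun r => entries ((1, q r) : SO0 d × SO0 d)) _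
    rw [hent]
    intro r _
    exact analyticAt_const.prod ((opEntries d).analyticAt _ |>.comp
      (analyticAt_exp_conj (toOp d (N + horoGen τ)) (toOp d N) (toOp d (lm v)) r))
  · change deriv (fun r => entries ((1, q r) : SO0 d × SO0 d)) 0 ≠ 0
    rw [hent]
    have h1 := (opEntries d).hasFDerivAt.comp_hasDerivAt (0 : ℝ)
      (hasDerivAt_exp_conj (toOp d (N + horoGen τ)) (toOp d N) (toOp d (lm v)))
    have h2 := ((hasDerivAt_const (0 : ℝ) fun i j => (1 : SO0 d).1.1 i j).prodMk h1).deriv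
    intro h3
    have h4 := congrArg Prod.snd (h2.symm.trans h3)
    simp only [Prod.snd_zero] at h4
    rw [← map_zero (opEntries d)] at h4
    have h5 := opEntries_injective h4
    rw [← map_mul, ← map_mul, sub_eq_zero] at h5
    exact hv ((toOp d).injective h5)
  -- Translate by `p r` inside `Y`, then by `(1, v)` into `X`, then by the diagonal element `(p₁⁻¹,
  -- p₁⁻¹)`.
  · have h1 := hvX _ (hpY r hr.1 y hyY)
    have h2 := hX _ h1 _ (mem_diagH_iff.2 ⟨((p r).1)⁻¹, rfl⟩)
    rw [act_act, act_act] at h2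
    convert h2 using 2
    refine Prod.ext ?_ ?_
    · simp
    · simp [q, mul_assoc]

end HypDyn

end

theorem mainTheorem4 (d : ℕ) [d.AtLeastTwo]
    (Γ₁ Γ₂ : Subgroup (HypDyn.SO0 d))
    (hΓ₁_discrete : DiscreteTopology Γ₁)
    (hΓ₁_zariski : HypDyn.IsZariskiDense Γ₁)
    (hΓ₁_torsionFree : HypDyn.IsTorsionFreeSubgroup Γ₁)
    (hΓ₁_convexCocompact : HypDyn.IsConvexCocompact Γ₁)
    (hΓ₂_discrete : DiscreteTopology Γ₂)
    (hΓ₂_torsionFree : HypDyn.IsTorsionFreeSubgroup Γ₂)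
    (hΓ₂_cocompact : CompactSpace (HypDyn.HomSpace Γ₂))
    (X Y : Set (HypDyn.HomSpace Γ₁ × HypDyn.HomSpace Γ₂))
    (hX_closed : IsClosed X)
    (hX_inv : HypDyn.IsInvariantUnder (HypDyn.diagH d) X)
    (hY : HypDyn.IsRelMinimal X Y)
    (hy : ∃ y ∈ Y ∩ HypDyn.Omega Γ₁ Γ₂, ¬ IsClosed (X \ HypDyn.orbitOf y (HypDyn.diagH d))) :
    ∃ C : ℝ → HypDyn.U₂ d,
      AnalyticOnNhd ℝ (fun t => HypDyn.entries (C t).1) (Set.Icc 0 1) ∧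
      deriv (fun t => HypDyn.entries (C t).1) 0 ≠ 0 ∧
      ∀ y ∈ Y, ∀ t ∈ Set.Icc (0 : ℝ) 1, HypDyn.act y (C t).1 ∈ X := by
  have : Nontrivial (Fin d) := Fin.nontrivial_iff_two_le.2 Nat.AtLeastTwo.prop
  have : Nonempty {i : Fin d // i ≠ 0} := nonempty_subtype.2 (exists_ne 0)
  exact HypDyn.exists_analytic_curve hΓ₁_discrete hΓ₁_convexCocompact hΓ₁_zariski hΓ₂_cocompact
    hX_closed hX_inv hY hy
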